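/- Let $\mathcal C\in\{\mathrm{AIII},\mathrm{BDI},\mathrm{CII}\}$ and put $\delta=1$ for AIII and BDI, $\delta=2$ for CII. Let $\kappa\in(0,1)$ and let $s(n),t(n)\in\mathbb N_0$ satisfy $s(n)+t(n)=n$ and $s(n)/n\to\kappa$. Write $S_n=\{1,\dots,\delta s(n)\}$, $T_n=\{1,\dots,\delta t(n)\}$, and let $\sim_n$ be an equivalence relation on $S_n\times T_n$ such that, as $n\to\infty$, (MP1) $\max_{p\in S_n}\#\{(q,p',q')\in T_n\times S_n\times T_n:(p,q)\sim_n(p',q')\}=o(n^2)$; (MP2) there is a finite constant $B$ with $\#\{q'\in T_n:(p,q)\sim_n(p',q')\}\le B$ for all $n,p,q,p'$, and $\#\{p'\in S_n:(p,q)\sim_n(p',q')\}\le B$ for all $n,p,q,q'$; (MP3) $\#\{(p,q,q')\in S_n\times T_n^2:(p,q)\sim_n(p,q'),\ q\ne q'\}=o(n^2)$ and $\#\{(p,p',q)\in S_n^2\times T_n:(p,q)\sim_n(p',q),\ p\ne p'\}=o(n^2)$. For each $n$ let $a_n(p,q)$, $(p,q)\in S_n\times T_n$, be complex random variables such that entries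 from distinct equivalence classes are independent, in the sense that each $a_n(p,q)$ is independent of the family of all $a_n(p',q')$ with $(p',q')\not\sim_n(p,q)$ (so that $a_n(p_1,q_1),\dots,a_n(p_j,q_j)$ are independent whenever $(p_1,q_1),\dots,(p_j,q_j)$ belong to $j$ distinct classes). Assume $\mathbb E\,a_n(p,q)=0$ and $\mathbb E|a_n(p,q)|^2=1$ for all $n,p,q$, and $\sup_n\max_{p,q}\mathbb E|a_n(p,q)|^k<\infty$ for every $k\in\mathbb N$. Let $X_n=\big(\tfrac1{\sqrt{\delta n}}\,a_n(p,q)\big)_{p\in S_n,\,q\in T_n}$, and assume that all realizations of $X_n$ lie in the space of admissible blocks of the class: $\mathbb C^{s(n)\times t(n)}$ for AIII; $(i\mathbb R)^{s(n)\times t(n)}$ for BDI; $\left\{\begin{pmatrix}U&V\\-\overline V&\overline U\end{pmatrix}:U,V\in\mathbb C^{s(n)\times t(n)}\right\}$ for CII. Let $$\mathcal X_{\delta n}=\begin{pmatrix}0&X_n\\X_n^*&0\end{pmatrix}\in\mathbb C^{\delta n\times\delta n},$$ and let $L_{\delta n}(\mathcal X_{\delta n})=\frac1{\delta n}\sum_{j=1}^{\delta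 n}\delta_{\lambda_j}$ be the empirical measure of its eigenvalues $\lambda_1,\dots,\lambda_{\delta n}$. Then, as $n\to\infty$, the mean empirical eigenvalue distribution $\mathbb E\,L_{\delta n}(\mathcal X_{\delta n})$ converges weakly to the measure $$\mu_{\mathrm{ch}}=|1-2\kappa|\,\delta_0+1_{[a,b]}(x^2)\,\frac1{\pi|x|}\sqrt{(x^2-a)(b-x^2)}\,dx,\qquad a=1-2\sqrt{\kappa(1-\kappa)},\quad b=1+2\sqrt{\kappa(1-\kappa)},$$ which is a probability measure on $\mathbb R$. -/

import Mathlib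

open MeasureTheory ProbabilityTheory Filter Topology Asymptotics
open scoped ENNReal Matrix BoundedContinuousFunction ComplexConjugate

/-- The three chiral symmetry classes. -/
inductive ChiralClass where
  | AIII
  | BDI
  | CII

namespace ChiralClass

/-- The size factor `δ`: matrices of the class with parameter `n` are of size `δ n × δ n`. -/
def delta : ChiralClass → ℕ
  | AIII => 1
  | BDI => 1
  | CII => 2

/-- The identification of `{1, …, 2m}` with two consecutive copies of `{1, …, m}`. -/
def halves (m : ℕ) : Fin m ⊕ Fin m ≃ Fin (2 * m) :=
  finSumFinEquiv.trans (finCongr (two_mul m).symm)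

/-- The admissible upper right blocks: all complex `s × t` matrices for AIII, those with purely
imaginary entries for BDI, and for CII the quaternionic `s × t` matrices, embedded into the complex
`2s × 2t` matrices as the block matrices `(U, V; -conj V, conj U)`. -/
def blocks : (C : ChiralClass) → (s t : ℕ) →
    Set (Matrix (Fin (C.delta * s)) (Fin (C.delta * t)) ℂ)
  | AIII, _, _ => Set.univ
  | BDI, _, _ => {X | ∀ p q, (X p q).re = 0}
  | CII, s, t => {X | ∃ U V : Matrix (Fin s) (Fin t) ℂ,
      X = Matrix.reindex (halves s) (halves t)
        (Matrix.fromBlocks U V (-(V.map conj)) (U.map conj))}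

end ChiralClass

/-- The matrix with diagonal blocks `0` and off-diagonal blocks `X` and `X*`. -/
def chiralMatrix {ι κ : Type*} (X : Matrix ι κ ℂ) : Matrix (ι ⊕ κ) (ι ⊕ κ) ℂ :=
  Matrix.fromBlocks 0 X Xᴴ 0

theorem chiralMatrix_isHermitian {ι κ : Type*} (X : Matrix ι κ ℂ) :
    (chiralMatrix X).IsHermitian := by
  simp [chiralMatrix, Matrix.IsHermitian, Matrix.fromBlocks_conjTranspose]

/-- The empirical measure of the eigenvalues (with multiplicity) of a Hermitian matrix. -/
noncomputable def empiricalMeasure {ι : Type*} [Fintype ι] [DecidableEq ι]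
    (M : Matrix ι ι ℂ) (hM : M.IsHermitian) : Measure ℝ :=
  (Fintype.card ι : ℝ≥0∞)⁻¹ • ∑ j, Measure.dirac (hM.eigenvalues j)

/-- The mean empirical eigenvalue distribution: the expectation, with respect to `P`, of the
empirical eigenvalue measure of the random matrix `ω ↦ (0, X ω; (X ω)*, 0)`. -/
noncomputable def meanEmpiricalMeasure {Ω ι κ : Type*} [MeasurableSpace Ω] [Fintype ι]
    [DecidableEq ι] [Fintype κ] [DecidableEq κ] (P : Measure Ω) (X : Ω → Matrix ι κ ℂ) :
    Measure ℝ :=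
  P.bind fun ω => empiricalMeasure (chiralMatrix (X ω)) (chiralMatrix_isHermitian (X ω))

/-- `max_p #{(q, p', q') : (p, q) ∼ₙ (p', q')} = o(n²)`. -/
def MP1 (s t : ℕ → ℕ) (r : ∀ n, Setoid (Fin (s n) × Fin (t n))) : Prop :=
  (fun n => ((Finset.univ.sup fun p : Fin (s n) =>
      {x : Fin (t n) × Fin (s n) × Fin (t n) | (r n).r (p, x.1) (x.2.1, x.2.2)}.ncard : ℕ) : ℝ))
    =o[atTop] fun n => (n : ℝ) ^ 2

/-- For a constant `B`, a fixed index pair is equivalent to at most `B` index pairs in each row and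
in each column. -/
def MP2 (s t : ℕ → ℕ) (r : ∀ n, Setoid (Fin (s n) × Fin (t n))) : Prop :=
  ∃ B : ℕ, ∀ (n : ℕ) (p : Fin (s n)) (q : Fin (t n)),
    (∀ p' : Fin (s n), {q' : Fin (t n) | (r n).r (p, q) (p', q')}.ncard ≤ B) ∧
    (∀ q' : Fin (t n), {p' : Fin (s n) | (r n).r (p, q) (p', q')}.ncard ≤ B)

/-- There are `o(n²)` triples giving distinct equivalent index pairs in a common row, and `o(n²)`
triples giving distinct equivalent index pairs in a common column. -/
def MP3 (s t : ℕ → ℕ) (r : ∀ n, Setoid (Fin (s n) × Fin (t n))) : Prop :=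
  ((fun n => ({x : Fin (s n) × Fin (t n) × Fin (t n) |
      (r n).r (x.1, x.2.1) (x.1, x.2.2) ∧ x.2.1 ≠ x.2.2}.ncard : ℝ))
    =o[atTop] fun n => (n : ℝ) ^ 2) ∧
  ((fun n => ({x : Fin (s n) × Fin (s n) × Fin (t n) |
      (r n).r (x.1, x.2.2) (x.2.1, x.2.2) ∧ x.1 ≠ x.2.1}.ncard : ℝ))
    =o[atTop] fun n => (n : ℝ) ^ 2)

/-- Entries at inequivalent positions are independent: each entry is independent of the family of
all entries whose positions are not equivalent to its own. By induction, entries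
at positions from distinct equivalence classes are then mutually independent. -/
def IndepOffClasses {Ω ι κ : Type*} [MeasurableSpace Ω] (P : Measure Ω) (r : Setoid (ι × κ))
    (a : Ω → Matrix ι κ ℂ) : Prop :=
  ∀ e : ι × κ, IndepFun (fun ω => a ω e.1 e.2)
    (fun ω (f : {f : ι × κ // ¬ r.r e f}) => a ω f.1.1 f.1.2) P

/-- The limit measure
`|1 - 2κ| δ₀ + 1_{[a,b]}(x²) (π|x|)⁻¹ √((x² - a)(b - x²)) dx`, `a, b = 1 ∓ 2 √(κ(1-κ))`. -/
noncomputable def chiralLimit (κ : ℝ) : Measure ℝ :=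
  let a := 1 - 2 * √(κ * (1 - κ))
  let b := 1 + 2 * √(κ * (1 - κ))
  ENNReal.ofReal |1 - 2 * κ| • Measure.dirac 0 +
    volume.withDensity fun x => ENNReal.ofReal
      ({y : ℝ | y ^ 2 ∈ Set.Icc a b}.indicator
        (fun y => 1 / (Real.pi * |y|) * √((y ^ 2 - a) * (b - y ^ 2))) x)

/-! The proof is the method of moments. The trace of the `m`-th power of the chiral matrix is a sum
over closed walks of `m` steps in the complete bipartite graph on rows and columns, with `N = δ n`
vertices. A step carries an entry or its conjugate, and the equivalence class of its position. The
expectation of the product along a walk vanishes if some class is met only once, because that entry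
is centred and independent of the others (`integral_pairProd_eq_zero`). The remaining walks have at
most `m / 2` classes. By (MP2), a step in a class already met leaves boundedly many choices for the
next vertex, so only new classes cost a factor `N`, and there are `O(N ^ (k + 1))` walks with `k`
classes (`card_walks_le`). The normalisation is `N ^ (-(1 + m / 2))`. Hence odd moments tend to
zero, and for `m = 2k` only walks with `k` classes, each met exactly twice, can survive.

All but `o(N ^ (k + 1))` of these are contour walks of plane trees (`exists_card_nonDyck_le`), by
induction on `k`. An immediate backtrack can be cut out. A walk without backtracks contains a
stretch whose first and last steps share a class: either these two steps are adjacent, which (MP3)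
makes rare, or they are not, and (MP1) makes such pairs rare. In a contour walk each edge is
traversed once in each direction, so the product is the squared modulus of a product of entries from
distinct classes, and its expectation is one. Only the variances enter here, never the expectation
of an unconjugated square.

Contour walks are counted by splitting at the first return to the start. In the limit this is a
Catalan recursion with weights `κ` and `1 - κ` for the two colours (`tendsto_card_contourWalks`).
Its generating series solves a quadratic equation, which yields a linear three-term recursion.
Integration by parts gives the same recursion for the even moments of `chiralLimit`, and the initial
values agree (`chiralIntegral_eq`). Since the limit has compact support, convergence of moments
implies weak convergence (`tendsto_integral_of_tendsto_moments`). -/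

/-! ### Walks and the classes of their steps -/

section Walks

open scoped Classical

variable {V Q : Type*}

/-- The list of pairs of consecutive entries. -/
def steps : List V → List (V × V)
  | [] => []
  | [_] => []
  | v :: u :: w => (v, u) :: steps (u :: w)

@[simp] theorem steps_nil : steps ([] : List V) = [] := rfl

@[simp] theorem steps_singleton (v : V) : steps [v] = [] := rfl

@[simp] theorem steps_cons_cons (v u : V) (w : List V) :
    steps (v :: u :: w) = (v, u) :: steps (u :: w) := rfl

theorem steps_append_cons (x : List V) (c : V) (y : List V) :
    steps (x ++ c :: y) = steps (x ++ [c]) ++ steps (c :: y) := by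
  induction x with
  | nil => simp
  | cons a x ih =>
    cases x with
    | nil => simp
    | cons b x => simpa using ih

theorem length_steps (p : List V) : (steps p).length = p.length - 1 := by
  induction p with
  | nil => rfl
  | cons a p ih =>
    cases p with
    | nil => rfl
    | cons b p => simp [ih]

theorem steps_reverse (p : List V) : steps p.reverse = ((steps p).map Prod.swap).reverse := by
  induction p with
  | nil => rfl
  | cons a p ih =>
    cases p with
    | nil => rfl
    | cons b p =>
      have : (a :: b :: p).reverse = p.reverse ++ b :: [a] := by simp
      rw [this, steps_append_cons]
      have h2 : p.reverse ++ [b] = (b :: p).reverse := by simp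
      rw [h2, ih]
      simp

/-- The set of classes of the steps of a list. -/
noncomputable def classes (cls : V × V → Q) (p : List V) : Finset Q :=
  ((steps p).map cls).toFinset

/-- All steps of the list are admissible. -/
def IsWalk (adj : V × V → Prop) (p : List V) : Prop := ∀ e ∈ steps p, adj e

theorem mem_classes {cls : V × V → Q} {p : List V} {c : Q} :
    c ∈ classes cls p ↔ ∃ e ∈ steps p, cls e = c := by
  simp [classes]

@[simp] theorem classes_singleton (cls : V × V → Q) (v : V) : classes cls [v] = ∅ := by
  simp [classes]

@[simp] theorem classes_cons_cons (cls : V × V → Q) (v u : V) (w : List V) :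
    classes cls (v :: u :: w) = insert (cls (v, u)) (classes cls (u :: w)) := by
  simp [classes]

theorem classes_append_cons (cls : V × V → Q) (x : List V) (c : V) (y : List V) :
    classes cls (x ++ c :: y) = classes cls (x ++ [c]) ∪ classes cls (c :: y) := by
  simp only [classes, steps_append_cons x c y, List.map_append, List.toFinset_append]

theorem classes_reverse {cls : V × V → Q} (hsymm : ∀ e : V × V, cls e.swap = cls e) (p : List V) :
    classes cls p.reverse = classes cls p := by
  ext c
  simp only [mem_classes, steps_reverse, List.mem_reverse, List.mem_map]
  constructor
  · rintro ⟨e, ⟨e', he', rfl⟩, rfl⟩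
    exact ⟨e', he', (hsymm e').symm⟩
  · rintro ⟨e, he, rfl⟩
    exact ⟨e.swap, ⟨e, he, rfl⟩, hsymm e⟩

theorem IsWalk.reverse {adj : V × V → Prop} (hadj : ∀ e : V × V, adj e → adj e.swap) {p : List V}
    (hp : IsWalk adj p) : IsWalk adj p.reverse := by
  intro e he
  simp only [steps_reverse, List.mem_reverse, List.mem_map] at he
  obtain ⟨e', he', rfl⟩ := he
  exact hadj _ (hp _ he')

theorem isWalk_append_cons {adj : V × V → Prop} {x : List V} {c : V} {y : List V} :
    IsWalk adj (x ++ c :: y) ↔ IsWalk adj (x ++ [c]) ∧ IsWalk adj (c :: y) := by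
  simp only [IsWalk, steps_append_cons x c y, List.mem_append]
  grind

@[simp] theorem isWalk_singleton (adj : V × V → Prop) (v : V) : IsWalk adj [v] := by
  simp [IsWalk]

@[simp] theorem isWalk_cons_cons {adj : V × V → Prop} {v u : V} {w : List V} :
    IsWalk adj (v :: u :: w) ↔ adj (v, u) ∧ IsWalk adj (u :: w) := by
  simp [IsWalk]

theorem card_classes_le (cls : V × V → Q) (p : List V) :
    (classes cls p).card ≤ p.length - 1 := by
  unfold classes
  refine (List.toFinset_card_le ((steps p).map cls)).trans ?_
  simp [length_steps]

theorem classes_subset_append_left (cls : V × V → Q) (x y : List V) :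
    classes cls x ⊆ classes cls (x ++ y) := by
  rcases List.eq_nil_or_concat x with rfl | ⟨x, c, rfl⟩
  · simp [classes]
  · rw [List.concat_eq_append, List.append_assoc, List.singleton_append,
      classes_append_cons cls x c y]
    exact Finset.subset_union_left (s₁ := classes cls (x ++ [c]))

theorem classes_subset_append_right (cls : V × V → Q) (x y : List V) :
    classes cls y ⊆ classes cls (x ++ y) := by
  cases y with
  | nil => simp [classes]
  | cons c y =>
    rw [classes_append_cons]
    exact Finset.subset_union_right (s₁ := classes cls (x ++ [c]))

/-! ### Counting lists -/

variable [Fintype V]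

variable (V) in
/-- The finite set of lists of a given length. -/
noncomputable def listsOfLength (m : ℕ) : Finset (List V) :=
  (List.finite_length_eq V m).toFinset

@[simp] theorem mem_listsOfLength {m : ℕ} {p : List V} : p ∈ listsOfLength V m ↔ p.length = m := by
  simp [listsOfLength]

theorem sum_listsOfLength_succ {A : Type*} [AddCommMonoid A] (m : ℕ) (f : List V → A) :
    ∑ p ∈ listsOfLength V (m + 1), f p = ∑ v : V, ∑ p ∈ listsOfLength V m, f (v :: p) := by
  rw [← Finset.sum_product']
  symm
  refine Finset.sum_bij (fun x _ => x.1 :: x.2) ?_ ?_ ?_ ?_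
  · simp
  · rintro ⟨a, b⟩ _ ⟨c, d⟩ _ h
    simpa using h
  · intro p hp
    cases p with
    | nil => simp at hp
    | cons v p => exact ⟨(v, p), by simpa using hp, rfl⟩
  · simp

theorem listsOfLength_zero : listsOfLength V 0 = {[]} := by
  ext; simp

theorem card_listsOfLength (m : ℕ) : (listsOfLength V m).card = Fintype.card V ^ m := by
  induction m with
  | zero => simp [listsOfLength_zero]
  | succ m ih =>
    rw [Finset.card_eq_sum_ones, sum_listsOfLength_succ]
    simp [ih, pow_succ']

theorem card_le_of_forall_cons {s t : Finset (List V)} {c : ℕ}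
    (hs : ∀ p ∈ s, ∃ u b, p = u :: b ∧ b ∈ t)
    (hf : ∀ b ∈ t, (Finset.univ.filter fun u : V => u :: b ∈ s).card ≤ c) :
    s.card ≤ c * t.card := by
  refine Finset.card_le_mul_card_image_of_maps_to (f := List.tail) ?_ c ?_
  · intro p hp
    obtain ⟨u, b, rfl, hb⟩ := hs p hp
    exact hb
  · intro b hb
    refine le_trans ?_ (hf b hb)
    refine (Finset.card_le_card (t := (Finset.univ.filter fun u : V => u :: b ∈ s).image
      fun u => u :: b) ?_).trans Finset.card_image_le
    intro p hp
    rw [Finset.mem_filter] at hp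
    obtain ⟨u, b', rfl, -⟩ := hs p hp.1
    have : b' = b := hp.2
    subst this
    simpa using hp.1

/-! ### Counting walks through a given stretch by their number of classes -/

/-- The walks with `k` classes that arise from the lists in `s` by putting `l` entries in front. -/
noncomputable def prependWalks (adj : V × V → Prop) (cls : V × V → Q) (s : Finset (List V))
    (L l k : ℕ) : Finset (List V) :=
  (listsOfLength V (l + L)).filter fun p =>
    IsWalk adj p ∧ p.drop l ∈ s ∧ (classes cls p).card = k

/-- Each prepended vertex either reuses a class, leaving at most `M * B` choices by `hB`, or opens a
new one, leaving at most `card V` choices; the latter happens exactly `d` times. Summing over the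
two options at every step gives the factor `(M * B + 1) ^ l`. -/
theorem card_prependWalks_le {adj : V × V → Prop} {cls : V × V → Q} {B : ℕ}
    (hadj : ∀ e : V × V, adj e → adj e.swap) (hsymm : ∀ e : V × V, cls e.swap = cls e)
    (hB : ∀ (i : V) (c : Q),
      (Finset.univ.filter fun j => adj (i, j) ∧ cls (i, j) = c).card ≤ B)
    {s : Finset (List V)} {L j : ℕ} (hL : 0 < L)
    (hs : ∀ p ∈ s, p.length = L ∧ (classes cls p).card = j) {M : ℕ} :
    ∀ l d : ℕ, l + L ≤ M → (prependWalks adj cls s L l (j + d)).card ≤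
      (M * B + 1) ^ l * s.card * Fintype.card V ^ d := by
  have fibre : ∀ (h : V) (C : Finset Q), C.card ≤ M →
      (Finset.univ.filter fun u : V => adj (u, h) ∧ cls (u, h) ∈ C).card ≤ M * B := by
    intro h C hC
    refine (Finset.card_le_card (t := C.biUnion fun c =>
      Finset.univ.filter fun u => adj (h, u) ∧ cls (h, u) = c) ?_).trans ?_
    · intro u hu
      simp only [Finset.mem_filter, Finset.mem_univ, true_and, Finset.mem_biUnion] at hu ⊢
      exact ⟨_, hu.2, hadj _ hu.1, hsymm (u, h)⟩
    · refine (Finset.card_biUnion_le_card_mul _ _ B fun c _ => hB h c).trans ?_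
      gcongr
  intro l
  induction l with
  | zero =>
    intro d _
    by_cases hd : d = 0
    · subst hd
      simp only [pow_zero, one_mul, mul_one]
      refine Finset.card_le_card fun p hp => ?_
      simp only [prependWalks, Finset.mem_filter, List.drop_zero] at hp
      exact hp.2.2.1
    · have : prependWalks adj cls s L 0 (j + d) = ∅ := by
        refine Finset.eq_empty_of_forall_notMem fun p hp => ?_
        simp only [prependWalks, Finset.mem_filter, List.drop_zero] at hp
        have := (hs p hp.2.2.1).2
        omega
      simp [this]
  | succ l ih =>
    intro d hM
    set E := prependWalks adj cls s L (l + 1) (j + d) with hE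
    set old := E.filter fun p => ∃ u h w, p = u :: h :: w ∧ cls (u, h) ∈ classes cls (h :: w)
      with hold
    set new := E.filter fun p => ¬ ∃ u h w, p = u :: h :: w ∧ cls (u, h) ∈ classes cls (h :: w)
      with hnew
    have hsplit : E.card = old.card + new.card :=
      (Finset.card_filter_add_card_filter_not _).symm
    have form : ∀ p ∈ E, ∃ u h w, p = u :: h :: w ∧ IsWalk adj (h :: w) ∧ adj (u, h) ∧
        (h :: w).length = l + L ∧ (h :: w).drop l ∈ s ∧
        (classes cls (u :: h :: w)).card = j + d := by
      intro p hp
      simp only [hE, prependWalks, Finset.mem_filter, mem_listsOfLength] at hp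
      obtain ⟨hlen, hw, hdrop, hcard⟩ := hp
      match p, hlen, hw, hdrop, hcard with
      | [], hlen, _, _, _ => simp at hlen; omega
      | [u], hlen, _, _, _ => simp at hlen; omega
      | u :: h :: w, hlen, hw, hdrop, hcard =>
        refine ⟨u, h, w, rfl, (isWalk_cons_cons.1 hw).2, (isWalk_cons_cons.1 hw).1, ?_, ?_, hcard⟩
        · simp at hlen ⊢; omega
        · simpa using hdrop
    have h1 : old.card ≤ M * B * (prependWalks adj cls s L l (j + d)).card := by
      refine card_le_of_forall_cons ?_ ?_
      · intro p hp
        rw [hold, Finset.mem_filter] at hp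
        obtain ⟨hpE, u', h', w', rfl, hmem⟩ := hp
        obtain ⟨u, h, w, heq, hw, ha, hlen, hdrop, hcard⟩ := form _ hpE
        obtain ⟨rfl, rfl, rfl⟩ : u' = u ∧ h' = h ∧ w' = w := by simpa using heq
        refine ⟨_, _, rfl, ?_⟩
        rw [classes_cons_cons, Finset.insert_eq_of_mem hmem] at hcard
        simp only [prependWalks, Finset.mem_filter, mem_listsOfLength]
        exact ⟨hlen, hw, hdrop, hcard⟩
      · intro b hb
        simp only [prependWalks, Finset.mem_filter, mem_listsOfLength] at hb
        cases b with
        | nil => simp at hb; omega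
        | cons h w =>
          refine le_trans (Finset.card_le_card ?_) (fibre h (classes cls (h :: w)) ?_)
          · intro u hu
            simp only [Finset.mem_filter, Finset.mem_univ, true_and, hold] at hu ⊢
            obtain ⟨hpE, u', h', w', heq, hmem⟩ := hu
            obtain ⟨u'', h'', w'', heq', -, ha, -⟩ := form _ hpE
            obtain ⟨rfl, rfl, rfl⟩ : u = u' ∧ h = h' ∧ w = w' := by simpa using heq
            obtain ⟨rfl, rfl, rfl⟩ : u = u'' ∧ h = h'' ∧ w = w'' := by simpa using heq'
            exact ⟨ha, hmem⟩
          · refine (card_classes_le _ _).trans ?_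
            omega
    have h2 : new.card ≤ (M * B + 1) ^ l * s.card * Fintype.card V ^ d := by
      cases d with
      | zero =>
        -- With `d = 0` no new class can be opened, as the tail contains a list from `s` and so
        -- already has `j` classes.
        have : new = ∅ := by
          refine Finset.eq_empty_of_forall_notMem fun p hp => ?_
          rw [hnew, Finset.mem_filter] at hp
          obtain ⟨u, h, w, rfl, hw, ha, hlen, hdrop, hcard⟩ := form _ hp.1
          have hnm : cls (u, h) ∉ classes cls (h :: w) := fun hm => hp.2 ⟨u, h, w, rfl, hm⟩
          rw [classes_cons_cons, Finset.card_insert_of_notMem hnm] at hcard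
          have hsub := Finset.card_le_card
            (classes_subset_append_right cls ((h :: w).take l) ((h :: w).drop l))
          rw [List.take_append_drop, (hs _ hdrop).2] at hsub
          omega
        simp [this]
      | succ d =>
        have : new.card ≤ Fintype.card V * (prependWalks adj cls s L l (j + d)).card := by
          refine card_le_of_forall_cons ?_ ?_
          · intro p hp
            rw [hnew, Finset.mem_filter] at hp
            obtain ⟨u, h, w, rfl, hw, ha, hlen, hdrop, hcard⟩ := form _ hp.1
            have hnm : cls (u, h) ∉ classes cls (h :: w) := fun hm => hp.2 ⟨u, h, w, rfl, hm⟩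
            rw [classes_cons_cons, Finset.card_insert_of_notMem hnm] at hcard
            refine ⟨_, _, rfl, ?_⟩
            simp only [prependWalks, Finset.mem_filter, mem_listsOfLength]
            exact ⟨hlen, hw, hdrop, by omega⟩
          · intro b _
            exact Finset.card_le_univ _
        refine this.trans ((Nat.mul_le_mul_left _ (ih d (by omega))).trans (le_of_eq ?_))
        ring
    rw [hsplit]
    calc old.card + new.card
        ≤ M * B * ((M * B + 1) ^ l * s.card * Fintype.card V ^ d) +
          (M * B + 1) ^ l * s.card * Fintype.card V ^ d := by
          gcongr
          exact h1.trans (Nat.mul_le_mul_left _ (ih d (by omega)))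
      _ = _ := by ring

/-- The walks with `k` classes that arise from the lists in `s` by putting `l` entries in front and
`l'` entries behind. -/
noncomputable def surroundWalks (adj : V × V → Prop) (cls : V × V → Q) (s : Finset (List V))
    (L l l' k : ℕ) : Finset (List V) :=
  (listsOfLength V (l + L + l')).filter fun p =>
    IsWalk adj p ∧ (∃ x q y, p = x ++ q ++ y ∧ x.length = l ∧ q ∈ s) ∧ (classes cls p).card = k

/-- The stretch is extended to the front, reversed, and extended to the front again; reversal
changes neither classes nor admissibility. The factor `d + 1` counts the ways in which the new
classes split between the two sides. -/
theorem card_surroundWalks_le {adj : V × V → Prop} {cls : V × V → Q} {B : ℕ}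
    (hadj : ∀ e : V × V, adj e → adj e.swap) (hsymm : ∀ e : V × V, cls e.swap = cls e)
    (hB : ∀ (i : V) (c : Q),
      (Finset.univ.filter fun j => adj (i, j) ∧ cls (i, j) = c).card ≤ B)
    {s : Finset (List V)} {L j : ℕ} (hL : 0 < L)
    (hs : ∀ p ∈ s, p.length = L ∧ (classes cls p).card = j) {M l l' : ℕ} (d : ℕ)
    (hM : l + L + l' ≤ M) :
    (surroundWalks adj cls s L l l' (j + d)).card ≤
      (d + 1) * ((M * B + 1) ^ (l + l') * s.card * Fintype.card V ^ d) := by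
  let T : ℕ → Finset (List V) := fun d' =>
    (prependWalks adj cls s L l (j + d')).image List.reverse
  let U : ℕ → Finset (List V) := fun d' =>
    (prependWalks adj cls (T d') (l + L) l' (j + d' + (d - d'))).image List.reverse
  have hT : ∀ d', (T d').card ≤ (M * B + 1) ^ l * s.card * Fintype.card V ^ d' := fun d' =>
    Finset.card_image_le.trans
      (card_prependWalks_le hadj hsymm hB hL hs l d' (by omega))
  have hU : ∀ d' ∈ Finset.range (d + 1), (U d').card ≤
      (M * B + 1) ^ (l + l') * s.card * Fintype.card V ^ d := by
    intro d' hd'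
    rw [Finset.mem_range] at hd'
    refine Finset.card_image_le.trans ((card_prependWalks_le hadj hsymm hB (by omega) (M := M)
      ?_ l' (d - d') (by omega)).trans ?_)
    · intro p hp
      obtain ⟨q, hq, rfl⟩ := Finset.mem_image.1 hp
      simp only [prependWalks, Finset.mem_filter, mem_listsOfLength] at hq
      exact ⟨by simpa using hq.1, by rw [classes_reverse hsymm]; exact hq.2.2.2⟩
    · calc (M * B + 1) ^ l' * (T d').card * Fintype.card V ^ (d - d')
          ≤ (M * B + 1) ^ l' * ((M * B + 1) ^ l * s.card * Fintype.card V ^ d') *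
            Fintype.card V ^ (d - d') := by gcongr; exact hT d'
        _ = (M * B + 1) ^ (l + l') * s.card * Fintype.card V ^ (d' + (d - d')) := by ring
        _ = _ := by rw [Nat.add_sub_cancel' (by omega)]
  refine (Finset.card_le_card (t := (Finset.range (d + 1)).biUnion U) ?_).trans
    ((Finset.card_biUnion_le_card_mul _ _ _ hU).trans (by simp))
  intro p hp
  simp only [surroundWalks, Finset.mem_filter, mem_listsOfLength] at hp
  obtain ⟨hlen, hw, ⟨x, q, y, rfl, hx, hq⟩, hcard⟩ := hp
  obtain ⟨hqL, hqj⟩ := hs q hq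
  have hyl : y.length = l' := by simp at hlen; omega
  have hjc : j ≤ (classes cls (x ++ q)).card := by
    rw [← hqj]
    exact Finset.card_le_card (classes_subset_append_right _ _ _)
  have hcj : (classes cls (x ++ q)).card ≤ j + d := by
    rw [← hcard]
    exact Finset.card_le_card (classes_subset_append_left _ _ _)
  obtain ⟨d', hd'⟩ := Nat.exists_eq_add_of_le hjc
  have hxq : IsWalk adj (x ++ q) := by
    intro e he
    obtain ⟨z, c, hz⟩ : ∃ z c, x ++ q = z ++ [c] := by
      rcases List.eq_nil_or_concat (x ++ q) with h | ⟨z, c, h⟩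
      · have := congrArg List.length h
        rw [List.length_append, List.length_nil] at this
        omega
      · exact ⟨z, c, by simpa using h⟩
    rw [hz, List.append_assoc, List.singleton_append, isWalk_append_cons] at hw
    rw [hz] at he
    exact hw.1 e he
  rw [Finset.mem_biUnion]
  refine ⟨d', by rw [Finset.mem_range]; omega, ?_⟩
  refine Finset.mem_image.2 ⟨(x ++ q ++ y).reverse, ?_, List.reverse_reverse _⟩
  simp only [prependWalks, Finset.mem_filter, mem_listsOfLength]
  refine ⟨by simp only [List.length_reverse, List.length_append]; omega, hw.reverse hadj, ?_, ?_⟩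
  · refine Finset.mem_image.2 ⟨x ++ q, ?_, ?_⟩
    · simp only [prependWalks, Finset.mem_filter, mem_listsOfLength]
      refine ⟨by simp; omega, hxq, ?_, hd'⟩
      rw [← hx, List.drop_left]
      exact hq
    · rw [List.reverse_append (as := x ++ q), ← hyl, ← List.length_reverse (as := y),
        List.drop_left]
  · rw [classes_reverse hsymm, hcard]
    omega

/-- Walks with `m` steps and `k` classes number at most a constant times `N ^ (k + 1)`. -/
theorem card_walks_le {adj : V × V → Prop} {cls : V × V → Q} {B : ℕ}
    (hadj : ∀ e : V × V, adj e → adj e.swap) (hsymm : ∀ e : V × V, cls e.swap = cls e)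
    (hB : ∀ (i : V) (c : Q),
      (Finset.univ.filter fun j => adj (i, j) ∧ cls (i, j) = c).card ≤ B) (m k : ℕ) :
    ((listsOfLength V (m + 1)).filter fun p =>
      IsWalk adj p ∧ (classes cls p).card = k).card ≤
      ((m + 1) * B + 1) ^ m * Fintype.card V ^ (k + 1) := by
  have h := card_prependWalks_le (M := m + 1) hadj hsymm hB (s := listsOfLength V 1) (L := 1)
    (j := 0) one_pos (by
      intro p hp
      rw [mem_listsOfLength] at hp
      obtain ⟨v, rfl⟩ := List.length_eq_one_iff.1 hp
      simp) m k le_rfl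
  rw [card_listsOfLength] at h
  refine le_trans (Finset.card_le_card ?_) (h.trans (le_of_eq (by ring)))
  intro p hp
  simp only [prependWalks, Finset.mem_filter, mem_listsOfLength] at hp ⊢
  exact ⟨hp.1, hp.2.1, by simp [hp.1], by simpa using hp.2.2⟩

end Walks

/-! ### Contour walks -/

section ContourWalks

open scoped Classical

variable {V Q : Type*}

/-- `v :: w` is the contour walk of a plane tree. -/
inductive Dyck (adj : V × V → Prop) : V → List V → Prop
  | nil (v : V) : Dyck adj v []
  | node {v u : V} {l r : List V} : adj (v, u) → Dyck adj u l → Dyck adj v r →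
      Dyck adj v (u :: (l ++ v :: r))

variable {adj : V × V → Prop} {cls : V × V → Q}

theorem Dyck.exists_append {v : V} {w : List V} (h : Dyck adj v w) : ∃ z, v :: w = z ++ [v] := by
  induction h with
  | nil v => exact ⟨[], rfl⟩
  | @node v u l r _ _ _ _ ihr =>
    obtain ⟨z, hz⟩ := ihr
    exact ⟨v :: u :: (l ++ z), by simp [hz]⟩

/-- A detour `c, u, c` hangs a new leaf on the tree at the chosen visit of `c`. Consequently,
erasing a backtrack from a walk that is not a contour walk never produces one. The `tail` only
removes the starting vertex, which `Dyck` carries separately. -/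
theorem Dyck.insert {v : V} {w : List V} (h : Dyck adj v w) :
    ∀ {z y : List V} {c u : V}, v :: w = z ++ c :: y → adj (c, u) →
      Dyck adj v (((z ++ [c]).tail) ++ u :: c :: y) := by
  induction h with
  | nil v =>
    intro z y c u hz ha
    rcases z with _ | ⟨a, z⟩
    · obtain ⟨rfl, rfl⟩ : v = c ∧ y = [] := by simpa [eq_comm] using hz
      exact Dyck.node (l := []) (r := []) ha (.nil _) (.nil _)
    · simp at hz
  | @node v u₀ l r hu hl hr ihl ihr =>
    intro z y c u hz ha
    rcases z with _ | ⟨a, z⟩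
    · obtain ⟨rfl, rfl⟩ : v = c ∧ u₀ :: (l ++ v :: r) = y := by simpa using hz
      exact Dyck.node (l := []) ha (.nil _) (.node hu hl hr)
    · obtain ⟨rfl, hz'⟩ : v = a ∧ (u₀ :: l) ++ v :: r = z ++ c :: y := by simpa using hz
      -- The visit of `c` lies either at or after the return to `v` that closes the first excursion,
      -- or not after it.
      rcases List.append_eq_append_iff.1 hz' with ⟨a', rfl, h⟩ | ⟨a', hl', h⟩
      · have := ihr h ha
        rcases a' with _ | ⟨b, a'⟩
        · obtain ⟨rfl, rfl⟩ : v = c ∧ r = y := by simpa using h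
          simpa using Dyck.node hu hl this
        · obtain ⟨rfl, rfl⟩ : v = b ∧ r = a' ++ c :: y := by simpa using h
          simpa using Dyck.node hu hl this
      · rcases a' with _ | ⟨b, a'⟩
        · obtain ⟨rfl, rfl⟩ : c = v ∧ y = r := by simpa using h
          have hz' : z = u₀ :: l := by simpa using hl'.symm
          subst hz'
          have := Dyck.node hu hl (Dyck.node (l := []) ha (.nil _) hr)
          simpa using this
        · obtain ⟨rfl, rfl⟩ : c = b ∧ y = a' ++ v :: r := by simpa using h
          have h1 := ihl hl' ha
          rcases z with _ | ⟨d, z⟩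
          · obtain ⟨rfl, rfl⟩ : u₀ = c ∧ l = a' := by simpa using hl'
            simpa using Dyck.node hu h1 hr
          · obtain ⟨rfl, rfl⟩ : u₀ = d ∧ l = z ++ c :: a' := by simpa using hl'
            simpa using Dyck.node hu h1 hr

theorem Dyck.isWalk (hadj : ∀ e : V × V, adj e → adj e.swap) {v : V} {w : List V}
    (h : Dyck adj v w) : IsWalk adj (v :: w) := by
  induction h with
  | nil v => simp
  | @node v u l r hu hl hr ihl ihr =>
    obtain ⟨z, hz⟩ := hl.exists_append
    rw [isWalk_cons_cons, ← List.cons_append, isWalk_append_cons]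
    refine ⟨hu, ?_, ihr⟩
    rw [hz, List.append_assoc, List.singleton_append, isWalk_append_cons, ← hz]
    exact ⟨ihl, by simpa using hadj _ hu⟩

theorem Dyck.classes_node (hsymm : ∀ e : V × V, cls e.swap = cls e) {v u : V} {l : List V}
    (hl : Dyck adj u l) (r : List V) :
    classes cls (v :: u :: (l ++ v :: r)) =
      Insert.insert (cls (v, u)) (classes cls (u :: l) ∪ classes cls (v :: r)) := by
  obtain ⟨z, hz⟩ := hl.exists_append
  rw [classes_cons_cons, ← List.cons_append, classes_append_cons, hz, List.append_assoc,
    List.singleton_append, classes_append_cons _ z, ← hz, classes_cons_cons]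
  have : cls (u, v) = cls (v, u) := hsymm (v, u)
  ext c
  simp [this]

theorem Dyck.even_length {v : V} {w : List V} (h : Dyck adj v w) : Even w.length := by
  induction h with
  | nil v => simp
  | node _ _ _ ihl ihr => simp; grind

/-- The two traversals of a tree edge have the same class, so there are no more classes than edges.
-/
theorem Dyck.card_classes_le (hsymm : ∀ e : V × V, cls e.swap = cls e) {v : V} {w : List V}
    (h : Dyck adj v w) : 2 * (classes cls (v :: w)).card ≤ w.length := by
  induction h with
  | nil v => simp
  | @node v u l r hu hl hr ihl ihr =>
    rw [Dyck.classes_node hsymm hl]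
    have h1 := Finset.card_insert_le (cls (v, u)) (classes cls (u :: l) ∪ classes cls (v :: r))
    have h2 := Finset.card_union_le (classes cls (u :: l)) (classes cls (v :: r))
    simp
    omega

/-! ### Walks that meet each class exactly twice -/

variable (adj cls) in
/-- Walks with `2k` steps that meet `k` classes, each of them at least twice. -/
def IsExact (k : ℕ) (p : List V) : Prop :=
  p.length = 2 * k + 1 ∧ IsWalk adj p ∧ (classes cls p).card = k ∧
    ∀ c ∈ classes cls p, 2 ≤ ((steps p).map cls).count c

theorem sum_count_classes (cls : V × V → Q) (p : List V) :
    ∑ c ∈ classes cls p, ((steps p).map cls).count c = p.length - 1 := by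
  rw [classes, List.sum_toFinset_count_eq_length]
  simp [length_steps]

theorem two_mul_card_classes_le {p : List V}
    (h : ∀ c ∈ classes cls p, 2 ≤ ((steps p).map cls).count c) :
    2 * (classes cls p).card ≤ p.length - 1 := by
  rw [← sum_count_classes cls, mul_comm]
  exact Finset.card_nsmul_le_sum _ _ _ h

/-- The counts of the `k` classes sum to `2k` and each is at least two. -/
theorem IsExact.count_eq_two {k : ℕ} {p : List V} (h : IsExact adj cls k p) {c : Q}
    (hc : c ∈ classes cls p) : ((steps p).map cls).count c = 2 := by
  obtain ⟨h1, -, h3, h4⟩ := h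
  have hsum := sum_count_classes cls p
  have : ∑ c ∈ classes cls p, 2 = ∑ c ∈ classes cls p, ((steps p).map cls).count c := by
    rw [hsum, h1, Finset.sum_const, h3]
    simp [mul_comm]
  exact ((Finset.sum_eq_sum_iff_of_le h4).1 this c hc).symm

/-- The two erased steps use up both occurrences of their class, so this class disappears and the
others are untouched. -/
theorem IsExact.erase_backtrack {k : ℕ} {x y : List V} {v u : V}
    (hsymm : ∀ e : V × V, cls e.swap = cls e)
    (h : IsExact adj cls (k + 1) (x ++ v :: u :: v :: y)) :
    IsExact adj cls k (x ++ v :: y) := by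
  have hcnt := fun c hc => h.count_eq_two (c := c) hc
  obtain ⟨h1, h2, h3, h4⟩ := h
  have e1 : (steps (x ++ v :: u :: v :: y)).map cls =
      (steps (x ++ [v])).map cls ++ cls (v, u) :: cls (v, u) :: (steps (v :: y)).map cls := by
    rw [steps_append_cons]
    have : cls (u, v) = cls (v, u) := hsymm (v, u)
    simp [this]
  have e2 : (steps (x ++ v :: y)).map cls =
      (steps (x ++ [v])).map cls ++ (steps (v :: y)).map cls := by
    rw [steps_append_cons]; simp
  have hne : cls (v, u) ∉ classes cls (x ++ v :: y) := by
    intro hm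
    have hc := hcnt (cls (v, u)) (by rw [classes, e1]; simp)
    rw [classes, List.mem_toFinset, e2] at hm
    have := List.count_pos_iff.2 hm
    rw [e1] at hc
    simp only [List.count_append, List.count_cons_self] at hc this
    omega
  have hins : classes cls (x ++ v :: u :: v :: y) =
      Insert.insert (cls (v, u)) (classes cls (x ++ v :: y)) := by
    simp only [classes, e1, e2]
    ext c
    simp
  refine ⟨by simp at h1 ⊢; omega, ?_, ?_, ?_⟩
  · rw [isWalk_append_cons] at h2 ⊢
    exact ⟨h2.1, by have := h2.2; simp only [isWalk_cons_cons] at this; exact this.2.2⟩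
  · rw [hins, Finset.card_insert_of_notMem hne] at h3
    omega
  · intro c hc
    have hcc := h4 c (by rw [hins]; exact Finset.mem_insert_of_mem hc)
    have hcne : cls (v, u) ≠ c := fun h => hne (h ▸ hc)
    rw [e1] at hcc
    rw [e2]
    simpa [List.count_append, List.count_cons_of_ne hcne] using hcc

theorem exists_split_of_mem_classes {p : List V} {c : Q} (hc : c ∈ classes cls p) :
    ∃ q a b y, p = q ++ a :: b :: y ∧ cls (a, b) = c := by
  rw [mem_classes] at hc
  obtain ⟨⟨a, b⟩, he, rfl⟩ := hc
  induction p with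
  | nil => simp at he
  | cons v p ih =>
    cases p with
    | nil => simp at he
    | cons u p =>
      rw [steps_cons_cons, List.mem_cons] at he
      rcases he with he | he
      · obtain ⟨rfl, rfl⟩ : a = v ∧ b = u := by simpa using he
        exact ⟨[], a, b, p, rfl, rfl⟩
      · obtain ⟨q, a', b', y, hp, h⟩ := ih he
        exact ⟨v :: q, a', b', y, by rw [hp]; rfl, h⟩

theorem classes_card_of_nodup {p : List V} (h : ((steps p).map cls).Nodup) :
    (classes cls p).card = p.length - 1 := by
  rw [classes, List.toFinset_card_of_nodup h, List.length_map, length_steps]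

/-- A walk that meets some class twice has a stretch whose first and last steps have the same class,
all but the last step being of different classes. -/
theorem exists_window {p : List V} (h : ¬ ((steps p).map cls).Nodup) :
    ∃ x y v u q a b, p = x ++ (v :: u :: q) ++ y ∧ u :: q = (u :: q).dropLast.dropLast ++ [a, b] ∧
      cls (v, u) = cls (a, b) ∧ (classes cls (v :: u :: q)).card = q.length := by
  induction p with
  | nil => simp at h
  | cons v p ih =>
    cases p with
    | nil => simp at h
    | cons u p =>
      -- The stretch begins at the last vertex from which some class still repeats. The later steps
      -- then have distinct classes, and the stretch ends where the class of its first step recurs.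
      by_cases hn : ((steps (u :: p)).map cls).Nodup
      · have hm : cls (v, u) ∈ classes cls (u :: p) := by
          by_contra hm
          apply h
          rw [steps_cons_cons, List.map_cons, List.nodup_cons]
          exact ⟨by simpa [classes] using hm, hn⟩
        obtain ⟨q, a, b, y, hp, hab⟩ := exists_split_of_mem_classes hm
        obtain ⟨q', hq'⟩ : ∃ q', q ++ [a, b] = u :: q' := by
          cases q with
          | nil =>
            obtain ⟨rfl, -⟩ : u = a ∧ _ := by simpa using hp
            exact ⟨[b], rfl⟩
          | cons c q =>
            obtain ⟨rfl, -⟩ : u = c ∧ _ := by simpa using hp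
            exact ⟨q ++ [a, b], rfl⟩
        have hp' : u :: p = (u :: q') ++ y := by rw [hp, ← hq']; simp
        have hp'' : p = q' ++ y := by simpa using hp'
        refine ⟨[], y, v, u, q', a, b, by simp [hp''], ?_, hab.symm, ?_⟩
        · rw [← hq']
          simp
        · have hmem : cls (v, u) ∈ classes cls (u :: q') := by
            rw [← hq', mem_classes]
            refine ⟨(a, b), ?_, hab⟩
            rw [steps_append_cons]
            simp
          rw [classes_cons_cons, Finset.insert_eq_of_mem hmem, classes_card_of_nodup]
          · simp
          · refine hn.sublist (List.Sublist.map _ ?_)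
            rw [hp', ← hq']
            have : q ++ [a, b] ++ y = (q ++ [a]) ++ b :: y := by simp
            rw [this, steps_append_cons (q ++ [a]) b y]
            have : q ++ [a, b] = (q ++ [a]) ++ [b] := by simp
            rw [this]
            exact List.sublist_append_left _ _
      · obtain ⟨x, y, v', u', q, a, b, hp, h2⟩ := ih hn
        exact ⟨v :: x, y, v', u', q, a, b, by rw [hp]; rfl, h2⟩

/-! ### Exceptional walks: exact, but not contour walks -/

variable [Fintype V]

variable (adj cls) in
/-- The pairs of consecutive steps of the same class that do not backtrack. -/
noncomputable def turnPairs : Finset (V × V × V) :=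
  Finset.univ.filter fun x => cls (x.1, x.2.1) = cls (x.2.1, x.2.2) ∧ x.1 ≠ x.2.2 ∧
    adj (x.1, x.2.1) ∧ adj (x.2.1, x.2.2)

variable (adj cls) in
/-- The pairs of steps of the same class. -/
noncomputable def stepPairs : Finset ((V × V) × V × V) :=
  Finset.univ.filter fun x => cls x.1 = cls x.2 ∧ adj x.1 ∧ adj x.2

variable (adj cls) in
/-- The possible stretches of `j + 1` steps and `j` classes, with first and last step of the same
class, in a walk without backtracking. -/
noncomputable def windows (j : ℕ) : Finset (List V) :=
  (listsOfLength V (j + 2)).filter fun p => (classes cls p).card = j ∧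
    (p ∈ (turnPairs adj cls).image (fun x => [x.1, x.2.1, x.2.2]) ∨
      2 ≤ j ∧ p ∈ (stepPairs adj cls ×ˢ listsOfLength V (j - 2)).image
        fun x => x.1.1.1 :: x.1.1.2 :: (x.2 ++ [x.1.2.1, x.1.2.2]))

/-- For `j = 1` the stretch is a turn pair. For `j ≥ 2` its end steps form a step pair and the other
`j - 2` vertices are free. Either way the bound is `η` times the order of all walks with `j`
classes. -/
theorem card_windows_le {η : ℝ} (hη : 0 ≤ η)
    (h1 : ((turnPairs adj cls).card : ℝ) ≤ η * (Fintype.card V : ℝ) ^ 2)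
    (h2 : ((stepPairs adj cls).card : ℝ) ≤ η * (Fintype.card V : ℝ) ^ 3) (j : ℕ) :
    ((windows adj cls j).card : ℝ) ≤ η * (Fintype.card V : ℝ) ^ (j + 1) := by
  rcases lt_trichotomy j 1 with hj | rfl | hj
  · have : windows adj cls j = ∅ := by
      refine Finset.eq_empty_of_forall_notMem fun p hp => ?_
      simp only [windows, Finset.mem_filter, mem_listsOfLength] at hp
      obtain ⟨hl, hc, hp | hp⟩ := hp
      · obtain ⟨x, -, rfl⟩ := Finset.mem_image.1 hp
        simp at hl
        omega
      · omega
    rw [this]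
    simp only [Finset.card_empty, Nat.cast_zero]
    positivity
  · refine le_trans ?_ h1
    have : windows adj cls 1 ⊆ (turnPairs adj cls).image (fun x => [x.1, x.2.1, x.2.2]) := by
      intro p hp
      simp only [windows, Finset.mem_filter, mem_listsOfLength] at hp
      obtain ⟨hl, hc, hp | hp⟩ := hp
      · exact hp
      · omega
    exact_mod_cast (Finset.card_le_card this).trans Finset.card_image_le
  · have : windows adj cls j ⊆ (stepPairs adj cls ×ˢ listsOfLength V (j - 2)).image
        fun x => x.1.1.1 :: x.1.1.2 :: (x.2 ++ [x.1.2.1, x.1.2.2]) := by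
      intro p hp
      simp only [windows, Finset.mem_filter, mem_listsOfLength] at hp
      obtain ⟨hl, hc, hp | hp⟩ := hp
      · obtain ⟨x, -, rfl⟩ := Finset.mem_image.1 hp
        simp at hl
        omega
      · exact hp.2
    have h3 := (Finset.card_le_card this).trans Finset.card_image_le
    rw [Finset.card_product, card_listsOfLength] at h3
    calc ((windows adj cls j).card : ℝ)
        ≤ (stepPairs adj cls).card * (Fintype.card V : ℝ) ^ (j - 2) := by exact_mod_cast h3
      _ ≤ η * (Fintype.card V : ℝ) ^ 3 * (Fintype.card V : ℝ) ^ (j - 2) := by gcongr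
      _ = η * (Fintype.card V : ℝ) ^ (3 + (j - 2)) := by ring
      _ = _ := by congr 2; omega

variable (adj cls) in
/-- Walks that meet each class exactly twice, but are not contour walks. -/
noncomputable def nonDyck (k : ℕ) : Finset (List V) :=
  (listsOfLength V (2 * k + 1)).filter fun p =>
    IsExact adj cls k p ∧ ¬ ∃ v w, p = v :: w ∧ Dyck adj v w

/-- A walk with a backtrack arises from a smaller exception by inserting a detour: the vertex at
position `x.1` is repeated with `x.2.1` in between. Without a backtrack, `2k + 2` steps share `k +
1` classes, so some class repeats and a stretch from `windows` occurs, starting at position `x.2`.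
-/
theorem nonDyck_succ_subset (hsymm : ∀ e : V × V, cls e.swap = cls e) (k : ℕ) :
    nonDyck adj cls (k + 1) ⊆
      ((Finset.range (2 * k + 3) ×ˢ (Finset.univ ×ˢ nonDyck adj cls k)).image
        fun x => x.2.2.take (x.1 + 1) ++ x.2.1 :: x.2.2.drop x.1) ∪
      ((Finset.range (k + 2) ×ˢ Finset.range (2 * k + 4)).filter
        fun x => x.2 + (x.1 + 2) ≤ 2 * k + 3).biUnion fun x =>
        surroundWalks adj cls (windows adj cls x.1) (x.1 + 2) x.2
          (2 * (k + 1) + 1 - (x.2 + (x.1 + 2))) (x.1 + (k + 1 - x.1)) := by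
  intro p hp
  simp only [nonDyck, Finset.mem_filter, mem_listsOfLength] at hp
  obtain ⟨hlen, hex, hnd⟩ := hp
  rw [Finset.mem_union]
  by_cases hbt : ∃ x v u y, p = x ++ v :: u :: v :: y
  · left
    obtain ⟨x, v, u, y, rfl⟩ := hbt
    have hex' := hex.erase_backtrack hsymm
    refine Finset.mem_image.2 ⟨(x.length, u, x ++ v :: y), ?_, ?_⟩
    · simp only [Finset.mem_product, Finset.mem_univ, true_and, Finset.mem_range, nonDyck,
        Finset.mem_filter, mem_listsOfLength]
      refine ⟨by simp at hlen; omega, hex'.1, hex', ?_⟩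
      rintro ⟨a, w, haw, hd⟩
      refine hnd ⟨a, (x ++ [v]).tail ++ u :: v :: y, ?_, hd.insert haw.symm ?_⟩
      · cases x with
        | nil =>
          obtain ⟨rfl, -⟩ : v = a ∧ _ := by simpa using haw
          simp
        | cons b x =>
          obtain ⟨rfl, -⟩ : b = a ∧ _ := by simpa using haw
          simp
      · have := hex.2.1
        rw [isWalk_append_cons] at this
        exact (isWalk_cons_cons.1 this.2).1
    · simp [List.take_append, List.take_of_length_le]
  · right
    have hnn : ¬ ((steps p).map cls).Nodup := by
      intro hn
      have h1 := classes_card_of_nodup hn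
      have h2 := hex.2.2.1
      omega
    obtain ⟨x, y, v, u, q, a, b, hpx, hq, hcl, hcard⟩ := exists_window hnn
    have hw := hex.2.1
    have hcle : q.length ≤ k + 1 := by
      rw [← hcard, ← hex.2.2.1, hpx]
      exact Finset.card_le_card ((classes_subset_append_right _ _ _).trans
        (classes_subset_append_left _ _ _))
    have hlen' := hlen
    rw [hpx] at hlen'
    simp only [List.length_append, List.length_cons] at hlen'
    refine Finset.mem_biUnion.2 ⟨(q.length, x.length), ?_, ?_⟩
    · simp only [Finset.mem_filter, Finset.mem_product, Finset.mem_range]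
      omega
    · simp only [surroundWalks, Finset.mem_filter, mem_listsOfLength]
      refine ⟨by omega, hw, ⟨x, v :: u :: q, y, hpx, rfl, ?_⟩, by rw [hex.2.2.1]; omega⟩
      simp only [windows, Finset.mem_filter, mem_listsOfLength, List.length_cons, true_and]
      refine ⟨hcard, ?_⟩
      -- An empty `z` means that the two steps of equal class are adjacent.
      generalize hz : (u :: q).dropLast.dropLast = z at hq
      cases z with
      | nil =>
        left
        obtain ⟨rfl, rfl⟩ : u = a ∧ q = [b] := by simpa using hq
        refine Finset.mem_image.2 ⟨(v, u, b), ?_, rfl⟩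
        have hpx' : p = x ++ v :: u :: b :: y := by simpa using hpx
        rw [hpx', isWalk_append_cons, isWalk_cons_cons, isWalk_cons_cons] at hw
        simp only [turnPairs, Finset.mem_filter, Finset.mem_univ, true_and]
        refine ⟨hcl, ?_, hw.2.1, hw.2.2.1⟩
        rintro rfl
        exact hbt ⟨_, _, _, _, hpx'⟩
      | cons c z =>
        right
        obtain ⟨rfl, rfl⟩ : u = c ∧ q = z ++ [a, b] := by simpa using hq
        refine ⟨by simp, Finset.mem_image.2 ⟨(((v, u), (a, b)), z), ?_, rfl⟩⟩
        simp only [stepPairs, Finset.mem_product, Finset.mem_filter, Finset.mem_univ, true_and,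
          mem_listsOfLength, List.length_append, List.length_cons, List.length_nil]
        refine ⟨⟨hcl, ?_, ?_⟩, by omega⟩
        · have hpx' : p = x ++ v :: u :: (z ++ [a, b] ++ y) := by simpa using hpx
          rw [hpx', isWalk_append_cons, isWalk_cons_cons] at hw
          exact hw.2.1
        · have hpx' : p = (x ++ v :: u :: z) ++ a :: b :: y := by simpa using hpx
          rw [hpx', isWalk_append_cons, isWalk_cons_cons] at hw
          exact hw.2.1

/-- Under the three multiplicity conditions, walks that meet each class exactly twice are contour
walks, up to a negligible number of exceptions. -/
theorem exists_card_nonDyck_le (B k : ℕ) : ∃ C : ℝ, 0 ≤ C ∧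
    ∀ {V Q : Type} [Fintype V] (adj : V × V → Prop) (cls : V × V → Q) (η : ℝ),
    (∀ e : V × V, adj e → adj e.swap) → (∀ e : V × V, cls e.swap = cls e) →
    (∀ (i : V) (c : Q),
      (Finset.univ.filter fun j => adj (i, j) ∧ cls (i, j) = c).card ≤ B) → 0 ≤ η →
    ((turnPairs adj cls).card : ℝ) ≤ η * (Fintype.card V : ℝ) ^ 2 →
    ((stepPairs adj cls).card : ℝ) ≤ η * (Fintype.card V : ℝ) ^ 3 →
    ((nonDyck adj cls k).card : ℝ) ≤ C * η * (Fintype.card V : ℝ) ^ (k + 1) := by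
  induction k with
  | zero =>
    refine ⟨0, le_rfl, fun adj cls η _ _ _ _ _ _ => ?_⟩
    have : nonDyck adj cls 0 = ∅ := by
      refine Finset.eq_empty_of_forall_notMem fun p hp => ?_
      simp only [nonDyck, Finset.mem_filter, mem_listsOfLength] at hp
      obtain ⟨v, rfl⟩ := List.length_eq_one_iff.1 hp.1
      exact hp.2.2 ⟨v, [], rfl, .nil v⟩
    simp [this]
  | succ k ih =>
    obtain ⟨C, hC, ih⟩ := ih
    -- `M` is the number of vertices of the walk. In `D`, the factor `k + 2` bounds the ways to
    -- split the new classes between the two sides of the stretch, and the power bounds the choices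
    -- at the extending steps.
    set M := 2 * k + 3 with hM
    set D : ℝ := (k + 2) * ((M : ℝ) * B + 1) ^ M with hD
    have hD0 : 0 ≤ D := by positivity
    refine ⟨M * C + (k + 2) * (2 * k + 4) * D, by positivity, ?_⟩
    intro V Q _ adj cls η hadj hsymm hB hη h1 h2
    have hsub := Finset.card_le_card (nonDyck_succ_subset (adj := adj) hsymm k)
    have hA : (((Finset.range (2 * k + 3) ×ˢ (Finset.univ ×ˢ nonDyck adj cls k)).image
        fun x => x.2.2.take (x.1 + 1) ++ x.2.1 :: x.2.2.drop x.1).card : ℝ) ≤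
        M * C * η * (Fintype.card V : ℝ) ^ (k + 2) := by
      calc _ ≤ ((Finset.range (2 * k + 3) ×ˢ
              ((Finset.univ : Finset V) ×ˢ nonDyck adj cls k)).card : ℝ) := by
            exact_mod_cast Finset.card_image_le
        _ = M * (Fintype.card V * (nonDyck adj cls k).card) := by
            simp [Finset.card_product, hM]
        _ ≤ M * (Fintype.card V * (C * η * (Fintype.card V : ℝ) ^ (k + 1))) := by
            gcongr
            exact ih adj cls η hadj hsymm hB hη h1 h2
        _ = _ := by ring
    have hS : ∀ x ∈ (Finset.range (k + 2) ×ˢ Finset.range (2 * k + 4)).filter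
        fun x => x.2 + (x.1 + 2) ≤ 2 * k + 3,
        ((surroundWalks adj cls (windows adj cls x.1) (x.1 + 2) x.2
          (2 * (k + 1) + 1 - (x.2 + (x.1 + 2))) (x.1 + (k + 1 - x.1))).card : ℝ) ≤
        D * η * (Fintype.card V : ℝ) ^ (k + 2) := by
      rintro ⟨j, l⟩ hx
      simp only [Finset.mem_filter, Finset.mem_product, Finset.mem_range] at hx
      obtain ⟨⟨hj, -⟩, hl⟩ := hx
      have := card_surroundWalks_le hadj hsymm hB (s := windows adj cls j) (L := j + 2) (j := j)
        (by omega) (fun p hp => by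
          simp only [windows, Finset.mem_filter, mem_listsOfLength] at hp
          exact ⟨hp.1, hp.2.1⟩) (M := M) (l := l) (l' := 2 * (k + 1) + 1 - (l + (j + 2)))
          (k + 1 - j) (by omega)
      calc _ ≤ (((k + 1 - j : ℕ) : ℝ) + 1) * (((M : ℝ) * B + 1) ^
              (l + (2 * (k + 1) + 1 - (l + (j + 2)))) * (windows adj cls j).card *
              (Fintype.card V : ℝ) ^ (k + 1 - j)) := by exact_mod_cast this
        _ ≤ (k + 2) * (((M : ℝ) * B + 1) ^ M * (η * (Fintype.card V : ℝ) ^ (j + 1)) *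
              (Fintype.card V : ℝ) ^ (k + 1 - j)) := by
            have e1 : ((k + 1 - j : ℕ) : ℝ) + 1 ≤ k + 2 := by
              have : k + 1 - j + 1 ≤ k + 2 := by omega
              exact_mod_cast this
            have e2 : 1 ≤ (M : ℝ) * B + 1 := by
              have : (0 : ℝ) ≤ (M : ℝ) * B := by positivity
              linarith
            have e3 := card_windows_le hη h1 h2 j
            have e4 : l + (2 * (k + 1) + 1 - (l + (j + 2))) ≤ M := by omega
            gcongr
        _ = D * η * (Fintype.card V : ℝ) ^ (j + 1 + (k + 1 - j)) := by rw [hD]; ring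
        _ = _ := by congr 2; omega
    have hS' : ((((Finset.range (k + 2) ×ˢ Finset.range (2 * k + 4)).filter
        fun x => x.2 + (x.1 + 2) ≤ 2 * k + 3).biUnion fun x =>
        surroundWalks adj cls (windows adj cls x.1) (x.1 + 2) x.2
          (2 * (k + 1) + 1 - (x.2 + (x.1 + 2))) (x.1 + (k + 1 - x.1))).card : ℝ) ≤
        (k + 2) * (2 * k + 4) * (D * η * (Fintype.card V : ℝ) ^ (k + 2)) := by
      refine le_trans (Nat.cast_le.2 Finset.card_biUnion_le) ?_
      rw [Nat.cast_sum]
      refine (Finset.sum_le_card_nsmul _ _ _ hS).trans ?_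
      rw [nsmul_eq_mul]
      have hc : (((Finset.range (k + 2) ×ˢ Finset.range (2 * k + 4)).filter
        fun x => x.2 + (x.1 + 2) ≤ 2 * k + 3).card : ℝ) ≤ (k + 2) * (2 * k + 4) := by
        have := Finset.card_filter_le (Finset.range (k + 2) ×ˢ Finset.range (2 * k + 4))
          fun x => x.2 + (x.1 + 2) ≤ 2 * k + 3
        rw [Finset.card_product, Finset.card_range, Finset.card_range] at this
        exact_mod_cast this
      gcongr
    calc ((nonDyck adj cls (k + 1)).card : ℝ)
        ≤ _ := Nat.cast_le.2 (hsub.trans (Finset.card_union_le _ _))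
      _ ≤ M * C * η * (Fintype.card V : ℝ) ^ (k + 2) +
          (k + 2) * (2 * k + 4) * (D * η * (Fintype.card V : ℝ) ^ (k + 2)) := by
          rw [Nat.cast_add]
          exact add_le_add hA hS'
      _ = _ := by ring

end ContourWalks

/-! ### Counting contour walks -/

section CountContourWalks

open scoped Classical

variable {V Q : Type*} {adj : V × V → Prop} {cls : V × V → Q}

/-- The first return to the starting point decomposes a contour walk in a unique way, if the first
step is of a class of its own in the first excursion. -/
theorem Dyck.node_injective (hsymm : ∀ e : V × V, cls e.swap = cls e) {v u u' : V}
    {l r l' r' : List V} (hl : Dyck adj u l) (hl' : Dyck adj u' l')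
    (hn : cls (v, u) ∉ classes cls (u :: l)) (hn' : cls (v, u') ∉ classes cls (u' :: l'))
    (h : u :: (l ++ v :: r) = u' :: (l' ++ v :: r')) : u = u' ∧ l = l' ∧ r = r' := by
  obtain ⟨rfl, h'⟩ : u = u' ∧ l ++ v :: r = l' ++ v :: r' := by simpa using h
  -- If one excursion were a proper prefix of the other, the longer one would contain the step from
  -- `u` to `v`, whose class is excluded from it.
  have key : ∀ {l l' r r' a : List V}, Dyck adj u l →
      cls (v, u) ∉ classes cls (u :: l') → l' = l ++ a → v :: r = a ++ v :: r' →
      a = [] := by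
    rintro l l' r r' a hl hn rfl h
    rcases a with _ | ⟨b, a⟩
    · rfl
    · obtain ⟨rfl, -⟩ : v = b ∧ _ := by simpa using h
      exfalso
      apply hn
      obtain ⟨z, hz⟩ := hl.exists_append
      rw [← List.cons_append, hz, List.append_assoc, List.singleton_append, mem_classes]
      refine ⟨(u, v), ?_, hsymm (v, u)⟩
      rw [steps_append_cons]
      simp
  rcases List.append_eq_append_iff.1 h' with ⟨a, h1, h2⟩ | ⟨a, h1, h2⟩
  · have := key hl hn' h1 h2
    subst this
    simp at h1 h2
    exact ⟨rfl, h1.symm, h2⟩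
  · have := key hl' hn h1 h2
    subst this
    simp at h1 h2
    exact ⟨rfl, h1, h2.symm⟩

/-- A walk followed by another one, with a step from the starting point of the latter in front. -/
def joinWalks : List V → List V → List V
  | _, [] => []
  | p, v :: r => v :: (p ++ v :: r)

variable [Fintype V]

variable (adj cls) in
/-- The contour walks with `2k` steps and `k` classes, starting at a vertex of colour `b`. -/
noncomputable def contourWalks (col : V → Bool) (k : ℕ) (b : Bool) : Finset (List V) :=
  (listsOfLength V (2 * k + 1)).filter fun p =>
    (∃ v w, p = v :: w ∧ Dyck adj v w ∧ col v = b) ∧ (classes cls p).card = k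

variable {col : V → Bool}

theorem mem_contourWalks {k : ℕ} {b : Bool} {p : List V} :
    p ∈ contourWalks adj cls col k b ↔ ∃ v w, p = v :: w ∧ Dyck adj v w ∧ col v = b ∧
      w.length = 2 * k ∧ (classes cls (v :: w)).card = k := by
  simp only [contourWalks, Finset.mem_filter, mem_listsOfLength]
  constructor
  · rintro ⟨h1, ⟨v, w, rfl, h2, h3⟩, h4⟩
    exact ⟨v, w, rfl, h2, h3, by simpa using h1, h4⟩
  · rintro ⟨v, w, rfl, h2, h3, h1, h4⟩
    exact ⟨by simpa using h1, ⟨v, w, rfl, h2, h3⟩, h4⟩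

theorem card_contourWalks_zero (b : Bool) :
    (contourWalks adj cls col 0 b).card = (Finset.univ.filter fun v => col v = b).card := by
  symm
  refine Finset.card_bij (fun v _ => [v]) ?_ ?_ ?_
  · intro v hv
    rw [mem_contourWalks]
    exact ⟨v, [], rfl, .nil v, by simpa using hv, rfl, by simp⟩
  · intro a _ b _ h
    simpa using h
  · intro p hp
    obtain ⟨v, w, rfl, h2, h3, h1, h4⟩ := mem_contourWalks.1 hp
    exact ⟨v, by simpa using h3, by rw [List.length_eq_zero_iff.1 (by omega : w.length = 0)]⟩

variable (adj cls col) in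
/-- The pairs of contour walks that combine to a contour walk of the same kind. -/
noncomputable def joinablePairs (b : Bool) (i j : ℕ) : Finset (List V × List V) :=
  (contourWalks adj cls col i (!b) ×ˢ contourWalks adj cls col j b).filter
    fun x => joinWalks x.1 x.2 ∈ contourWalks adj cls col (i + j + 1) b

/-- The joined walk has `i + j + 1` classes and its parts have only `i` and `j`, so the joining edge
has a class of its own. This is what makes the decomposition unique. -/
theorem mem_joinablePairs (hsymm : ∀ e : V × V, cls e.swap = cls e) {b : Bool} {i j : ℕ}
    {x : List V × List V} (hx : x ∈ joinablePairs adj cls col b i j) :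
    ∃ v u l r, x = (u :: l, v :: r) ∧ Dyck adj u l ∧ cls (v, u) ∉ classes cls (u :: l) ∧
      l.length = 2 * i ∧ r.length = 2 * j := by
  simp only [joinablePairs, Finset.mem_filter, Finset.mem_product] at hx
  obtain ⟨p, q⟩ := x
  obtain ⟨⟨h1, h2⟩, h3⟩ := hx
  obtain ⟨u, l, rfl, hul, -, hll, hlc⟩ := mem_contourWalks.1 h1
  obtain ⟨v, r, rfl, hvr, -, hrl, hrc⟩ := mem_contourWalks.1 h2
  refine ⟨v, u, l, r, rfl, hul, fun hm => ?_, hll, hrl⟩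
  obtain ⟨v', w, h, -, -, -, hc⟩ := mem_contourWalks.1 h3
  rw [← h] at hc
  have e : joinWalks (u :: l) (v :: r) = v :: u :: (l ++ v :: r) := rfl
  simp only [e] at hc
  rw [Dyck.classes_node hsymm hul, Finset.insert_eq_of_mem (Finset.mem_union_left _ hm)] at hc
  have := Finset.card_union_le (classes cls (u :: l)) (classes cls (v :: r))
  omega

/-- Splitting at the first return is a bijection onto joinable pairs. A contour walk has at most as
many classes as edges, and equality for the whole walk forces equality for both parts. -/
theorem card_contourWalks_succ (hsymm : ∀ e : V × V, cls e.swap = cls e)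
    (hcol : ∀ u v, adj (u, v) ↔ col u ≠ col v) (k : ℕ) (b : Bool) :
    (contourWalks adj cls col (k + 1) b).card =
      ∑ x ∈ Finset.HasAntidiagonal.antidiagonal k, (joinablePairs adj cls col b x.1 x.2).card := by
  have himg : ∀ x ∈ Finset.HasAntidiagonal.antidiagonal k,
      (joinablePairs adj cls col b x.1 x.2).card =
      ((joinablePairs adj cls col b x.1 x.2).image fun y => joinWalks y.1 y.2).card := by
    intro x _
    refine (Finset.card_image_of_injOn ?_).symm
    intro y hy z hz h
    obtain ⟨v, u, l, r, rfl, h1, h2, h3, h4⟩ := mem_joinablePairs hsymm hy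
    obtain ⟨v', u', l', r', rfl, h1', h2', h3', h4'⟩ := mem_joinablePairs hsymm hz
    obtain ⟨rfl, h⟩ : v = v' ∧ u :: (l ++ v :: r) = u' :: (l' ++ v' :: r') := by
      simpa [joinWalks] using h
    obtain ⟨rfl, rfl, rfl⟩ := Dyck.node_injective hsymm h1 h1' h2 h2' h
    rfl
  rw [Finset.sum_congr rfl himg, ← Finset.card_biUnion]
  · congr 1
    ext p
    rw [Finset.mem_biUnion]
    constructor
    · intro hp
      obtain ⟨v, w, rfl, hd, hb, hlen, hc⟩ := mem_contourWalks.1 hp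
      cases hd with
      | nil v => simp at hlen
      | @node _ u l r hvu hl hr =>
        obtain ⟨i, hi⟩ := hl.even_length
        obtain ⟨j, hj⟩ := hr.even_length
        have hlc := hl.card_classes_le hsymm
        have hrc := hr.card_classes_le hsymm
        have hij : i + j = k := by simp at hlen; omega
        have hc' := hc
        rw [Dyck.classes_node hsymm hl] at hc'
        have h1 := Finset.card_insert_le (cls (v, u)) (classes cls (u :: l) ∪ classes cls (v :: r))
        have h2 := Finset.card_union_le (classes cls (u :: l)) (classes cls (v :: r))
        refine ⟨(i, j), Finset.HasAntidiagonal.mem_antidiagonal.2 hij,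
          Finset.mem_image.2 ⟨(u :: l, v :: r), ?_, rfl⟩⟩
        simp only [joinablePairs, Finset.mem_filter, Finset.mem_product]
        refine ⟨⟨mem_contourWalks.2 ⟨u, l, rfl, hl, ?_, by omega, by omega⟩,
          mem_contourWalks.2 ⟨v, r, rfl, hr, hb, by omega, by omega⟩⟩, ?_⟩
        · have := (hcol v u).1 hvu
          rw [hb] at this
          cases b <;> cases hu : col u <;> simp_all
        · rw [hij]
          exact hp
    · rintro ⟨x, hx, hp⟩
      obtain ⟨y, hy, rfl⟩ := Finset.mem_image.1 hp
      rw [← Finset.HasAntidiagonal.mem_antidiagonal.1 hx]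
      exact (Finset.mem_filter.1 hy).2
  · intro x hx x' hx' hne
    rw [Function.onFun, Finset.disjoint_left]
    intro p hp hp'
    obtain ⟨y, hy, rfl⟩ := Finset.mem_image.1 hp
    obtain ⟨z, hz, h⟩ := Finset.mem_image.1 hp'
    obtain ⟨v, u, l, r, rfl, h1, h2, h3, h4⟩ := mem_joinablePairs hsymm hy
    obtain ⟨v', u', l', r', rfl, h1', h2', h3', h4'⟩ := mem_joinablePairs hsymm hz
    obtain ⟨rfl, h⟩ : v' = v ∧ u' :: (l' ++ v' :: r') = u :: (l ++ v :: r) := by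
      simpa [joinWalks] using h
    obtain ⟨rfl, rfl, rfl⟩ := Dyck.node_injective hsymm h1' h1 h2' h2 h
    exact hne (Prod.ext (by omega) (by omega))

/-- A pair that is not joinable still joins to a contour walk, but one with at most `i + j` classes.
There are `O(N ^ (i + j + 1))` of those, one power of `N` below the natural order of the product. -/
theorem card_product_sub_joinablePairs_le {B : ℕ} (hV : 0 < Fintype.card V)
    (hadj : ∀ e : V × V, adj e → adj e.swap) (hsymm : ∀ e : V × V, cls e.swap = cls e)
    (hB : ∀ (i : V) (c : Q),
      (Finset.univ.filter fun j => adj (i, j) ∧ cls (i, j) = c).card ≤ B)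
    (hcol : ∀ u v, adj (u, v) ↔ col u ≠ col v) (b : Bool) (i j : ℕ) :
    (contourWalks adj cls col i (!b)).card * (contourWalks adj cls col j b).card ≤
      (joinablePairs adj cls col b i j).card + (i + j + 1) *
        (((2 * (i + j + 1) + 1) * B + 1) ^ (2 * (i + j + 1)) *
          Fintype.card V ^ (i + j + 1)) := by
  rw [← Finset.card_product, joinablePairs,
    ← Finset.card_filter_add_card_filter_not
      (fun x => joinWalks x.1 x.2 ∈ contourWalks adj cls col (i + j + 1) b)]
  refine Nat.add_le_add_left ?_ _
  refine (Finset.card_le_card_of_injOn (t := (Finset.range (i + j + 1)).biUnion fun c =>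
    (listsOfLength V (2 * (i + j + 1) + 1)).filter fun p =>
      IsWalk adj p ∧ (classes cls p).card = c) (fun x => joinWalks x.1 x.2) ?_ ?_).trans ?_
  · rintro ⟨p, q⟩ hx
    simp only [Finset.coe_filter, Set.mem_ofPred_eq, Finset.mem_product] at hx
    obtain ⟨⟨h1, h2⟩, h3⟩ := hx
    obtain ⟨u, l, rfl, hul, hu, hll, hlc⟩ := mem_contourWalks.1 h1
    obtain ⟨v, r, rfl, hvr, hv, hrl, hrc⟩ := mem_contourWalks.1 h2
    have hd : Dyck adj v (u :: (l ++ v :: r)) := by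
      refine .node ?_ hul hvr
      rw [hcol, hu, hv]
      cases b <;> simp
    have e : joinWalks (u :: l) (v :: r) = v :: u :: (l ++ v :: r) := rfl
    simp only [e] at h3 ⊢
    have hlen : (u :: (l ++ v :: r)).length = 2 * (i + j + 1) := by simp; omega
    have hle := hd.card_classes_le hsymm
    simp only [Finset.coe_biUnion, Set.mem_iUnion, Finset.coe_filter, Set.mem_ofPred_eq,
      mem_listsOfLength]
    refine ⟨_, ?_, ?_, hd.isWalk hadj, rfl⟩
    · rw [Finset.mem_coe, Finset.mem_range]
      by_contra hcon
      exact h3 (mem_contourWalks.2 ⟨v, _, rfl, hd, hv, hlen, by omega⟩)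
    · rw [List.length_cons, hlen]
  · rintro ⟨p, q⟩ hx ⟨p', q'⟩ hx' h
    simp only [Finset.coe_filter, Set.mem_ofPred_eq, Finset.mem_product] at hx hx'
    obtain ⟨u, l, rfl, -, -, hll, -⟩ := mem_contourWalks.1 hx.1.1
    obtain ⟨v, r, rfl, -, -, hrl, -⟩ := mem_contourWalks.1 hx.1.2
    obtain ⟨u', l', rfl, -, -, hll', -⟩ := mem_contourWalks.1 hx'.1.1
    obtain ⟨v', r', rfl, -, -, hrl', -⟩ := mem_contourWalks.1 hx'.1.2
    obtain ⟨rfl, rfl, hlr⟩ : v = v' ∧ u = u' ∧ l ++ v :: r = l' ++ v' :: r' := by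
      simpa [joinWalks] using h
    obtain ⟨rfl, hr⟩ := List.append_inj hlr (by omega)
    obtain ⟨-, rfl⟩ : v = v ∧ r = r' := by simpa using hr
    rfl
  · refine (Finset.card_biUnion_le_card_mul _ _ (((2 * (i + j + 1) + 1) * B + 1) ^
      (2 * (i + j + 1)) * Fintype.card V ^ (i + j + 1)) ?_).trans (by simp)
    intro c hc
    refine (card_walks_le hadj hsymm hB (2 * (i + j + 1)) c).trans ?_
    have hc' : c + 1 ≤ i + j + 1 := by simpa using hc
    exact Nat.mul_le_mul_left _ (Nat.pow_le_pow_right hV hc')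

end CountContourWalks

/-! ### Limits of the normalised numbers of contour walks -/

section ContourWalkLimit

open scoped Classical

/-- Limits of the numbers of contour walks with `2k` steps: weighted Catalan numbers. -/
noncomputable def chiralCatalan (κ : ℝ) : ℕ → Bool → ℝ
  | 0, b => if b then κ else 1 - κ
  | k + 1, b => ∑ i : Fin (k + 1), chiralCatalan κ i (!b) * chiralCatalan κ (k - i) b

theorem chiralCatalan_succ (κ : ℝ) (k : ℕ) (b : Bool) :
    chiralCatalan κ (k + 1) b = ∑ x ∈ Finset.HasAntidiagonal.antidiagonal k,
      chiralCatalan κ x.1 (!b) * chiralCatalan κ x.2 b := by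
  rw [chiralCatalan, Finset.Nat.sum_antidiagonal_eq_sum_range_succ
    (fun i j => chiralCatalan κ i (!b) * chiralCatalan κ j b), Finset.sum_range]

/-- Replacing joinable pairs by all pairs turns the exact recursion into the Catalan recursion. The
error is at most `D / N` per summand, hence the squeeze between `hlow` and `hmain`. -/
theorem tendsto_card_contourWalks {κ : ℝ} {B : ℕ} {V Q : ℕ → Type} [∀ n, Fintype (V n)]
    {adj : ∀ n, V n × V n → Prop} {cls : ∀ n, V n × V n → Q n} {col : ∀ n, V n → Bool}
    (hadj : ∀ n, ∀ e : V n × V n, adj n e → adj n e.swap)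
    (hsymm : ∀ n, ∀ e : V n × V n, cls n e.swap = cls n e)
    (hB : ∀ n, ∀ (i : V n) (c : Q n),
      (Finset.univ.filter fun j => adj n (i, j) ∧ cls n (i, j) = c).card ≤ B)
    (hcol : ∀ n u v, adj n (u, v) ↔ col n u ≠ col n v)
    (hV : Tendsto (fun n => (Fintype.card (V n) : ℝ)) atTop atTop)
    (h0 : ∀ b, Tendsto (fun n => ((Finset.univ.filter fun v => col n v = b).card : ℝ) /
      Fintype.card (V n)) atTop (𝓝 (chiralCatalan κ 0 b))) (k : ℕ) :
    ∀ b, Tendsto (fun n => ((contourWalks (adj n) (cls n) (col n) k b).card : ℝ) /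
      (Fintype.card (V n) : ℝ) ^ (k + 1)) atTop (𝓝 (chiralCatalan κ k b)) := by
  induction k using Nat.strong_induction_on with
  | _ k ih =>
  intro b
  cases k with
  | zero => simpa [card_contourWalks_zero] using h0 b
  | succ k =>
    set D : ℝ := ((k + 1 : ℕ) : ℝ) * (((2 * (k + 1) + 1) * B + 1) ^ (2 * (k + 1)) : ℕ) with hD
    set N : ℕ → ℝ := fun n => Fintype.card (V n) with hN
    have hmain : Tendsto (fun n => ∑ x ∈ Finset.HasAntidiagonal.antidiagonal k,
        ((contourWalks (adj n) (cls n) (col n) x.1 (!b)).card : ℝ) / N n ^ (x.1 + 1) *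
        (((contourWalks (adj n) (cls n) (col n) x.2 b).card : ℝ) / N n ^ (x.2 + 1))) atTop
        (𝓝 (chiralCatalan κ (k + 1) b)) := by
      rw [chiralCatalan_succ]
      refine tendsto_finsetSum _ fun x hx => ?_
      rw [Finset.HasAntidiagonal.mem_antidiagonal] at hx
      exact (ih x.1 (by omega) (!b)).mul (ih x.2 (by omega) b)
    have hlow : Tendsto (fun n => (∑ x ∈ Finset.HasAntidiagonal.antidiagonal k,
        ((contourWalks (adj n) (cls n) (col n) x.1 (!b)).card : ℝ) / N n ^ (x.1 + 1) *
        (((contourWalks (adj n) (cls n) (col n) x.2 b).card : ℝ) / N n ^ (x.2 + 1))) -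
        (k + 1) * (D / N n)) atTop (𝓝 (chiralCatalan κ (k + 1) b)) := by
      have := hmain.sub ((hV.const_div_atTop D).const_mul ((k : ℝ) + 1))
      simpa using this
    have hpos : ∀ᶠ n in atTop, 0 < N n := hV.eventually_gt_atTop 0
    have hprod : ∀ᶠ n in atTop, ∀ x ∈ Finset.HasAntidiagonal.antidiagonal k,
        ((contourWalks (adj n) (cls n) (col n) x.1 (!b)).card : ℝ) / N n ^ (x.1 + 1) *
        (((contourWalks (adj n) (cls n) (col n) x.2 b).card : ℝ) / N n ^ (x.2 + 1)) =
        ((contourWalks (adj n) (cls n) (col n) x.1 (!b)).card *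
          (contourWalks (adj n) (cls n) (col n) x.2 b).card : ℝ) / N n ^ (k + 2) := by
      filter_upwards with n x hx
      rw [Finset.HasAntidiagonal.mem_antidiagonal] at hx
      rw [div_mul_div_comm, ← pow_add]
      congr 2
      omega
    refine tendsto_of_tendsto_of_tendsto_of_le_of_le' hlow hmain ?_ ?_
    · filter_upwards [hpos, hprod] with n hn hpr
      rw [card_contourWalks_succ (hsymm n) (hcol n), Finset.sum_congr rfl hpr, sub_le_iff_le_add,
        Nat.cast_sum, Finset.sum_div]
      have : ((k : ℝ) + 1) * (D / N n) = ∑ x ∈ Finset.HasAntidiagonal.antidiagonal k, D / N n := by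
        rw [Finset.sum_const, Finset.Nat.card_antidiagonal, nsmul_eq_mul]
        push_cast
        ring
      rw [this, ← Finset.sum_add_distrib]
      refine Finset.sum_le_sum fun x hx => ?_
      rw [Finset.HasAntidiagonal.mem_antidiagonal] at hx
      have := card_product_sub_joinablePairs_le (Nat.cast_pos.1 hn) (hadj n) (hsymm n) (hB n)
        (hcol n) b x.1 x.2
      rw [hx] at this
      have hD' : D / N n = (D * N n ^ (k + 1)) / N n ^ (k + 1 + 1) := by
        field_simp
        ring
      rw [hD', ← add_div]
      refine div_le_div_of_nonneg_right ?_ (by positivity)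
      simp only [hD, hN, mul_assoc]
      exact_mod_cast this
    · filter_upwards [hpos, hprod] with n hn hpr
      rw [card_contourWalks_succ (hsymm n) (hcol n), Finset.sum_congr rfl hpr, Nat.cast_sum,
        Finset.sum_div]
      refine Finset.sum_le_sum fun x hx => ?_
      refine div_le_div_of_nonneg_right ?_ (by positivity)
      have := Finset.card_filter_le (contourWalks (adj n) (cls n) (col n) x.1 (!b) ×ˢ
        contourWalks (adj n) (cls n) (col n) x.2 b)
        fun y => joinWalks y.1 y.2 ∈ contourWalks (adj n) (cls n) (col n) (x.1 + x.2 + 1) b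
      rw [Finset.card_product] at this
      rw [joinablePairs]
      exact_mod_cast this

end ContourWalkLimit

/-! ### Expectations along walks -/

section Expectations

open scoped Classical

variable {V Q Ω : Type*}

/-- The product of the random variables over a list of index pairs. -/
noncomputable def pairProd (x : V × V → Ω → ℂ) (l : List (V × V)) (ω : Ω) : ℂ :=
  (l.map fun e => x e ω).prod

@[simp] theorem pairProd_nil (x : V × V → Ω → ℂ) (ω : Ω) : pairProd x [] ω = 1 := rfl

@[simp] theorem pairProd_cons (x : V × V → Ω → ℂ) (e : V × V) (l : List (V × V)) (ω : Ω) :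
    pairProd x (e :: l) ω = x e ω * pairProd x l ω := by
  simp [pairProd]

theorem pairProd_append (x : V × V → Ω → ℂ) (l l' : List (V × V)) (ω : Ω) :
    pairProd x (l ++ l') ω = pairProd x l ω * pairProd x l' ω := by
  simp [pairProd]

/-- Every factor is at most the largest one, whose power is among the summands. This takes the place
of Hölder's inequality for mixed moments. -/
theorem List.prod_le_sum_pow_length (l : List ℝ) (h : ∀ a ∈ l, 0 ≤ a) (hl : l ≠ []) :
    l.prod ≤ (l.map fun a => a ^ l.length).sum := by
  obtain ⟨m, hm, hmax⟩ := Finset.exists_max_image l.toFinset id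
    (by simpa [Finset.nonempty_iff_ne_empty] using hl)
  rw [List.mem_toFinset] at hm
  have key : ∀ l' : List ℝ, (∀ a ∈ l', 0 ≤ a ∧ a ≤ m) → 0 ≤ l'.prod ∧ l'.prod ≤ m ^ l'.length := by
    intro l'
    induction l' with
    | nil => simp
    | cons a l' ih =>
      intro hl'
      obtain ⟨h1, h2⟩ := ih fun a ha => hl' a (List.mem_cons_of_mem _ ha)
      obtain ⟨h3, h4⟩ := hl' a List.mem_cons_self
      rw [List.prod_cons, List.length_cons, pow_succ']
      exact ⟨mul_nonneg h3 h1, mul_le_mul h4 h2 h1 (h3.trans h4)⟩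
  refine (key l fun a ha => ⟨h a ha, hmax a (List.mem_toFinset.2 ha)⟩).2.trans ?_
  refine List.single_le_sum ?_ _ (List.mem_map.2 ⟨m, hm, rfl⟩)
  intro b hb
  obtain ⟨a, ha, rfl⟩ := List.mem_map.1 hb
  exact pow_nonneg (h a ha) _

theorem norm_pairProd_le (x : V × V → Ω → ℂ) {l : List (V × V)} (h : l ≠ []) (ω : Ω) :
    ‖pairProd x l ω‖ ≤ (l.map fun e => ‖x e ω‖ ^ l.length).sum := by
  have := List.prod_le_sum_pow_length (l.map fun e => ‖x e ω‖) (fun a ha => by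
    obtain ⟨e, -, rfl⟩ := List.mem_map.1 ha
    exact norm_nonneg _) (by simpa using h)
  simpa [pairProd, List.norm_prod, Function.comp_def] using this

theorem norm_sum_le_card_mul {ι : Type*} {s t : Finset ι} {f : ι → ℂ} {C : ℝ} (hC : 0 ≤ C)
    (h0 : ∀ i ∈ s, i ∉ t → f i = 0) (h1 : ∀ i ∈ s, ‖f i‖ ≤ C) :
    ‖∑ i ∈ s, f i‖ ≤ t.card * C := by
  have : ∑ i ∈ s, f i = ∑ i ∈ s ∩ t, f i := by
    symm
    refine Finset.sum_subset Finset.inter_subset_left fun i hi hit => h0 i hi fun h => ?_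
    exact hit (Finset.mem_inter.2 ⟨hi, h⟩)
  rw [this]
  refine (norm_sum_le_of_le _ fun i hi => h1 i (Finset.mem_inter.1 hi).1).trans ?_
  rw [Finset.sum_const, nsmul_eq_mul]
  gcongr
  exact Finset.inter_subset_right

/-- The walks with `m` steps and fewer than `k` classes. -/
noncomputable def fewClassWalks [Fintype V] (adj : V × V → Prop) (cls : V × V → Q) (m k : ℕ) :
    Finset (List V) :=
  (listsOfLength V (m + 1)).filter fun p => IsWalk adj p ∧ (classes cls p).card < k

theorem card_fewClassWalks_le [Fintype V] {adj : V × V → Prop} {cls : V × V → Q}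
    {B : ℕ} (hV : 0 < Fintype.card V)
    (hadj : ∀ e : V × V, adj e → adj e.swap) (hsymm : ∀ e : V × V, cls e.swap = cls e)
    (hB : ∀ (i : V) (c : Q),
      (Finset.univ.filter fun j => adj (i, j) ∧ cls (i, j) = c).card ≤ B) (m k : ℕ) :
    (fewClassWalks adj cls m k).card ≤
      k * (((m + 1) * B + 1) ^ m * Fintype.card V ^ k) := by
  refine (Finset.card_le_card (t := (Finset.range k).biUnion fun c =>
    (listsOfLength V (m + 1)).filter fun p =>
      IsWalk adj p ∧ (classes cls p).card = c) ?_).trans ?_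
  · intro p hp
    simp only [fewClassWalks, Finset.mem_filter, mem_listsOfLength] at hp
    simp only [Finset.mem_biUnion, Finset.mem_range, Finset.mem_filter, mem_listsOfLength]
    exact ⟨_, hp.2.2, hp.1, hp.2.1, rfl⟩
  · refine (Finset.card_biUnion_le_card_mul _ _ (((m + 1) * B + 1) ^ m * Fintype.card V ^ k)
      ?_).trans (by simp)
    intro c hc
    refine (card_walks_le hadj hsymm hB m c).trans ?_
    exact Nat.mul_le_mul_left _ (Nat.pow_le_pow_right hV (Finset.mem_range.1 hc))

/-- The lists with `m` steps and equal end points. -/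
noncomputable def closedLists (V : Type*) [Fintype V] (m : ℕ) : Finset (List V) :=
  (listsOfLength V (m + 1)).filter fun p => p.head? = p.getLast?

variable [MeasurableSpace Ω]

/-- A Hermitian family of centred random variables of variance one, indexed by the admissible pairs,
such that each is independent of those of the other classes. -/
structure IsHermitianFamily (P : Measure Ω) (adj : V × V → Prop) (cls : V × V → Q)
    (x : V × V → Ω → ℂ) (K : ℕ → ℝ) : Prop where
  adj_swap : ∀ e : V × V, adj e → adj e.swap
  cls_swap : ∀ e : V × V, cls e.swap = cls e
  measurable : ∀ e, Measurable (x e)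
  eq_zero : ∀ e, ¬ adj e → ∀ ω, x e ω = 0
  swap : ∀ e : V × V, ∀ ω, x e.swap ω = conj (x e ω)
  indep : ∀ e, adj e →
    IndepFun (x e) (fun ω (f : {f : V × V // adj f ∧ cls f ≠ cls e}) => x f.1 ω) P
  center : ∀ e, adj e → ∫ ω, x e ω ∂P = 0
  variance : ∀ e, adj e → ∫ ω, ‖x e ω‖ ^ 2 ∂P = 1
  integrable_pow : ∀ e, ∀ k : ℕ, Integrable (fun ω => ‖x e ω‖ ^ k) P
  moment_le : ∀ e, ∀ k : ℕ, ∫ ω, ‖x e ω‖ ^ k ∂P ≤ K k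

namespace IsHermitianFamily

variable {P : Measure Ω} {adj : V × V → Prop} {cls : V × V → Q} {x : V × V → Ω → ℂ} {K : ℕ → ℝ}

theorem measurable_pairProd (h : IsHermitianFamily P adj cls x K) (l : List (V × V)) :
    Measurable (pairProd x l) := by
  induction l with
  | nil => exact measurable_const
  | cons e l ih =>
    have : pairProd x (e :: l) = fun ω => x e ω * pairProd x l ω := by ext; simp
    rw [this]
    exact (h.measurable e).mul ih

theorem integrable_sum (h : IsHermitianFamily P adj cls x K) (l : List (V × V)) (m : ℕ) :
    Integrable (fun ω => (l.map fun e => ‖x e ω‖ ^ m).sum) P ∧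
      ∫ ω, (l.map fun e => ‖x e ω‖ ^ m).sum ∂P ≤ l.length * K m := by
  induction l with
  | nil => simp
  | cons e l ih =>
    simp only [List.map_cons, List.sum_cons, List.length_cons]
    refine ⟨(h.integrable_pow e m).add ih.1, ?_⟩
    rw [integral_add (h.integrable_pow e m) ih.1]
    push_cast
    linarith [h.moment_le e m, ih.2]

theorem integrable_pairProd [IsProbabilityMeasure P] (h : IsHermitianFamily P adj cls x K) (l : List (V × V)) :
    Integrable (pairProd x l) P := by
  by_cases hl : l = []
  · subst hl
    exact integrable_const 1
  · exact (h.integrable_sum l l.length).1.mono' (h.measurable_pairProd l).aestronglyMeasurable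
      (ae_of_all _ fun ω => norm_pairProd_le x hl ω)

/-- The bound depends only on `K` and the length of the list, hence is uniform in the matrix size.
The summand `1` covers the empty list. -/
theorem norm_integral_pairProd_le [IsProbabilityMeasure P] (h : IsHermitianFamily P adj cls x K) (l : List (V × V)) :
    ‖∫ ω, pairProd x l ω ∂P‖ ≤ 1 + l.length * |K l.length| := by
  by_cases hl : l = []
  · subst hl
    simp
  · refine (norm_integral_le_integral_norm _).trans ?_
    refine (integral_mono (h.integrable_pairProd l).norm (h.integrable_sum l l.length).1
      fun ω => norm_pairProd_le x hl ω).trans ((h.integrable_sum l l.length).2.trans ?_)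
    nlinarith [le_abs_self (K l.length), (Nat.cast_nonneg l.length : (0 : ℝ) ≤ l.length)]

theorem indepFun_pairProd (h : IsHermitianFamily P adj cls x K) {e : V × V} (he : adj e)
    {l : List (V × V)} (hl : ∀ f ∈ l, adj f ∧ cls f ≠ cls e) :
    IndepFun (x e) (pairProd x l) P := by
  have key : ∃ g : ({f : V × V // adj f ∧ cls f ≠ cls e} → ℂ) → ℂ, Measurable g ∧
      pairProd x l = g ∘ fun ω f => x f.1 ω := by
    induction l with
    | nil => exact ⟨fun _ => 1, measurable_const, rfl⟩
    | cons f l ih =>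
      obtain ⟨g, hg, hgl⟩ := ih fun f hf => hl f (List.mem_cons_of_mem _ hf)
      refine ⟨fun F => F ⟨f, hl f List.mem_cons_self⟩ * g F, (measurable_pi_apply _).mul hg, ?_⟩
      ext ω
      simp [hgl]
  obtain ⟨g, hg, hgl⟩ := key
  rw [hgl]
  exact (h.indep e he).comp measurable_id hg

/-- An entry that is alone in its class is independent of the product of the others, so its zero
mean factors out. -/
theorem integral_pairProd_eq_zero [IsProbabilityMeasure P] (h : IsHermitianFamily P adj cls x K) {l : List (V × V)}
    (hl : ∀ f ∈ l, adj f) {c : Q} (hc : c ∈ (l.map cls).toFinset) (hc2 : (l.map cls).count c < 2) :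
    ∫ ω, pairProd x l ω ∂P = 0 := by
  obtain ⟨e, he, rfl⟩ := List.mem_map.1 (List.mem_toFinset.1 hc)
  obtain ⟨l₁, l₂, rfl⟩ := List.append_of_mem he
  have hne : ∀ f ∈ l₁ ++ l₂, adj f ∧ cls f ≠ cls e := by
    intro f hf
    refine ⟨hl f (by simp at hf ⊢; tauto), fun hfe => ?_⟩
    have : 0 < ((l₁ ++ l₂).map cls).count (cls e) :=
      List.count_pos_iff.2 (List.mem_map.2 ⟨f, hf, hfe⟩)
    simp only [List.map_append, List.map_cons, List.count_append, List.count_cons_self] at this hc2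
    omega
  have hadj : adj e := hl e he
  have e1 : ∀ ω, pairProd x (l₁ ++ e :: l₂) ω = x e ω * pairProd x (l₁ ++ l₂) ω := by
    intro ω
    simp only [pairProd_append, pairProd_cons]
    ring
  simp only [e1]
  rw [(h.indepFun_pairProd hadj hne).integral_fun_mul_eq_mul_integral
    (h.measurable e).aestronglyMeasurable (h.measurable_pairProd _).aestronglyMeasurable,
    h.center e hadj, zero_mul]

/-- Factors are peeled off one at a time, which needs only the independence of one entry from the
entries of other classes. -/
theorem integral_norm_pairProd_sq [IsProbabilityMeasure P] (h : IsHermitianFamily P adj cls x K) {l : List (V × V)}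
    (hl : ∀ f ∈ l, adj f) (hn : (l.map cls).Nodup) :
    ∫ ω, ‖pairProd x l ω‖ ^ 2 ∂P = 1 := by
  induction l with
  | nil => simp
  | cons e l ih =>
    rw [List.map_cons, List.nodup_cons] at hn
    have hind := h.indepFun_pairProd (hl e List.mem_cons_self) (l := l) fun f hf =>
      ⟨hl f (List.mem_cons_of_mem _ hf), fun hfe => hn.1 (List.mem_map.2 ⟨f, hf, hfe⟩)⟩
    have hind2 := hind.comp (φ := fun z : ℂ => ‖z‖ ^ 2) (ψ := fun z : ℂ => ‖z‖ ^ 2)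
      (by fun_prop) (by fun_prop)
    have hm := hind2.integral_fun_mul_eq_mul_integral
      ((h.measurable e).norm.pow_const 2).aestronglyMeasurable
      ((h.measurable_pairProd l).norm.pow_const 2).aestronglyMeasurable
    simp only [Function.comp_apply] at hm
    simp only [pairProd_cons, norm_mul, mul_pow]
    rw [hm, h.variance e (hl e List.mem_cons_self),
      ih (fun f hf => hl f (List.mem_cons_of_mem _ hf)) hn.2, one_mul]

/-- The list `l` consists of the tree edges in their downward direction. The way back up contributes
the conjugate entry. -/
theorem exists_pairProd_eq (h : IsHermitianFamily P adj cls x K) {v : V} {w : List V}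
    (hd : Dyck adj v w) : ∃ l : List (V × V), (∀ f ∈ l, adj f) ∧ 2 * l.length = w.length ∧
      (l.map cls).toFinset = classes cls (v :: w) ∧
      ∀ ω, pairProd x (steps (v :: w)) ω = ((‖pairProd x l ω‖ ^ 2 : ℝ) : ℂ) := by
  induction hd with
  | nil v => exact ⟨[], by simp⟩
  | @node v u l r hu hl hr ihl ihr =>
    obtain ⟨a, ha1, ha2, ha3, ha4⟩ := ihl
    obtain ⟨b, hb1, hb2, hb3, hb4⟩ := ihr
    refine ⟨(v, u) :: (a ++ b), ?_, ?_, ?_, ?_⟩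
    · intro f hf
      rcases List.mem_cons.1 hf with rfl | hf
      · exact hu
      · exact (List.mem_append.1 hf).elim (ha1 f) (hb1 f)
    · simp
      omega
    · rw [hl.classes_node h.cls_swap, ← ha3, ← hb3]
      simp
    · intro ω
      obtain ⟨z, hz⟩ := hl.exists_append
      have hs : steps (v :: u :: (l ++ v :: r)) =
          (v, u) :: (steps (u :: l) ++ (u, v) :: steps (v :: r)) := by
        rw [steps_cons_cons, ← List.cons_append, hz, List.append_assoc, List.singleton_append,
          steps_append_cons]
        rfl
      have hsw : x (u, v) ω = conj (x (v, u) ω) := h.swap (v, u) ω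
      rw [hs, pairProd_cons, pairProd_append, pairProd_cons, ha4, hb4, hsw, pairProd_cons,
        pairProd_append, norm_mul, norm_mul]
      push_cast
      have : x (v, u) ω * conj (x (v, u) ω) = (‖x (v, u) ω‖ : ℂ) ^ 2 := Complex.mul_conj' _
      linear_combination (‖pairProd x a ω‖ : ℂ) ^ 2 * (‖pairProd x b ω‖ : ℂ) ^ 2 * this

theorem integral_eq_zero [IsProbabilityMeasure P] (h : IsHermitianFamily P adj cls x K) {p : List V}
    (hp : ¬ (IsWalk adj p ∧ ∀ c ∈ classes cls p, 2 ≤ ((steps p).map cls).count c)) :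
    ∫ ω, pairProd x (steps p) ω ∂P = 0 := by
  by_cases hw : IsWalk adj p
  · obtain ⟨c, hc, hc2⟩ : ∃ c ∈ classes cls p, ((steps p).map cls).count c < 2 := by
      simpa [hw] using hp
    exact h.integral_pairProd_eq_zero hw hc hc2
  · obtain ⟨e, he, hne⟩ : ∃ e ∈ steps p, ¬ adj e := by simpa [IsWalk] using hw
    have : ∀ ω, pairProd x (steps p) ω = 0 := fun ω =>
      List.prod_eq_zero (List.mem_map.2 ⟨e, he, h.eq_zero e hne ω⟩)
    simp [this]

variable [Fintype V]

/-- There are `k` tree edges and `k` classes, so the edges have distinct classes. -/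
theorem integral_contourWalk [IsProbabilityMeasure P] (h : IsHermitianFamily P adj cls x K) {col : V → Bool} {k : ℕ}
    {b : Bool} {p : List V} (hp : p ∈ contourWalks adj cls col k b) :
    ∫ ω, pairProd x (steps p) ω ∂P = 1 := by
  obtain ⟨v, w, rfl, hd, -, hlen, hc⟩ := mem_contourWalks.1 hp
  obtain ⟨l, h1, h2, h3, h4⟩ := h.exists_pairProd_eq hd
  have hn : (l.map cls).Nodup := by
    rw [← h3] at hc
    have : (l.map cls).toFinset.card = (l.map cls).length := by rw [List.length_map]; omega
    exact Multiset.toFinset_card_eq_card_iff_nodup.1 this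
  simp only [h4]
  refine (integral_ofReal (𝕜 := ℂ) (f := fun ω => ‖pairProd x l ω‖ ^ 2)).trans ?_
  rw [h.integral_norm_pairProd_sq h1 hn]
  simp

/-- If every class is met at least twice in `2k + 1` steps, there are at most `k` classes. -/
theorem norm_sum_odd_le [IsProbabilityMeasure P] (h : IsHermitianFamily P adj cls x K) (k : ℕ) :
    ‖∑ p ∈ closedLists V (2 * k + 1), ∫ ω, pairProd x (steps p) ω ∂P‖ ≤
      (fewClassWalks adj cls (2 * k + 1) (k + 1)).card *
        (1 + (2 * k + 1 : ℕ) * |K (2 * k + 1)|) := by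
  refine norm_sum_le_card_mul (by positivity) ?_ ?_
  · intro p hp hpt
    simp only [closedLists, Finset.mem_filter, mem_listsOfLength] at hp
    refine h.integral_eq_zero fun hw => hpt ?_
    have := two_mul_card_classes_le hw.2
    simp only [fewClassWalks, Finset.mem_filter, mem_listsOfLength]
    exact ⟨hp.1, hw.1, by omega⟩
  · intro p hp
    simp only [closedLists, Finset.mem_filter, mem_listsOfLength] at hp
    have := h.norm_integral_pairProd_le (steps p)
    rwa [length_steps, hp.1, Nat.add_sub_cancel] at this

/-- Contour walks with `k` classes contribute exactly one each. Any other closed walk contributes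
zero unless it has fewer than `k` classes or lies in `nonDyck`. -/
theorem norm_sum_even_sub_le [IsProbabilityMeasure P] (h : IsHermitianFamily P adj cls x K) (col : V → Bool) (k : ℕ) :
    ‖∑ p ∈ closedLists V (2 * k), ∫ ω, pairProd x (steps p) ω ∂P -
      ((contourWalks adj cls col k true).card + (contourWalks adj cls col k false).card : ℂ)‖ ≤
      ((nonDyck adj cls k).card + (fewClassWalks adj cls (2 * k) k).card) *
        (1 + (2 * k : ℕ) * |K (2 * k)|) := by
  set G := contourWalks adj cls col k true ∪ contourWalks adj cls col k false with hG
  have hGmem : ∀ p, p ∈ G ↔ p.length = 2 * k + 1 ∧ (∃ v w, p = v :: w ∧ Dyck adj v w) ∧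
      (classes cls p).card = k := by
    intro p
    rw [hG, Finset.mem_union, mem_contourWalks, mem_contourWalks]
    constructor
    · rintro (⟨v, w, rfl, h1, h2, h3, h4⟩ | ⟨v, w, rfl, h1, h2, h3, h4⟩) <;>
        exact ⟨by simpa using h3, ⟨v, w, rfl, h1⟩, h4⟩
    · rintro ⟨h3, ⟨v, w, rfl, h1⟩, h4⟩
      have h3' : w.length = 2 * k := by simpa using h3
      cases hc : col v
      · exact Or.inr ⟨v, w, rfl, h1, hc, h3', h4⟩
      · exact Or.inl ⟨v, w, rfl, h1, hc, h3', h4⟩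
  have hdisj : Disjoint (contourWalks adj cls col k true) (contourWalks adj cls col k false) := by
    rw [Finset.disjoint_left]
    intro p hp hp'
    obtain ⟨v, w, rfl, -, h1, -⟩ := mem_contourWalks.1 hp
    obtain ⟨v', w', h2, -, h3, -⟩ := mem_contourWalks.1 hp'
    obtain ⟨rfl, -⟩ : v = v' ∧ _ := by simpa using h2
    rw [h1] at h3
    simp at h3
  have hsub : G ⊆ closedLists V (2 * k) := by
    intro p hp
    obtain ⟨h1, ⟨v, w, rfl, hd⟩, -⟩ := (hGmem p).1 hp
    simp only [closedLists, Finset.mem_filter, mem_listsOfLength]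
    refine ⟨h1, ?_⟩
    obtain ⟨z, hz⟩ := hd.exists_append
    have : (v :: w).getLast? = some v := by rw [hz]; simp
    rw [this]
    rfl
  have hGsum : ∑ p ∈ G, ∫ ω, pairProd x (steps p) ω ∂P =
      ((contourWalks adj cls col k true).card + (contourWalks adj cls col k false).card : ℂ) := by
    rw [Finset.sum_congr rfl (g := fun _ => (1 : ℂ))]
    · rw [Finset.sum_const, hG, Finset.card_union_of_disjoint hdisj]
      simp
    · intro p hp
      rcases Finset.mem_union.1 hp with hp | hp <;> exact h.integral_contourWalk hp
  rw [← hGsum, ← Finset.sum_sdiff hsub, add_sub_cancel_right]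
  have hcard : ((nonDyck adj cls k ∪ fewClassWalks adj cls (2 * k) k).card : ℝ) ≤
      (nonDyck adj cls k).card + (fewClassWalks adj cls (2 * k) k).card := by
    exact_mod_cast Finset.card_union_le _ _
  refine (norm_sum_le_card_mul (t := nonDyck adj cls k ∪ fewClassWalks adj cls (2 * k) k)
    (C := 1 + (2 * k : ℕ) * |K (2 * k)|) (by positivity) ?_ ?_).trans
    (mul_le_mul_of_nonneg_right hcard (by positivity))
  · intro p hp hpt
    rw [Finset.mem_sdiff, hGmem] at hp
    obtain ⟨hp1, hp2⟩ := hp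
    simp only [closedLists, Finset.mem_filter, mem_listsOfLength] at hp1
    refine h.integral_eq_zero fun hw => hpt ?_
    have h2 := two_mul_card_classes_le hw.2
    rw [Finset.mem_union]
    by_cases hk : (classes cls p).card = k
    · left
      simp only [nonDyck, Finset.mem_filter, mem_listsOfLength]
      exact ⟨hp1.1, ⟨hp1.1, hw.1, hk, hw.2⟩, fun hd => hp2 ⟨hp1.1, hd, hk⟩⟩
    · right
      simp only [fewClassWalks, Finset.mem_filter, mem_listsOfLength]
      exact ⟨hp1.1, hw.1, by omega⟩
  · intro p hp
    have hp1 := (Finset.mem_sdiff.1 hp).1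
    simp only [closedLists, Finset.mem_filter, mem_listsOfLength] at hp1
    have := h.norm_integral_pairProd_le (steps p)
    rwa [length_steps, hp1.1, Nat.add_sub_cancel] at this

end IsHermitianFamily

/-! ### Traces of powers as sums over closed walks -/

theorem Matrix.pow_apply_eq_sum_lists [Fintype V] [DecidableEq V] (M : Matrix V V ℂ) (m : ℕ) (i j : V) :
    (M ^ m) i j = ∑ w ∈ (listsOfLength V m).filter fun w => (i :: w).getLast? = some j,
      ((steps (i :: w)).map fun e => M e.1 e.2).prod := by
  induction m generalizing i with
  | zero =>
    rw [Finset.sum_filter, listsOfLength_zero, Finset.sum_singleton]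
    simp [Matrix.one_apply]
  | succ m ih =>
    rw [pow_succ', Matrix.mul_apply, Finset.sum_filter, sum_listsOfLength_succ]
    refine Finset.sum_congr rfl fun u _ => ?_
    rw [ih u, Finset.mul_sum, Finset.sum_filter]
    refine Finset.sum_congr rfl fun w _ => ?_
    simp only [List.getLast?_cons_cons, steps_cons_cons, List.map_cons, List.prod_cons]

theorem Matrix.trace_pow_eq_sum_lists [Fintype V] [DecidableEq V] (M : Matrix V V ℂ) (m : ℕ) :
    (M ^ m).trace = ∑ p ∈ closedLists V m,
      ((steps p).map fun e => M e.1 e.2).prod := by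
  rw [closedLists, Finset.sum_filter, sum_listsOfLength_succ, Matrix.trace]
  refine Finset.sum_congr rfl fun i _ => ?_
  rw [Matrix.diag_apply, Matrix.pow_apply_eq_sum_lists, Finset.sum_filter]
  refine Finset.sum_congr rfl fun w _ => ?_
  simp only [List.head?_cons, eq_comm]

end Expectations

/-! ### Limits of the normalised sums over closed walks -/

section MomentLimits

open scoped Classical

/-- A sequence of Hermitian families on growing complete bipartite graphs that satisfies the
multiplicity conditions. -/
structure IsHermitianSequence {Ω V Q : ℕ → Type*} [∀ n, MeasurableSpace (Ω n)]
    [∀ n, Fintype (V n)] (P : ∀ n, Measure (Ω n)) (adj : ∀ n, V n × V n → Prop)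
    (cls : ∀ n, V n × V n → Q n) (x : ∀ n, V n × V n → Ω n → ℂ) (col : ∀ n, V n → Bool)
    (K : ℕ → ℝ) (B : ℕ) (κ : ℝ) : Prop where
  family : ∀ n, IsHermitianFamily (P n) (adj n) (cls n) (x n) K
  adj_iff : ∀ n u v, adj n (u, v) ↔ col n u ≠ col n v
  card_le : ∀ n, ∀ (i : V n) (c : Q n),
    (Finset.univ.filter fun j => adj n (i, j) ∧ cls n (i, j) = c).card ≤ B
  tendsto_card : Tendsto (fun n => (Fintype.card (V n) : ℝ)) atTop atTop
  tendsto_colour : ∀ b, Tendsto (fun n => ((Finset.univ.filter fun v => col n v = b).card : ℝ) /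
    Fintype.card (V n)) atTop (𝓝 (chiralCatalan κ 0 b))
  tendsto_turnPairs : Tendsto (fun n => ((turnPairs (adj n) (cls n)).card : ℝ) /
    (Fintype.card (V n) : ℝ) ^ 2) atTop (𝓝 0)
  tendsto_stepPairs : Tendsto (fun n => ((stepPairs (adj n) (cls n)).card : ℝ) /
    (Fintype.card (V n) : ℝ) ^ 3) atTop (𝓝 0)

namespace IsHermitianSequence

variable {Ω : ℕ → Type*} {V Q : ℕ → Type} [∀ n, MeasurableSpace (Ω n)]
    [∀ n, Fintype (V n)] {P : ∀ n, Measure (Ω n)} {adj : ∀ n, V n × V n → Prop}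
    {cls : ∀ n, V n × V n → Q n} {x : ∀ n, V n × V n → Ω n → ℂ} {col : ∀ n, V n → Bool}
    {K : ℕ → ℝ} {B : ℕ} {κ : ℝ}

/-- The factor `f` is the excess of the normalisation over the count: `N` for even moments, `√N` for
odd ones. -/
theorem tendsto_fewClassWalks (h : IsHermitianSequence P adj cls x col K B κ) (m k : ℕ) {f : ℕ → ℝ}
    (hf : Tendsto f atTop atTop) :
    Tendsto (fun n => ((fewClassWalks (adj n) (cls n) m k).card : ℝ) /
      ((Fintype.card (V n) : ℝ) ^ k * f n)) atTop (𝓝 0) := by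
  have hpos : ∀ᶠ n in atTop, (0 : ℝ) < Fintype.card (V n) := h.tendsto_card.eventually_gt_atTop 0
  have hlim := hf.const_div_atTop ((k : ℝ) * ((((m + 1) * B + 1) ^ m : ℕ) : ℝ))
  refine squeeze_zero' ?_ ?_ hlim
  · filter_upwards [hf.eventually_gt_atTop 0] with n hn
    positivity
  · filter_upwards [hpos, hf.eventually_gt_atTop 0] with n hn hfn
    have := card_fewClassWalks_le (Nat.cast_pos.1 hn) (h.family n).adj_swap (h.family n).cls_swap
      (h.card_le n) m k
    rw [div_le_div_iff₀ (by positivity) hfn]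
    have h2 : ((fewClassWalks (adj n) (cls n) m k).card : ℝ) ≤
      k * (((((m + 1) * B + 1) ^ m : ℕ) : ℝ) * (Fintype.card (V n) : ℝ) ^ k) := by
      exact_mod_cast this
    calc _ ≤ k * (((((m + 1) * B + 1) ^ m : ℕ) : ℝ) * (Fintype.card (V n) : ℝ) ^ k) * f n := by
          gcongr
      _ = _ := by ring

theorem tendsto_nonDyck (h : IsHermitianSequence P adj cls x col K B κ) (k : ℕ) :
    Tendsto (fun n => ((nonDyck (adj n) (cls n) k).card : ℝ) /
      (Fintype.card (V n) : ℝ) ^ (k + 1)) atTop (𝓝 0) := by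
  obtain ⟨C, hC, hbound⟩ := exists_card_nonDyck_le B k
  have hlim := (h.tendsto_turnPairs.add h.tendsto_stepPairs).const_mul C
  rw [add_zero, mul_zero] at hlim
  refine squeeze_zero' (Eventually.of_forall fun n => by positivity) ?_ hlim
  filter_upwards [h.tendsto_card.eventually_gt_atTop 0] with n hn
  rw [div_le_iff₀ (by positivity)]
  -- Here `η` is the sum of the two normalised counts, so it dominates each of them.
  refine hbound (adj n) (cls n) _ (h.family n).adj_swap (h.family n).cls_swap (h.card_le n)
    (by positivity) ?_ ?_
  · rw [add_mul, div_mul_cancel₀ _ (by positivity)]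
    exact le_add_of_nonneg_right (by positivity)
  · rw [add_mul, div_mul_cancel₀ _ (by positivity)]
    exact le_add_of_nonneg_left (by positivity)

variable [∀ n, IsProbabilityMeasure (P n)]

theorem tendsto_even (h : IsHermitianSequence P adj cls x col K B κ) (k : ℕ) :
    Tendsto (fun n => (∑ p ∈ closedLists (V n) (2 * k),
      ∫ ω, pairProd (x n) (steps p) ω ∂P n) / ((Fintype.card (V n) : ℂ) ^ (k + 1))) atTop
      (𝓝 ((chiralCatalan κ k true + chiralCatalan κ k false : ℝ) : ℂ)) := by
  have hG : ∀ b, Tendsto (fun n => ((contourWalks (adj n) (cls n) (col n) k b).card : ℝ) /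
      (Fintype.card (V n) : ℝ) ^ (k + 1)) atTop (𝓝 (chiralCatalan κ k b)) :=
    tendsto_card_contourWalks (fun n => (h.family n).adj_swap) (fun n => (h.family n).cls_swap)
      h.card_le h.adj_iff h.tendsto_card h.tendsto_colour k
  have hGC := (Complex.continuous_ofReal.tendsto _).comp ((hG true).add (hG false))
  have hE : Tendsto (fun n => (((nonDyck (adj n) (cls n) k).card : ℝ) /
      (Fintype.card (V n) : ℝ) ^ (k + 1) + ((fewClassWalks (adj n) (cls n) (2 * k) k).card : ℝ) /
      ((Fintype.card (V n) : ℝ) ^ k * Fintype.card (V n))) *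
      (1 + (2 * k : ℕ) * |K (2 * k)|)) atTop (𝓝 0) := by
    have := ((h.tendsto_nonDyck k).add (h.tendsto_fewClassWalks (2 * k) k h.tendsto_card)).mul_const
      (1 + (2 * k : ℕ) * |K (2 * k)|)
    simpa using this
  rw [← tendsto_sub_nhds_zero_iff]
  have hE2 : Tendsto (fun n => (∑ p ∈ closedLists (V n) (2 * k),
      ∫ ω, pairProd (x n) (steps p) ω ∂P n) / ((Fintype.card (V n) : ℂ) ^ (k + 1)) -
      ((((contourWalks (adj n) (cls n) (col n) k true).card : ℝ) /
      (Fintype.card (V n) : ℝ) ^ (k + 1) + ((contourWalks (adj n) (cls n) (col n) k false).card : ℝ) /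
      (Fintype.card (V n) : ℝ) ^ (k + 1) : ℝ) : ℂ)) atTop (𝓝 0) := by
    refine squeeze_zero_norm (fun n => ?_) hE
    have := (h.family n).norm_sum_even_sub_le (col n) k
    set S := ∑ p ∈ closedLists (V n) (2 * k), ∫ ω, pairProd (x n) (steps p) ω ∂P n
    have e : S / ((Fintype.card (V n) : ℂ) ^ (k + 1)) -
      ((((contourWalks (adj n) (cls n) (col n) k true).card : ℝ) /
      (Fintype.card (V n) : ℝ) ^ (k + 1) + ((contourWalks (adj n) (cls n) (col n) k false).card : ℝ) /
      (Fintype.card (V n) : ℝ) ^ (k + 1) : ℝ) : ℂ) =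
      (S - ((contourWalks (adj n) (cls n) (col n) k true).card +
        (contourWalks (adj n) (cls n) (col n) k false).card : ℂ)) /
        ((Fintype.card (V n) : ℂ) ^ (k + 1)) := by
      push_cast
      ring
    rw [e, norm_div, norm_pow, Complex.norm_natCast, ← pow_succ, ← add_div, div_mul_eq_mul_div]
    exact div_le_div_of_nonneg_right this (by positivity)
  have := hE2.add (hGC.sub_const
    ((chiralCatalan κ k true + chiralCatalan κ k false : ℝ) : ℂ))
  rw [sub_self, add_zero] at this
  refine this.congr fun n => ?_
  simp only [Function.comp_apply]
  ring

theorem tendsto_odd (h : IsHermitianSequence P adj cls x col K B κ) (k : ℕ) :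
    Tendsto (fun n => (∑ p ∈ closedLists (V n) (2 * k + 1),
      ∫ ω, pairProd (x n) (steps p) ω ∂P n) /
      (((Fintype.card (V n) : ℝ) ^ (k + 1) * √(Fintype.card (V n) : ℝ) : ℝ) : ℂ)) atTop
      (𝓝 0) := by
  have hsq : Tendsto (fun n => √(Fintype.card (V n) : ℝ)) atTop atTop :=
    Real.tendsto_sqrt_atTop.comp h.tendsto_card
  have hE := (h.tendsto_fewClassWalks (2 * k + 1) (k + 1) hsq).mul_const
    (1 + (2 * k + 1 : ℕ) * |K (2 * k + 1)|)
  rw [zero_mul] at hE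
  refine squeeze_zero_norm (fun n => ?_) hE
  rw [norm_div, Complex.norm_real, Real.norm_of_nonneg (by positivity), div_mul_eq_mul_div]
  exact div_le_div_of_nonneg_right ((h.family n).norm_sum_odd_le k) (by positivity)

end IsHermitianSequence

end MomentLimits

/-! ### The mean empirical eigenvalue measure and its moments -/

section EmpiricalMeasure

variable {ι : Type*} [Fintype ι] [DecidableEq ι]

theorem Matrix.IsHermitian.trace_pow_eq_sum_eigenvalues {M : Matrix ι ι ℂ} (hM : M.IsHermitian)
    (m : ℕ) : (M ^ m).trace = ((∑ j, hM.eigenvalues j ^ m : ℝ) : ℂ) := by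
  conv_lhs => rw [hM.spectral_theorem]
  rw [← map_pow, Unitary.conjStarAlgAut_apply, Matrix.trace_mul_comm, ← mul_assoc]
  simp [Matrix.diagonal_pow, Matrix.trace_diagonal]

theorem integral_empiricalMeasure {M : Matrix ι ι ℂ} (hM : M.IsHermitian) (f : ℝ → ℝ) :
    ∫ x, f x ∂(empiricalMeasure M hM) =
      (Fintype.card ι : ℝ)⁻¹ * ∑ j, f (hM.eigenvalues j) := by
  rw [empiricalMeasure, integral_smul_measure, integral_finsetSum_measure]
  · simp
  · intro j _
    exact integrable_dirac (by simp)

theorem integrable_empiricalMeasure [Nonempty ι] {M : Matrix ι ι ℂ} (hM : M.IsHermitian)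
    (f : ℝ → ℝ) : Integrable f (empiricalMeasure M hM) := by
  refine Integrable.smul_measure ?_ (by simp)
  rw [integrable_finsetSum_measure]
  intro j _
  exact integrable_dirac (by simp)

instance isProbabilityMeasure_empiricalMeasure [Nonempty ι] {M : Matrix ι ι ℂ}
    (hM : M.IsHermitian) : IsProbabilityMeasure (empiricalMeasure M hM) := by
  refine ⟨?_⟩
  simp only [empiricalMeasure, Measure.smul_apply, Measure.finsetSum_apply, measure_univ,
    Finset.sum_const, Finset.card_univ, nsmul_eq_mul, mul_one, smul_eq_mul]
  exact ENNReal.inv_mul_cancel (by simp) (by simp)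

variable {Ω : Type*} [MeasurableSpace Ω] {H : Ω → Matrix ι ι ℂ}

theorem measurable_matrix_pow (hmeas : ∀ i j, Measurable fun ω => H ω i j) (m : ℕ) :
    ∀ i j, Measurable fun ω => (H ω ^ m) i j := by
  induction m with
  | zero => intro i j; simp
  | succ m ih =>
    intro i j
    simp only [pow_succ, Matrix.mul_apply]
    exact Finset.measurable_sum _ fun k _ => (ih i k).mul (hmeas k j)

theorem measurable_sum_eigenvalues_pow (hmeas : ∀ i j, Measurable fun ω => H ω i j)
    (hH : ∀ ω, (H ω).IsHermitian) (m : ℕ) :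
    Measurable fun ω => ∑ j, (hH ω).eigenvalues j ^ m := by
  have e : (fun ω => ∑ j, (hH ω).eigenvalues j ^ m) = fun ω => ((H ω ^ m).trace).re := by
    ext ω
    rw [(hH ω).trace_pow_eq_sum_eigenvalues, Complex.ofReal_re]
  rw [e]
  exact Complex.measurable_re.comp
    (Finset.measurable_sum _ fun k _ => measurable_matrix_pow hmeas m k k)

/-- Power sums of eigenvalues are traces, hence measurable, and Weierstrass approximation on `[-n,
n]` passes to continuous `g`. No measurability of individual eigenvalues is needed. -/
theorem measurable_sum_eigenvalues (hmeas : ∀ i j, Measurable fun ω => H ω i j)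
    (hH : ∀ ω, (H ω).IsHermitian) {g : ℝ → ℝ} (hg : Continuous g) :
    Measurable fun ω => ∑ j, g ((hH ω).eigenvalues j) := by
  have hq : ∀ n : ℕ, ∃ q : Polynomial ℝ, ∀ x ∈ Set.Icc (-(n : ℝ)) n,
      |q.eval x - g x| < 1 / ((n : ℝ) + 1) := fun n =>
    exists_polynomial_near_of_continuousOn _ _ g hg.continuousOn _ (by positivity)
  choose q hq using hq
  refine measurable_of_tendsto_metrizable (f := fun n ω => ∑ j, (q n).eval ((hH ω).eigenvalues j))
    ?_ ?_
  · intro n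
    have e : (fun ω => ∑ j, (q n).eval ((hH ω).eigenvalues j)) =
        fun ω => ∑ i ∈ Finset.range ((q n).natDegree + 1),
          (q n).coeff i * ∑ j, (hH ω).eigenvalues j ^ i := by
      ext ω
      simp only [Polynomial.eval_eq_sum_range, Finset.mul_sum]
      exact Finset.sum_comm
    rw [e]
    exact Finset.measurable_sum _ fun i _ =>
      (measurable_sum_eigenvalues_pow hmeas hH i).const_mul _
  · rw [tendsto_pi_nhds]
    intro ω
    refine tendsto_finsetSum _ fun j _ => ?_
    rw [tendsto_iff_dist_tendsto_zero]
    refine squeeze_zero' (Eventually.of_forall fun _ => dist_nonneg) ?_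
      tendsto_one_div_add_atTop_nhds_zero_nat
    filter_upwards [eventually_ge_atTop ⌈|(hH ω).eigenvalues j|⌉₊] with n hn
    rw [Real.dist_eq]
    exact (hq n _ (abs_le.1 (Nat.ceil_le.1 hn))).le

/-- Half-lines generate the Borel sets, and the indicator of `Iic c` is the pointwise limit of
continuous ramps falling from one at `c` to zero at `c + 1 / n`. -/
theorem measurable_empiricalMeasure [Nonempty ι] (hmeas : ∀ i j, Measurable fun ω => H ω i j)
    (hH : ∀ ω, (H ω).IsHermitian) : Measurable fun ω => empiricalMeasure (H ω) (hH ω) := by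
  refine Measurable.measure_of_isPiSystem_of_isProbabilityMeasure (borel_eq_generateFrom_Iic ℝ ▸
    (BorelSpace.measurable_eq (α := ℝ))) isPiSystem_Iic ?_
  rintro _ ⟨c, rfl⟩
  have hlim : ∀ x : ℝ, Tendsto (fun n : ℕ => max 0 (min 1 (1 - n * (x - c)))) atTop
      (𝓝 ((Set.Iic c).indicator (fun _ => (1 : ℝ)) x)) := by
    intro x
    by_cases hx : x ≤ c
    · rw [Set.indicator_of_mem (by exact hx)]
      refine tendsto_const_nhds.congr fun n => ?_
      have : (n : ℝ) * (x - c) ≤ 0 := mul_nonpos_of_nonneg_of_nonpos (by positivity) (by linarith)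
      rw [min_eq_left (by linarith), max_eq_right zero_le_one]
    · rw [Set.indicator_of_notMem (by exact hx)]
      refine tendsto_const_nhds.congr' ?_
      have hpos : 0 < x - c := by linarith
      filter_upwards [eventually_ge_atTop ⌈1 / (x - c)⌉₊] with n hn
      have h1 : 1 / (x - c) ≤ n := Nat.ceil_le.1 hn
      have h2 : 1 ≤ (n : ℝ) * (x - c) := (div_le_iff₀ hpos).1 h1
      rw [max_eq_left ((min_le_right _ _).trans (by linarith))]
  have hmeasS : Measurable fun ω => ∑ j, (Set.Iic c).indicator (fun _ => (1 : ℝ))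
      ((hH ω).eigenvalues j) := by
    refine measurable_of_tendsto_metrizable
      (f := fun (n : ℕ) ω => ∑ j, max 0 (min 1 (1 - n * ((hH ω).eigenvalues j - c)))) ?_ ?_
    · intro n
      exact measurable_sum_eigenvalues hmeas hH
        (g := fun x => max 0 (min 1 (1 - n * (x - c)))) (by fun_prop)
    · rw [tendsto_pi_nhds]
      exact fun ω => tendsto_finsetSum _ fun j _ => hlim _
  have e : (fun ω => empiricalMeasure (H ω) (hH ω) (Set.Iic c)) = fun ω =>
      (Fintype.card ι : ℝ≥0∞)⁻¹ * ENNReal.ofReal (∑ j, (Set.Iic c).indicator (fun _ => (1 : ℝ))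
        ((hH ω).eigenvalues j)) := by
    ext ω
    rw [ENNReal.ofReal_sum_of_nonneg fun j _ => Set.indicator_nonneg (fun _ _ => zero_le_one) _]
    simp only [empiricalMeasure, Measure.smul_apply, Measure.finsetSum_apply, smul_eq_mul,
      Measure.dirac_apply' _ measurableSet_Iic]
    congr 2
    ext j
    by_cases h : (hH ω).eigenvalues j ∈ Set.Iic c <;> simp [h]
  rw [e]
  exact hmeasS.ennreal_ofReal.const_mul _

/-- The mean of a random empirical eigenvalue measure: moments and total mass. -/
theorem bind_empiricalMeasure [Nonempty ι] (P : Measure Ω) [IsProbabilityMeasure P]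
    (hmeas : ∀ i j, Measurable fun ω => H ω i j) (hH : ∀ ω, (H ω).IsHermitian)
    (hint : ∀ m, Integrable (fun ω => (H ω ^ m).trace) P) :
    IsProbabilityMeasure (P.bind fun ω => empiricalMeasure (H ω) (hH ω)) ∧
    ∀ m : ℕ, Integrable (fun x => x ^ m) (P.bind fun ω => empiricalMeasure (H ω) (hH ω)) ∧
      ((∫ x, x ^ m ∂(P.bind fun ω => empiricalMeasure (H ω) (hH ω)) : ℝ) : ℂ) =
        (Fintype.card ι : ℂ)⁻¹ * ∫ ω, (H ω ^ m).trace ∂P := by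
  let k : Kernel Ω ℝ :=
    ⟨fun ω => empiricalMeasure (H ω) (hH ω), measurable_empiricalMeasure hmeas hH⟩
  have hk : IsMarkovKernel k :=
    ⟨fun ω => inferInstanceAs (IsProbabilityMeasure (empiricalMeasure (H ω) (hH ω)))⟩
  change IsProbabilityMeasure (P.bind k) ∧ ∀ m : ℕ, Integrable (fun x => x ^ m) (P.bind k) ∧
    ((∫ x, x ^ m ∂(P.bind k) : ℝ) : ℂ) = _
  refine ⟨inferInstance, fun m => ?_⟩
  have hre : ∀ m, Integrable (fun ω => ∑ j, (hH ω).eigenvalues j ^ m) P := by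
    intro m
    refine (hint m).re.congr (ae_of_all _ fun ω => ?_)
    simp only [(hH ω).trace_pow_eq_sum_eigenvalues]
    exact Complex.ofReal_re _
  have hI : Integrable (fun x : ℝ => x ^ m) (P.bind k) := by
    rw [Measure.integrable_comp_iff (by fun_prop)]
    refine ⟨ae_of_all _ fun ω => integrable_empiricalMeasure (hH ω) _, ?_⟩
    have e : (fun ω => ∫ x, ‖x ^ m‖ ∂(k ω)) = fun ω =>
        (Fintype.card ι : ℝ)⁻¹ * ∑ j, ‖(hH ω).eigenvalues j ^ m‖ := by
      ext ω
      exact integral_empiricalMeasure (hH ω) fun x => ‖x ^ m‖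
    rw [e]
    refine Integrable.const_mul ?_ _
    -- Since `|y| ≤ 1 + y ^ 2`, absolute power sums are controlled by even ones, which are traces.
    refine ((integrable_const (Fintype.card ι : ℝ)).add (hre (2 * m))).mono'
      (measurable_sum_eigenvalues hmeas hH (g := fun x => ‖x ^ m‖)
        (by fun_prop)).aestronglyMeasurable (ae_of_all _ fun ω => ?_)
    rw [Real.norm_of_nonneg (Finset.sum_nonneg fun j _ => norm_nonneg _)]
    have : (Fintype.card ι : ℝ) = ∑ j : ι, (1 : ℝ) := by simp
    simp only [Pi.add_apply]
    rw [this, ← Finset.sum_add_distrib]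
    refine Finset.sum_le_sum fun j _ => ?_
    rw [mul_comm 2 m, pow_mul, Real.norm_eq_abs]
    nlinarith [sq_abs ((hH ω).eigenvalues j ^ m),
      sq_nonneg (|(hH ω).eigenvalues j ^ m| - 1), abs_nonneg ((hH ω).eigenvalues j ^ m)]
  refine ⟨hI, ?_⟩
  have hcomp : ∫ x, x ^ m ∂(P.bind k) = ∫ ω, ∫ x, x ^ m ∂(k ω) ∂P := by
    rw [Measure.comp_eq_comp_const_apply] at hI ⊢
    rw [Kernel.integral_comp hI, Kernel.const_apply]
  rw [hcomp]
  have e : (fun ω => ∫ x, x ^ m ∂(k ω)) = fun ω =>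
      (Fintype.card ι : ℝ)⁻¹ * ∑ j, (hH ω).eigenvalues j ^ m := by
    ext ω
    exact integral_empiricalMeasure (hH ω) fun x => x ^ m
  rw [e, integral_const_mul]
  simp only [(hH _).trace_pow_eq_sum_eigenvalues]
  rw [integral_complex_ofReal]
  push_cast
  rfl

end EmpiricalMeasure

/-! ### Convergence of moments implies weak convergence to a compactly supported limit -/

section MomentConvergence

theorem Polynomial.abs_eval_le_of_le_abs (q : Polynomial ℝ) {K x : ℝ} (hK : 0 < K) (hx : K ≤ |x|) :
    |q.eval x| ≤ (∑ i ∈ Finset.range (q.natDegree + 1), |q.coeff i| * K ^ i) *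
      (|x| / K) ^ q.natDegree := by
  rw [Polynomial.eval_eq_sum_range, Finset.sum_mul]
  refine (Finset.abs_sum_le_sum_abs _ _).trans (Finset.sum_le_sum fun i hi => ?_)
  rw [abs_mul, abs_pow, mul_assoc]
  refine mul_le_mul_of_nonneg_left ?_ (abs_nonneg _)
  have h1 : 1 ≤ |x| / K := (one_le_div hK).2 hx
  calc |x| ^ i = K ^ i * (|x| / K) ^ i := by rw [← mul_pow, mul_div_cancel₀ _ hK.ne']
    _ ≤ K ^ i * (|x| / K) ^ q.natDegree := by
      refine mul_le_mul_of_nonneg_left (pow_le_pow_right₀ h1 ?_) (by positivity)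
      simp at hi
      omega

theorem integral_polynomial_eval {μ : Measure ℝ} (hμ : ∀ k : ℕ, Integrable (fun x => x ^ k) μ)
    (q : Polynomial ℝ) : Integrable (fun x => q.eval x) μ ∧
      ∫ x, q.eval x ∂μ = ∑ i ∈ Finset.range (q.natDegree + 1), q.coeff i * ∫ x, x ^ i ∂μ := by
  have e : (fun x => q.eval x) =
      fun x => ∑ i ∈ Finset.range (q.natDegree + 1), q.coeff i * x ^ i := by
    ext x
    rw [Polynomial.eval_eq_sum_range]
  rw [e]
  refine ⟨integrable_finsetSum _ fun i _ => (hμ i).const_mul _, ?_⟩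
  rw [integral_finsetSum _ fun i _ => (hμ i).const_mul _]
  simp only [integral_const_mul]

/-- On `[-K, K]` the function `f` is close to a polynomial `q`. Outside, `f - q` is dominated by `D
* (x / K) ^ (2 * L)`, whose integral against `μ` is at most `D / 4 ^ L`. Convergence of this single
moment carries the smallness over to `ν n`, so neither tightness nor moment determinacy has to be
invoked. -/
theorem tendsto_integral_of_tendsto_moments {ν : ℕ → Measure ℝ} {μ : Measure ℝ}
    [IsProbabilityMeasure μ] {R : ℝ} (hR : ∀ᵐ x ∂μ, |x| ≤ R)
    (hprob : ∀ᶠ n in atTop, IsProbabilityMeasure (ν n))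
    (hint : ∀ᶠ n in atTop, ∀ k : ℕ, Integrable (fun x => x ^ k) (ν n))
    (hmom : ∀ k : ℕ, Tendsto (fun n => ∫ x, x ^ k ∂(ν n)) atTop (𝓝 (∫ x, x ^ k ∂μ)))
    (f : ℝ →ᵇ ℝ) : Tendsto (fun n => ∫ x, f x ∂(ν n)) atTop (𝓝 (∫ x, f x ∂μ)) := by
  -- Chosen so that `|R| / K ≤ 1 / 2`, whence the `2L`-th moments of `μ` relative to `K` decay like
  -- `4 ^ (-L)`.
  set K : ℝ := 2 * (|R| + 1) with hK
  have hK0 : 0 < K := by positivity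
  have hRK : |R| / K ≤ 1 / 2 := by
    rw [div_le_iff₀ hK0, hK]
    linarith
  have hμR : ∀ᵐ x ∂μ, |x| ≤ |R| := hR.mono fun x hx => hx.trans (le_abs_self R)
  have hμint : ∀ k : ℕ, Integrable (fun x : ℝ => x ^ k) μ := fun k =>
    Integrable.of_bound (by fun_prop) (|R| ^ k) (hμR.mono fun x hx => by
      rw [norm_pow, Real.norm_eq_abs]
      exact pow_le_pow_left₀ (abs_nonneg x) hx k)
  rw [Metric.tendsto_atTop]
  intro ε hε
  -- The share `ε / 8` is spent five times: on the approximation and on the tail, each for `ν n` and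
  -- for `μ`, and on the integrals of `q`.
  obtain ⟨q, hq⟩ := exists_polynomial_near_of_continuousOn (-K) K f f.continuous.continuousOn
    (ε / 8) (by positivity)
  set D := ‖f‖ + ∑ i ∈ Finset.range (q.natDegree + 1), |q.coeff i| * K ^ i with hD
  have hD0 : 0 ≤ D := by positivity
  have hpt : ∀ L : ℕ, q.natDegree ≤ 2 * L → ∀ x, |f x - q.eval x| ≤
      ε / 8 + D / K ^ (2 * L) * x ^ (2 * L) := by
    intro L hL x
    have hx2 : 0 ≤ x ^ (2 * L) := by rw [pow_mul]; positivity
    by_cases hx : |x| ≤ K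
    · have h1 := (hq x (abs_le.1 hx)).le
      rw [abs_sub_comm] at h1
      have : 0 ≤ D / K ^ (2 * L) * x ^ (2 * L) := by positivity
      linarith
    · have hx := (not_le.1 hx).le
      have h1 : 1 ≤ |x| / K := (one_le_div hK0).2 hx
      have h2 := q.abs_eval_le_of_le_abs hK0 hx
      have h3 : |f x| ≤ ‖f‖ := f.norm_coe_le_norm x
      have e : D / K ^ (2 * L) * x ^ (2 * L) = D * (|x| / K) ^ (2 * L) := by
        rw [div_pow, (even_two_mul L).pow_abs]
        ring
      have h4 : |q.eval x| ≤ (∑ i ∈ Finset.range (q.natDegree + 1), |q.coeff i| * K ^ i) *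
          (|x| / K) ^ (2 * L) :=
        h2.trans (mul_le_mul_of_nonneg_left (pow_le_pow_right₀ h1 hL) (by positivity))
      have h5 : ‖f‖ ≤ ‖f‖ * (|x| / K) ^ (2 * L) :=
        le_mul_of_one_le_right (norm_nonneg _) (one_le_pow₀ h1)
      rw [e, hD, add_mul]
      have := abs_sub (f x) (q.eval x)
      linarith
  have hint_diff : ∀ (m : Measure ℝ) [IsProbabilityMeasure m],
      (∀ k : ℕ, Integrable (fun x : ℝ => x ^ k) m) → ∀ L : ℕ, q.natDegree ≤ 2 * L →
      |∫ x, f x ∂m - ∫ x, q.eval x ∂m| ≤ ε / 8 + D / K ^ (2 * L) * ∫ x, x ^ (2 * L) ∂m := by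
    intro m _ hm L hL
    rw [← integral_sub (f.integrable m) (integral_polynomial_eval hm q).1,
      ← Real.norm_eq_abs]
    refine (norm_integral_le_integral_norm _).trans ?_
    refine (integral_mono ((f.integrable m).sub (integral_polynomial_eval hm q).1).norm
      ((integrable_const _).add ((hm _).const_mul _)) (hpt L hL)).trans (le_of_eq ?_)
    rw [integral_add' (integrable_const (ε / 8)) ((hm (2 * L)).const_mul (D / K ^ (2 * L))),
      integral_const_mul]
    simp
  have hsmall : Tendsto (fun L : ℕ => D * (1 / 4 : ℝ) ^ L) atTop (𝓝 0) := by
    simpa using (tendsto_pow_atTop_nhds_zero_of_lt_one (r := (1 / 4 : ℝ)) (by norm_num)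
      (by norm_num)).const_mul D
  obtain ⟨L, hL1, hL2⟩ := ((hsmall.eventually_lt_const (by positivity : (0 : ℝ) < ε / 8)).and
    (eventually_ge_atTop q.natDegree)).exists
  have hLq : q.natDegree ≤ 2 * L := by omega
  have hμL : D / K ^ (2 * L) * ∫ x, x ^ (2 * L) ∂μ < ε / 8 := by
    refine lt_of_le_of_lt ?_ hL1
    have h1 : ∫ x, x ^ (2 * L) ∂μ ≤ |R| ^ (2 * L) := by
      refine (integral_mono_ae (hμint _) (integrable_const (|R| ^ (2 * L)))
        (hμR.mono fun x hx => ?_)).trans (by simp)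
      change x ^ (2 * L) ≤ |R| ^ (2 * L)
      rw [← (even_two_mul L).pow_abs x]
      exact pow_le_pow_left₀ (abs_nonneg x) hx _
    calc D / K ^ (2 * L) * ∫ x, x ^ (2 * L) ∂μ ≤ D / K ^ (2 * L) * |R| ^ (2 * L) := by gcongr
      _ = D * (|R| / K) ^ (2 * L) := by rw [div_pow]; ring
      _ ≤ D * (1 / 2) ^ (2 * L) := by gcongr
      _ = _ := by rw [pow_mul]; norm_num
  have hνL := ((hmom (2 * L)).const_mul (D / K ^ (2 * L))).eventually_lt_const hμL
  have hqlim : Tendsto (fun n => ∑ i ∈ Finset.range (q.natDegree + 1),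
      q.coeff i * ∫ x, x ^ i ∂(ν n)) atTop (𝓝 (∑ i ∈ Finset.range (q.natDegree + 1),
      q.coeff i * ∫ x, x ^ i ∂μ)) :=
    tendsto_finsetSum _ fun i _ => (hmom i).const_mul _
  have hqe := Metric.tendsto_nhds.1 hqlim (ε / 8) (by positivity)
  obtain ⟨n₀, hn₀⟩ := eventually_atTop.1 (((hprob.and hint).and hνL).and hqe)
  refine ⟨n₀, fun n hn => ?_⟩
  obtain ⟨⟨⟨h1, h2⟩, h3⟩, h4⟩ := hn₀ n hn
  have a1 := hint_diff (ν n) h2 L hLq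
  have a2 := hint_diff μ hμint L hLq
  rw [← (integral_polynomial_eval h2 q).2, ← (integral_polynomial_eval hμint q).2] at h4
  rw [Real.dist_eq] at h4 ⊢
  have e : ∫ x, f x ∂(ν n) - ∫ x, f x ∂μ = (∫ x, f x ∂(ν n) - ∫ x, q.eval x ∂(ν n)) +
    (∫ x, q.eval x ∂(ν n) - ∫ x, q.eval x ∂μ) - (∫ x, f x ∂μ - ∫ x, q.eval x ∂μ) := by ring
  rw [e]
  have b1 := abs_sub ((∫ x, f x ∂(ν n) - ∫ x, q.eval x ∂(ν n)) +
    (∫ x, q.eval x ∂(ν n) - ∫ x, q.eval x ∂μ)) (∫ x, f x ∂μ - ∫ x, q.eval x ∂μ)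
  have b2 := abs_add_le (∫ x, f x ∂(ν n) - ∫ x, q.eval x ∂(ν n))
    (∫ x, q.eval x ∂(ν n) - ∫ x, q.eval x ∂μ)
  linarith

end MomentConvergence

/-! ### A linear recursion for the weighted Catalan numbers -/

section ChiralCatalan

/-- The order of the two factors is immaterial, so beyond index zero the colour no longer matters.
-/
theorem chiralCatalan_succ_eq (κ : ℝ) (k : ℕ) (b : Bool) :
    chiralCatalan κ (k + 1) b = ∑ x ∈ Finset.HasAntidiagonal.antidiagonal k,
      chiralCatalan κ x.1 true * chiralCatalan κ x.2 false := by
  rw [chiralCatalan_succ]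
  cases b
  · rfl
  · rw [← Finset.Nat.sum_antidiagonal_swap]
    exact Finset.sum_congr rfl fun x _ => mul_comm _ _

-- The series of either colour is its constant term plus `X * W`, and the recursion says that `W` is
-- the product of the two series.
open PowerSeries in
theorem chiralCatalan_quadratic (κ : ℝ) :
    let W : PowerSeries ℝ := PowerSeries.mk fun k => chiralCatalan κ (k + 1) true
    W = (C κ + X * W) * (C (1 - κ) + X * W) := by
  intro W
  have hA : ∀ b, PowerSeries.mk (fun k => chiralCatalan κ k b) =
      C (if b then κ else 1 - κ) + X * W := by
    intro b
    ext n
    cases n with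
    | zero => simp [chiralCatalan]
    | succ n =>
      rw [coeff_mk, map_add, coeff_succ_X_mul, coeff_mk, coeff_C, if_neg (by omega), zero_add,
        chiralCatalan_succ_eq, chiralCatalan_succ_eq]
  have h1 := hA true
  have h2 := hA false
  simp only [if_true, Bool.false_eq_true, if_false] at h1 h2
  rw [← h1, ← h2]
  ext n
  rw [coeff_mk, chiralCatalan_succ_eq, coeff_mul]
  simp

-- Completing the square in the quadratic equation gives a series `R` whose square is a polynomial
-- `P` of degree at most two. Then `2 P R' = P' R`, and comparing coefficients gives a three-term
-- recursion.
open PowerSeries in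
theorem chiralCatalan_recursion (κ : ℝ) (k : ℕ) :
    ((k : ℝ) + 4) * chiralCatalan κ (k + 3) true =
      (2 * k + 5) * chiralCatalan κ (k + 2) true +
        (k + 1) * (4 * (κ * (1 - κ)) - 1) * chiralCatalan κ (k + 1) true := by
  set W : PowerSeries ℝ := PowerSeries.mk fun k => chiralCatalan κ (k + 1) true with hW
  have hq : W = (C κ + X * W) * (C (1 - κ) + X * W) := chiralCatalan_quadratic κ
  set R : PowerSeries ℝ := 2 * X ^ 2 * W + X - 1 with hR
  have hRD : R ^ 2 = (1 - X) ^ 2 - 4 * C (κ * (1 - κ)) * X ^ 2 := by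
    have hC : C (1 - κ) = (1 : PowerSeries ℝ) - C κ := by simp
    rw [map_mul, hR]
    rw [hC] at hq ⊢
    linear_combination (4 * X ^ 2) * (- hq)
  set d : ℝ := 1 - 4 * (κ * (1 - κ)) with hd
  have hRD' : R * R = 1 - C 2 * X + C d * (X * X) := by
    have h2 : (C 2 : PowerSeries ℝ) = 2 := map_ofNat C 2
    have h4 : (C d : PowerSeries ℝ) = 1 - 4 * C (κ * (1 - κ)) := by
      have : (C 4 : PowerSeries ℝ) = 4 := map_ofNat C 4
      rw [hd, map_sub, map_mul C 4, this, map_one]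
    rw [← pow_two, hRD, h2, h4]
    ring
  have hder := congrArg (PowerSeries.derivative ℝ) hRD'
  set R' := PowerSeries.derivative ℝ R with hR'
  simp only [Derivation.leibniz, map_add, map_sub, derivative_C, derivative_X, derivative_one,
    smul_eq_mul, mul_one, mul_zero, add_zero, zero_sub] at hder
  rw [← hR'] at hder
  have hode : C 2 * R' - C 2 * (C 2 * (X * R')) + C 2 * (C d * (X * (X * R'))) =
      C 2 * (C d * (X * R)) - C 2 * R := by
    have h2 : (C 2 : PowerSeries ℝ) = 2 := map_ofNat C 2
    rw [h2] at hRD' hder ⊢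
    linear_combination (-2 * R') * hRD' + R * hder
  have hRc : ∀ n, coeff (n + 2) R = 2 * chiralCatalan κ (n + 1) true := by
    intro n
    have e : R = C 2 * (X * (X * W)) + X - 1 := by
      have : (C 2 : PowerSeries ℝ) = 2 := map_ofNat C 2
      rw [hR, this]
      ring
    rw [e, map_sub, map_add, coeff_C_mul, coeff_succ_X_mul, coeff_succ_X_mul, hW, coeff_mk,
      coeff_X, coeff_one]
    simp
  -- This coefficient involves only the coefficients `k + 2` to `k + 4` of `R`, where `hRc` applies.
  have hc := congrArg (coeff (k + 3)) hode
  simp only [map_add, map_sub, coeff_C_mul, coeff_succ_X_mul, hR', coeff_derivative] at hc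
  rw [show k + 3 + 1 = (k + 2) + 2 from rfl, show k + 2 + 1 = (k + 1) + 2 from rfl,
    show k + 1 + 1 = k + 2 from rfl, show k + 3 = (k + 1) + 2 from rfl, hRc, hRc, hRc] at hc
  push_cast at hc
  linear_combination hc / 4

end ChiralCatalan

/-! ### The moments of the limit measure -/

section ChiralIntegrals

variable {r x : ℝ}

theorem chiral_pos (hr1 : r ≤ 1) (hx : x ∈ Set.Ioo √(1 - r) √(1 + r)) :
    0 < x ∧ 0 < r ^ 2 - (x ^ 2 - 1) ^ 2 := by
  have hx0 : 0 < x := (Real.sqrt_nonneg _).trans_lt hx.1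
  have h1 : 1 - r < x ^ 2 := (Real.sqrt_lt (by linarith) hx0.le).1 hx.1
  have h2 : x ^ 2 < 1 + r := (Real.lt_sqrt hx0.le).1 hx.2
  refine ⟨hx0, ?_⟩
  nlinarith [mul_pos (sub_pos.2 h1) (sub_pos.2 h2)]

theorem sqrt_one_sub_le_sqrt_one_add (hr : 0 < r) : √(1 - r) ≤ √(1 + r) :=
  Real.sqrt_le_sqrt (by linarith)

theorem hasDerivAt_arcsin_sq (hr : 0 < r) (hs : 0 < r ^ 2 - (x ^ 2 - 1) ^ 2) :
    HasDerivAt (fun x : ℝ => Real.arcsin ((x ^ 2 - 1) / r))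
      (2 * x / √(r ^ 2 - (x ^ 2 - 1) ^ 2)) x := by
  have hlt : ((x ^ 2 - 1) / r) ^ 2 < 1 := by
    rw [div_pow, div_lt_one (by positivity)]
    linarith
  have hb := abs_lt.1 ((sq_lt_one_iff_abs_lt_one _).1 hlt)
  have h1 : HasDerivAt (fun x : ℝ => (x ^ 2 - 1) / r) (2 * x / r) x := by
    simpa using (((hasDerivAt_id x).pow 2).sub_const 1).div_const r
  have := (Real.hasDerivAt_arcsin hb.1.ne' hb.2.ne).comp x h1
  refine this.congr_deriv ?_
  have e : 1 - ((x ^ 2 - 1) / r) ^ 2 = (r ^ 2 - (x ^ 2 - 1) ^ 2) / r ^ 2 := by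
    field_simp
  rw [e, Real.sqrt_div hs.le, Real.sqrt_sq hr.le]
  have := Real.sqrt_pos.2 hs
  field_simp

theorem hasDerivAt_sqrt_chiral (hs : 0 < r ^ 2 - (x ^ 2 - 1) ^ 2) :
    HasDerivAt (fun x : ℝ => √(r ^ 2 - (x ^ 2 - 1) ^ 2))
      (-(2 * x * (x ^ 2 - 1)) / √(r ^ 2 - (x ^ 2 - 1) ^ 2)) x := by
  have h1 : HasDerivAt (fun x : ℝ => r ^ 2 - (x ^ 2 - 1) ^ 2) (-(4 * x * (x ^ 2 - 1))) x := by
    have := ((((hasDerivAt_id x).pow 2).sub_const 1).pow 2).const_sub (r ^ 2)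
    refine this.congr_deriv ?_
    simp
    ring
  refine (h1.sqrt hs.ne').congr_deriv ?_
  have := Real.sqrt_pos.2 hs
  field_simp
  ring

/-- This supplies the `1 / x` part of the density. Its boundary values produce `√(1 - r ^ 2)`, the
mass of the atom at zero. -/
theorem hasDerivAt_arcsin_ratio (hr : 0 < r) (hr1 : r < 1) (hx : 0 < x)
    (hs : 0 < r ^ 2 - (x ^ 2 - 1) ^ 2) :
    HasDerivAt (fun x : ℝ => √(1 - r ^ 2) * Real.arcsin ((x ^ 2 - (1 - r ^ 2)) / (r * x ^ 2)))
      (2 * (1 - r ^ 2) / (x * √(r ^ 2 - (x ^ 2 - 1) ^ 2))) x := by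
  have he : 0 < 1 - r ^ 2 := by nlinarith
  have h1 : HasDerivAt (fun x : ℝ => (x ^ 2 - (1 - r ^ 2)) / (r * x ^ 2))
      (2 * (1 - r ^ 2) / (r * x ^ 3)) x := by
    have h2 : HasDerivAt (fun x : ℝ => x ^ 2) (2 * x) x := by simpa using hasDerivAt_pow 2 x
    have := (h2.sub_const (1 - r ^ 2)).div (h2.const_mul r) (by positivity)
    refine this.congr_deriv ?_
    field_simp
    ring
  have e : 1 - ((x ^ 2 - (1 - r ^ 2)) / (r * x ^ 2)) ^ 2 =
      (1 - r ^ 2) * (r ^ 2 - (x ^ 2 - 1) ^ 2) / (r * x ^ 2) ^ 2 := by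
    field_simp
    ring
  have hlt : ((x ^ 2 - (1 - r ^ 2)) / (r * x ^ 2)) ^ 2 < 1 := by
    have : 0 < 1 - ((x ^ 2 - (1 - r ^ 2)) / (r * x ^ 2)) ^ 2 := by
      rw [e]
      positivity
    linarith
  have hb := abs_lt.1 ((sq_lt_one_iff_abs_lt_one _).1 hlt)
  have := ((Real.hasDerivAt_arcsin hb.1.ne' hb.2.ne).comp x h1).const_mul √(1 - r ^ 2)
  refine this.congr_deriv ?_
  rw [e, Real.sqrt_div (by positivity), Real.sqrt_sq (by positivity), Real.sqrt_mul he.le]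
  have h3 := Real.sqrt_pos.2 hs
  have h4 := Real.sqrt_pos.2 he
  field_simp

/-- With `Δ = r ^ 2 - (x ^ 2 - 1) ^ 2`, the integrand `Δ / (x √Δ)` is a combination of `x (x ^ 2 -
1) / √Δ`, `x / √Δ` and `1 / (x √Δ)`, which are up to constants the derivatives of the three terms of
`F`. -/
theorem integral_chiral_mass (hr : 0 < r) (hr1 : r ≤ 1) :
    IntervalIntegrable (fun x => √(r ^ 2 - (x ^ 2 - 1) ^ 2) / x) volume √(1 - r) √(1 + r) ∧
      ∫ x in √(1 - r)..√(1 + r), √(r ^ 2 - (x ^ 2 - 1) ^ 2) / x =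
        Real.pi / 2 * (1 - √(1 - r ^ 2)) := by
  set F : ℝ → ℝ := fun x => (√(r ^ 2 - (x ^ 2 - 1) ^ 2) + Real.arcsin ((x ^ 2 - 1) / r) -
    √(1 - r ^ 2) * Real.arcsin ((x ^ 2 - (1 - r ^ 2)) / (r * x ^ 2))) / 2 with hF
  have hle := sqrt_one_sub_le_sqrt_one_add hr
  have hder : ∀ x ∈ Set.Ioo √(1 - r) √(1 + r),
      HasDerivAt F (√(r ^ 2 - (x ^ 2 - 1) ^ 2) / x) x := by
    intro x hx
    obtain ⟨hx0, hs⟩ := chiral_pos hr1 hx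
    have hs' := Real.sqrt_pos.2 hs
    have hsq := Real.sq_sqrt hs.le
    -- For `r = 1` the lower endpoint is zero and the factor `√(1 - r ^ 2)` removes the last term of
    -- `F`; the derivative formula for that term needs `r < 1`.
    rcases hr1.lt_or_eq with hlt | rfl
    · refine (((hasDerivAt_sqrt_chiral hs).add (hasDerivAt_arcsin_sq hr hs)).sub
        (hasDerivAt_arcsin_ratio hr hlt hx0 hs)).div_const 2 |>.congr_deriv ?_
      field_simp
      rw [hsq]
      ring
    · have e : F = fun x => (√(1 ^ 2 - (x ^ 2 - 1) ^ 2) + Real.arcsin ((x ^ 2 - 1) / 1)) / 2 := by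
        ext x
        simp [hF]
      rw [e]
      refine ((hasDerivAt_sqrt_chiral hs).add (hasDerivAt_arcsin_sq hr hs)).div_const 2
        |>.congr_deriv ?_
      simp only [one_pow] at hs' hsq ⊢
      field_simp
      rw [hsq]
      ring
  have hcont : ContinuousOn F (Set.Icc √(1 - r) √(1 + r)) := by
    rcases hr1.lt_or_eq with hlt | rfl
    · have hne : ∀ x ∈ Set.Icc √(1 - r) √(1 + r), r * x ^ 2 ≠ 0 := by
        intro x hx
        have : 0 < x := (Real.sqrt_pos.2 (by linarith)).trans_le hx.1
        positivity
      refine ContinuousOn.div_const (ContinuousOn.sub (ContinuousOn.add (by fun_prop) ?_) ?_) 2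
      · exact Real.continuous_arcsin.comp_continuousOn (by fun_prop)
      · exact continuousOn_const.mul (Real.continuous_arcsin.comp_continuousOn
          (ContinuousOn.div (by fun_prop) (by fun_prop) hne))
    · have e : F = fun x => (√(1 ^ 2 - (x ^ 2 - 1) ^ 2) + Real.arcsin (x ^ 2 - 1)) / 2 := by
        ext x
        simp [hF]
      rw [e]
      exact Continuous.continuousOn (by
        have := Real.continuous_arcsin
        fun_prop)
  have hint : IntervalIntegrable (fun x => √(r ^ 2 - (x ^ 2 - 1) ^ 2) / x) volume
      √(1 - r) √(1 + r) := by
    -- A nonnegative derivative of a continuous function is integrable, so the behaviour of the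
    -- integrand near the endpoints needs no estimate.
    refine intervalIntegral.intervalIntegrable_deriv_of_nonneg (g := F) ?_ ?_ ?_
    · rwa [Set.uIcc_of_le hle]
    · rwa [min_eq_left hle, max_eq_right hle]
    · rw [min_eq_left hle, max_eq_right hle]
      intro x hx
      have := (chiral_pos hr1 hx).1
      positivity
  refine ⟨hint, ?_⟩
  rw [intervalIntegral.integral_eq_sub_of_hasDerivAt_of_le hle hcont hder hint]
  have ha : √(1 - r) ^ 2 = 1 - r := Real.sq_sqrt (by linarith)
  have hb : √(1 + r) ^ 2 = 1 + r := Real.sq_sqrt (by linarith)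
  simp only [hF, ha, hb]
  have e1 : (1 + r - 1) / r = 1 := by field_simp; ring
  have e2 : (1 - r - 1) / r = -1 := by field_simp; ring
  have e3 : (1 + r - (1 - r ^ 2)) / (r * (1 + r)) = 1 := by
    rw [div_eq_one_iff_eq (by positivity)]; ring
  have e4 : r ^ 2 - (1 + r - 1) ^ 2 = 0 := by ring
  have e5 : r ^ 2 - (1 - r - 1) ^ 2 = 0 := by ring
  rw [e1, e2, e3, e4, e5, Real.arcsin_one, Real.arcsin_neg_one, Real.sqrt_zero]
  rcases hr1.lt_or_eq with hlt | rfl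
  · have e6 : (1 - r - (1 - r ^ 2)) / (r * (1 - r)) = -1 := by
      have : 0 < 1 - r := by linarith
      rw [div_eq_iff (by positivity)]; ring
    rw [e6, Real.arcsin_neg_one]
    ring
  · simp
    ring

variable (r) in
/-- The integrals that give the even moments of the limit measure. -/
noncomputable def chiralIntegral (k : ℕ) : ℝ :=
  ∫ x in √(1 - r)..√(1 + r), x ^ (2 * k + 1) * √(r ^ 2 - (x ^ 2 - 1) ^ 2)

/-- In the variable `x ^ 2 - 1` this is half the area of a half-disc of radius `r`. -/
theorem chiralIntegral_zero (hr : 0 < r) (hr1 : r ≤ 1) :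
    chiralIntegral r 0 = Real.pi * r ^ 2 / 4 := by
  set F : ℝ → ℝ := fun x => ((x ^ 2 - 1) * √(r ^ 2 - (x ^ 2 - 1) ^ 2) +
    r ^ 2 * Real.arcsin ((x ^ 2 - 1) / r)) / 4 with hF
  have hle := sqrt_one_sub_le_sqrt_one_add hr
  have hder : ∀ x ∈ Set.Ioo √(1 - r) √(1 + r),
      HasDerivAt F (x ^ (2 * 0 + 1) * √(r ^ 2 - (x ^ 2 - 1) ^ 2)) x := by
    intro x hx
    obtain ⟨hx0, hs⟩ := chiral_pos hr1 hx
    have hs' := Real.sqrt_pos.2 hs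
    have hsq := Real.sq_sqrt hs.le
    have h2 : HasDerivAt (fun x : ℝ => x ^ 2 - 1) (2 * x) x := by
      simpa using (hasDerivAt_pow 2 x).sub_const 1
    refine ((h2.mul (hasDerivAt_sqrt_chiral hs)).add
      ((hasDerivAt_arcsin_sq hr hs).const_mul (r ^ 2))).div_const 4 |>.congr_deriv ?_
    field_simp
    rw [hsq]
    ring
  have hcont : Continuous F := by
    have := Real.continuous_arcsin
    fun_prop
  rw [chiralIntegral, intervalIntegral.integral_eq_sub_of_hasDerivAt_of_le hle hcont.continuousOn
    hder (Continuous.intervalIntegrable (by fun_prop) _ _)]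
  have ha : √(1 - r) ^ 2 = 1 - r := Real.sq_sqrt (by linarith)
  have hb : √(1 + r) ^ 2 = 1 + r := Real.sq_sqrt (by linarith)
  simp only [hF, ha, hb]
  have e1 : (1 + r - 1) / r = 1 := by field_simp; ring
  have e2 : (1 - r - 1) / r = -1 := by field_simp; ring
  have e4 : r ^ 2 - (1 + r - 1) ^ 2 = 0 := by ring
  have e5 : r ^ 2 - (1 - r - 1) ^ 2 = 0 := by ring
  rw [e1, e2, e4, e5, Real.arcsin_one, Real.arcsin_neg_one, Real.sqrt_zero]
  ring

/-- The integrand is the derivative of `p Δ ^ (3 / 2)`, where `Δ = r ^ 2 - (x ^ 2 - 1) ^ 2` vanishes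
at both endpoints. The exponent `3 / 2` leaves a factor `√Δ`, so polynomial `p` yields relations
among the chiral integrals. -/
theorem integral_deriv_chiral (hr : 0 < r) (hr1 : r ≤ 1) (p p' : ℝ → ℝ)
    (hp : ∀ x, HasDerivAt p (p' x) x) (hp' : Continuous p') :
    ∫ x in √(1 - r)..√(1 + r), (p' x * (r ^ 2 - (x ^ 2 - 1) ^ 2) - p x * (6 * x * (x ^ 2 - 1))) *
      √(r ^ 2 - (x ^ 2 - 1) ^ 2) = 0 := by
  have hpc : Continuous p := continuous_iff_continuousAt.2 fun x => (hp x).continuousAt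
  have hle := sqrt_one_sub_le_sqrt_one_add hr
  have hder : ∀ x ∈ Set.Ioo √(1 - r) √(1 + r),
      HasDerivAt (fun x => p x * ((r ^ 2 - (x ^ 2 - 1) ^ 2) * √(r ^ 2 - (x ^ 2 - 1) ^ 2)))
        ((p' x * (r ^ 2 - (x ^ 2 - 1) ^ 2) - p x * (6 * x * (x ^ 2 - 1))) *
          √(r ^ 2 - (x ^ 2 - 1) ^ 2)) x := by
    intro x hx
    obtain ⟨hx0, hs⟩ := chiral_pos hr1 hx
    have hs' := Real.sqrt_pos.2 hs
    have hsq := Real.sq_sqrt hs.le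
    have h1 : HasDerivAt (fun x : ℝ => r ^ 2 - (x ^ 2 - 1) ^ 2) (-(4 * x * (x ^ 2 - 1))) x := by
      have := ((((hasDerivAt_id x).pow 2).sub_const 1).pow 2).const_sub (r ^ 2)
      refine this.congr_deriv ?_
      simp
      ring
    refine ((hp x).mul (h1.mul (hasDerivAt_sqrt_chiral hs))).congr_deriv ?_
    simp only [Pi.mul_apply]
    field_simp
    rw [hsq]
    ring
  rw [intervalIntegral.integral_eq_sub_of_hasDerivAt_of_le hle
    (Continuous.continuousOn (by fun_prop)) hder (Continuous.intervalIntegrable (by fun_prop) _ _)]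
  have ha : √(1 - r) ^ 2 = 1 - r := Real.sq_sqrt (by linarith)
  have hb : √(1 + r) ^ 2 = 1 + r := Real.sq_sqrt (by linarith)
  simp only [ha, hb]
  ring

theorem chiralIntegral_one (hr : 0 < r) (hr1 : r ≤ 1) :
    chiralIntegral r 1 = chiralIntegral r 0 := by
  have h := integral_deriv_chiral hr hr1 (fun _ => 1) (fun _ => 0)
    (fun x => hasDerivAt_const x 1) continuous_const
  have h2 : ∫ x in √(1 - r)..√(1 + r), (0 * (r ^ 2 - (x ^ 2 - 1) ^ 2) -
      1 * (6 * x * (x ^ 2 - 1))) * √(r ^ 2 - (x ^ 2 - 1) ^ 2) =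
      6 * chiralIntegral r 0 - 6 * chiralIntegral r 1 := by
    rw [chiralIntegral, chiralIntegral, ← intervalIntegral.integral_const_mul,
      ← intervalIntegral.integral_const_mul, ← intervalIntegral.integral_sub
      (Continuous.intervalIntegrable (by fun_prop) _ _)
      (Continuous.intervalIntegrable (by fun_prop) _ _)]
    congr 1
    ext x
    ring
  linarith

/-- Integration by parts with `p = x ^ (2 * (k + 1))`. For `r ^ 2 = 4 κ (1 - κ)` this is the
recursion of `chiralCatalan_recursion`. -/
theorem chiralIntegral_recursion (hr : 0 < r) (hr1 : r ≤ 1) (k : ℕ) :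
    ((k : ℝ) + 4) * chiralIntegral r (k + 2) = (2 * k + 5) * chiralIntegral r (k + 1) +
      (k + 1) * (r ^ 2 - 1) * chiralIntegral r k := by
  have h := integral_deriv_chiral hr hr1 (fun x => x ^ (2 * (k + 1)))
    (fun x => (2 * (k + 1) : ℕ) * x ^ (2 * (k + 1) - 1))
    (fun x => hasDerivAt_pow _ x) (by fun_prop)
  have h2 : ∫ x in √(1 - r)..√(1 + r),
      ((2 * (k + 1) : ℕ) * x ^ (2 * (k + 1) - 1) * (r ^ 2 - (x ^ 2 - 1) ^ 2) -
      x ^ (2 * (k + 1)) * (6 * x * (x ^ 2 - 1))) * √(r ^ 2 - (x ^ 2 - 1) ^ 2) =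
      (2 * (k + 1) * (r ^ 2 - 1)) * chiralIntegral r k +
        (4 * (k + 1) + 6) * chiralIntegral r (k + 1) -
        (2 * (k + 1) + 6) * chiralIntegral r (k + 2) := by
    simp only [chiralIntegral]
    rw [← intervalIntegral.integral_const_mul, ← intervalIntegral.integral_const_mul,
      ← intervalIntegral.integral_const_mul, ← intervalIntegral.integral_add
      (Continuous.intervalIntegrable (by fun_prop) _ _)
      (Continuous.intervalIntegrable (by fun_prop) _ _), ← intervalIntegral.integral_sub
      (Continuous.intervalIntegrable (by fun_prop) _ _)
      (Continuous.intervalIntegrable (by fun_prop) _ _)]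
    congr 1
    ext x
    rw [show 2 * (k + 1) - 1 = 2 * k + 1 by omega]
    push_cast
    ring
  linarith

end ChiralIntegrals

/-! ### The moments of the limit measure as weighted Catalan numbers -/

section ChiralMoments

variable {κ : ℝ}

theorem two_mul_sqrt_mem (hκ : κ ∈ Set.Ioo (0 : ℝ) 1) :
    0 < 2 * √(κ * (1 - κ)) ∧ 2 * √(κ * (1 - κ)) ≤ 1 ∧
      (2 * √(κ * (1 - κ))) ^ 2 = 4 * (κ * (1 - κ)) := by
  have h0 : 0 < κ * (1 - κ) := mul_pos hκ.1 (sub_pos.2 hκ.2)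
  have h2 : (2 * √(κ * (1 - κ))) ^ 2 = 4 * (κ * (1 - κ)) := by
    rw [mul_pow, Real.sq_sqrt h0.le]
    norm_num
  have h1 := Real.sqrt_pos.2 h0
  refine ⟨by positivity, ?_, h2⟩
  nlinarith [sq_nonneg (1 - 2 * κ)]

/-- Both sides obey the same three-term recursion and agree for `k = 0` and `k = 1`. -/
theorem chiralIntegral_eq (hκ : κ ∈ Set.Ioo (0 : ℝ) 1) (k : ℕ) :
    2 / Real.pi * chiralIntegral (2 * √(κ * (1 - κ))) k =
      chiralCatalan κ (k + 1) true + chiralCatalan κ (k + 1) false := by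
  obtain ⟨hr, hr1, hr2⟩ := two_mul_sqrt_mem hκ
  have hb : chiralCatalan κ (k + 1) false = chiralCatalan κ (k + 1) true := by
    rw [chiralCatalan_succ_eq, chiralCatalan_succ_eq]
  have hc1 : chiralCatalan κ 1 true = κ * (1 - κ) := by
    rw [chiralCatalan_succ_eq]
    simp [chiralCatalan]
  have hc1' : chiralCatalan κ 1 false = κ * (1 - κ) := by
    rw [chiralCatalan_succ_eq]
    simp [chiralCatalan]
  have hc2 : chiralCatalan κ 2 true = κ * (1 - κ) := by
    rw [chiralCatalan_succ_eq]
    simp [Finset.Nat.antidiagonal_succ, hc1, hc1', chiralCatalan]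
    ring
  have h0 : 2 / Real.pi * chiralIntegral (2 * √(κ * (1 - κ))) 0 = 2 * (κ * (1 - κ)) := by
    rw [chiralIntegral_zero hr hr1, hr2]
    have := Real.pi_pos
    field_simp
  rw [hb, ← two_mul]
  induction k using Nat.strong_induction_on with
  | _ k ih =>
  match k with
  | 0 => rw [h0, hc1]
  | 1 => rw [chiralIntegral_one hr hr1, h0, hc2]
  | k + 2 =>
    have h1 := ih k (by omega) (by rw [chiralCatalan_succ_eq, chiralCatalan_succ_eq])
    have h2 := ih (k + 1) (by omega) (by rw [chiralCatalan_succ_eq, chiralCatalan_succ_eq])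
    have h3 := chiralIntegral_recursion hr hr1 k
    have h4 := chiralCatalan_recursion κ k
    rw [hr2] at h3
    have h5 : ((k : ℝ) + 4) * (2 / Real.pi * chiralIntegral (2 * √(κ * (1 - κ))) (k + 2)) =
        (k + 4) * (2 * chiralCatalan κ (k + 2 + 1) true) := by
      have e1 : ((k : ℝ) + 4) * (2 / Real.pi * chiralIntegral (2 * √(κ * (1 - κ))) (k + 2)) =
        2 / Real.pi * (((k : ℝ) + 4) * chiralIntegral (2 * √(κ * (1 - κ))) (k + 2)) := by ring
      have e2 : ((k : ℝ) + 4) * (2 * chiralCatalan κ (k + 2 + 1) true) =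
        2 * (((k : ℝ) + 4) * chiralCatalan κ (k + 3) true) := by ring
      rw [e1, e2, h3, h4]
      linear_combination (2 * k + 5) * h2 + (k + 1) * (4 * (κ * (1 - κ)) - 1) * h1
    exact mul_left_cancel₀ (by positivity) h5

variable (κ) in
/-- The restriction to the positive half-line of the density of the limit measure. -/
noncomputable def chiralHalfDensity (x : ℝ) : ℝ :=
  (Set.Ioc √(1 - 2 * √(κ * (1 - κ))) √(1 + 2 * √(κ * (1 - κ)))).indicator
    (fun x => 1 / Real.pi * (√((2 * √(κ * (1 - κ))) ^ 2 - (x ^ 2 - 1) ^ 2) / x)) x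

variable (κ) in
/-- The density of the absolutely continuous part of the limit measure. -/
noncomputable def chiralDensity (x : ℝ) : ℝ :=
  {y : ℝ | y ^ 2 ∈ Set.Icc (1 - 2 * √(κ * (1 - κ))) (1 + 2 * √(κ * (1 - κ)))}.indicator
    (fun y => 1 / (Real.pi * |y|) *
      √((y ^ 2 - (1 - 2 * √(κ * (1 - κ)))) * (1 + 2 * √(κ * (1 - κ)) - y ^ 2))) x

theorem chiralLimit_eq (κ : ℝ) : chiralLimit κ = ENNReal.ofReal |1 - 2 * κ| • Measure.dirac 0 +
    volume.withDensity fun x => ENNReal.ofReal (chiralDensity κ x) := rfl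

theorem chiralDensity_neg (κ x : ℝ) : chiralDensity κ (-x) = chiralDensity κ x := by
  simp only [chiralDensity, Set.indicator_apply, Set.mem_ofPred_eq, neg_sq, abs_neg]

theorem chiralHalfDensity_of_nonpos {x : ℝ} (hx : x ≤ 0) : chiralHalfDensity κ x = 0 := by
  refine Set.indicator_of_notMem (fun h => ?_) _
  exact absurd ((Real.sqrt_nonneg _).trans_lt h.1) (not_lt.2 hx)

theorem chiralDensity_eq_half (hκ : κ ∈ Set.Ioo (0 : ℝ) 1) {x : ℝ} (hx : 0 < x) :
    chiralDensity κ x = chiralHalfDensity κ x := by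
  obtain ⟨hr, hr1, -⟩ := two_mul_sqrt_mem hκ
  rw [chiralDensity, chiralHalfDensity]
  set r := 2 * √(κ * (1 - κ))
  have hs : (x ^ 2 - (1 - r)) * (1 + r - x ^ 2) = r ^ 2 - (x ^ 2 - 1) ^ 2 := by ring
  have hval : 1 / (Real.pi * |x|) * √((x ^ 2 - (1 - r)) * (1 + r - x ^ 2)) =
      1 / Real.pi * (√(r ^ 2 - (x ^ 2 - 1) ^ 2) / x) := by
    rw [hs, abs_of_pos hx]
    have := Real.pi_pos
    field_simp
  simp only [Set.indicator_apply, Set.mem_ofPred_eq, Set.mem_Icc, Set.mem_Ioc]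
  have h2 : x ^ 2 ≤ 1 + r ↔ x ≤ √(1 + r) := (Real.le_sqrt' hx).symm
  by_cases h1 : √(1 - r) < x
  · have h1' : 1 - r ≤ x ^ 2 := ((Real.sqrt_lt (by linarith) hx.le).1 h1).le
    simp only [h1, h1', h2, true_and, hval]
  · rw [if_neg (fun h : √(1 - r) < x ∧ x ≤ √(1 + r) => h1 h.1)]
    split_ifs with h
    -- Only the lower endpoint remains, which `Ioc` omits; the square root vanishes there.
    · have : x ^ 2 ≤ 1 - r := (Real.le_sqrt' hx).1 (not_lt.1 h1)
      rw [le_antisymm this h.1]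
      simp
    · rfl

theorem chiralDensity_eq (hκ : κ ∈ Set.Ioo (0 : ℝ) 1) (x : ℝ) :
    chiralDensity κ x = chiralHalfDensity κ x + chiralHalfDensity κ (-x) := by
  rcases lt_trichotomy x 0 with hx | rfl | hx
  · rw [chiralHalfDensity_of_nonpos hx.le, zero_add, ← chiralDensity_neg,
      chiralDensity_eq_half hκ (neg_pos.2 hx)]
  -- At zero the density has the value `0`, by the convention for division by zero.
  · simp [chiralDensity, chiralHalfDensity_of_nonpos, Set.indicator_apply]
  · rw [chiralHalfDensity_of_nonpos (neg_nonpos.2 hx.le), add_zero, chiralDensity_eq_half hκ hx]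

theorem chiralDensity_nonneg (κ x : ℝ) : 0 ≤ chiralDensity κ x :=
  Set.indicator_nonneg (fun _ _ => by positivity) x

theorem measurable_chiralDensity (κ : ℝ) : Measurable (chiralDensity κ) := by
  refine Measurable.indicator (by fun_prop) ?_
  exact measurableSet_Icc.preimage (by fun_prop)

theorem chiralHalfDensity_moments (hκ : κ ∈ Set.Ioo (0 : ℝ) 1) (m : ℕ) :
    Integrable (fun x => x ^ m * chiralHalfDensity κ x) ∧
      ∫ x, x ^ m * chiralHalfDensity κ x =
        1 / Real.pi * ∫ x in √(1 - 2 * √(κ * (1 - κ)))..√(1 + 2 * √(κ * (1 - κ))),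
          x ^ m * (√((2 * √(κ * (1 - κ))) ^ 2 - (x ^ 2 - 1) ^ 2) / x) := by
  obtain ⟨hr, hr1, -⟩ := two_mul_sqrt_mem hκ
  set r := 2 * √(κ * (1 - κ)) with hrdef
  have hle := sqrt_one_sub_le_sqrt_one_add hr
  have e : (fun x => x ^ m * chiralHalfDensity κ x) = (Set.Ioc √(1 - r) √(1 + r)).indicator
      fun x => 1 / Real.pi * (x ^ m * (√(r ^ 2 - (x ^ 2 - 1) ^ 2) / x)) := by
    ext x
    simp only [chiralHalfDensity, Set.indicator_apply, ← hrdef]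
    split_ifs <;> ring
  have hint : IntervalIntegrable (fun x => x ^ m * (√(r ^ 2 - (x ^ 2 - 1) ^ 2) / x)) volume
      √(1 - r) √(1 + r) :=
    (integral_chiral_mass hr hr1).1.continuousOn_mul (by fun_prop)
  rw [e, integrable_indicator_iff measurableSet_Ioc, integral_indicator measurableSet_Ioc,
    intervalIntegral.integral_of_le hle, integral_const_mul]
  exact ⟨((intervalIntegrable_iff_integrableOn_Ioc_of_le hle).1 hint).const_mul _, rfl⟩

theorem chiralDensity_moments (hκ : κ ∈ Set.Ioo (0 : ℝ) 1) (m : ℕ) :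
    Integrable (fun x => x ^ m * chiralDensity κ x) ∧
      ∫ x, x ^ m * chiralDensity κ x =
        (1 + (-1) ^ m) * (1 / Real.pi *
          ∫ x in √(1 - 2 * √(κ * (1 - κ)))..√(1 + 2 * √(κ * (1 - κ))),
            x ^ m * (√((2 * √(κ * (1 - κ))) ^ 2 - (x ^ 2 - 1) ^ 2) / x)) := by
  obtain ⟨h1, h2⟩ := chiralHalfDensity_moments hκ m
  have e : (fun x => x ^ m * chiralDensity κ x) = fun x => x ^ m * chiralHalfDensity κ x +
      (-1) ^ m * ((-x) ^ m * chiralHalfDensity κ (-x)) := by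
    ext x
    rw [chiralDensity_eq hκ, mul_add, ← mul_assoc ((-1 : ℝ) ^ m), ← mul_pow]
    simp
  rw [e]
  have h3 : Integrable fun x => (-1 : ℝ) ^ m * ((-x) ^ m * chiralHalfDensity κ (-x)) :=
    h1.comp_neg.const_mul _
  refine ⟨h1.add h3, ?_⟩
  rw [integral_add h1 h3, integral_const_mul,
    integral_neg_eq_self (fun x => x ^ m * chiralHalfDensity κ x), h2]
  ring

/-- The continuous part has mass `1 - √(1 - r ^ 2)`, and `1 - r ^ 2 = (1 - 2 * κ) ^ 2`, so the atom
supplies exactly what is missing. -/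
theorem isProbabilityMeasure_chiralLimit (hκ : κ ∈ Set.Ioo (0 : ℝ) 1) :
    IsProbabilityMeasure (chiralLimit κ) := by
  obtain ⟨hr, hr1, hr2⟩ := two_mul_sqrt_mem hκ
  obtain ⟨h1, h2⟩ := chiralDensity_moments hκ 0
  simp only [pow_zero, one_mul] at h1 h2
  rw [(integral_chiral_mass hr hr1).2, hr2,
    show 1 - 4 * (κ * (1 - κ)) = (1 - 2 * κ) ^ 2 by ring, Real.sqrt_sq_eq_abs] at h2
  have h3 : ∫ x, chiralDensity κ x = 1 - |1 - 2 * κ| := by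
    rw [h2]
    have := Real.pi_pos
    field_simp
    ring
  have h4 : |1 - 2 * κ| ≤ 1 := by
    rw [abs_le]
    constructor <;> linarith [hκ.1, hκ.2]
  refine ⟨?_⟩
  rw [chiralLimit_eq, Measure.add_apply, Measure.smul_apply, withDensity_apply _ MeasurableSet.univ,
    Measure.restrict_univ, ← ofReal_integral_eq_lintegral_ofReal h1
    (ae_of_all _ (chiralDensity_nonneg κ)), h3]
  simp only [measure_univ, smul_eq_mul, mul_one]
  rw [← ENNReal.ofReal_add (abs_nonneg _) (by linarith)]
  simp

theorem ae_abs_le_chiralLimit (hκ : κ ∈ Set.Ioo (0 : ℝ) 1) : ∀ᵐ x ∂(chiralLimit κ), |x| ≤ 2 := by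
  obtain ⟨hr, hr1, -⟩ := two_mul_sqrt_mem hκ
  rw [chiralLimit_eq, ae_add_measure_iff]
  constructor
  · refine Measure.ae_smul_measure ?_ _
    rw [ae_dirac_eq]
    simp
  · rw [ae_withDensity_iff (measurable_chiralDensity κ).ennreal_ofReal]
    refine ae_of_all _ fun x hx => ?_
    have hne : chiralDensity κ x ≠ 0 := fun h => hx (by simp [h])
    have hmem := Set.mem_of_indicator_ne_zero hne
    have h2 : x ^ 2 ≤ 1 + 2 * √(κ * (1 - κ)) := hmem.2
    exact abs_le_of_sq_le_sq (by linarith) (by norm_num)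

theorem integral_pow_chiralLimit (hκ : κ ∈ Set.Ioo (0 : ℝ) 1) (m : ℕ) :
    ∫ x, x ^ m ∂(chiralLimit κ) = |1 - 2 * κ| * 0 ^ m + ∫ x, x ^ m * chiralDensity κ x := by
  have hm := measurable_chiralDensity κ
  have hfin : ∀ᵐ x : ℝ, ENNReal.ofReal (chiralDensity κ x) < ∞ :=
    ae_of_all _ fun x => ENNReal.ofReal_lt_top
  have e : ∀ x, (ENNReal.ofReal (chiralDensity κ x)).toReal = chiralDensity κ x := fun x =>
    ENNReal.toReal_ofReal (chiralDensity_nonneg κ x)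
  rw [chiralLimit_eq, integral_add_measure, integral_smul_measure, integral_dirac,
    ENNReal.toReal_ofReal (abs_nonneg _), integral_withDensity_eq_integral_toReal_smul
    hm.ennreal_ofReal hfin]
  · simp only [e, smul_eq_mul, mul_comm]
  · exact (integrable_dirac (by simp)).smul_measure ENNReal.ofReal_ne_top
  · rw [integrable_withDensity_iff hm.ennreal_ofReal hfin]
    simpa only [e] using (chiralDensity_moments hκ m).1

theorem integral_pow_odd_chiralLimit (hκ : κ ∈ Set.Ioo (0 : ℝ) 1) (k : ℕ) :
    ∫ x, x ^ (2 * k + 1) ∂(chiralLimit κ) = 0 := by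
  rw [integral_pow_chiralLimit hκ, (chiralDensity_moments hκ _).2]
  simp [pow_succ, pow_mul]

theorem integral_pow_even_chiralLimit (hκ : κ ∈ Set.Ioo (0 : ℝ) 1) (k : ℕ) :
    ∫ x, x ^ (2 * k) ∂(chiralLimit κ) = chiralCatalan κ k true + chiralCatalan κ k false := by
  cases k with
  | zero =>
    have := isProbabilityMeasure_chiralLimit hκ
    simp [chiralCatalan]
  | succ k =>
    rw [integral_pow_chiralLimit hκ, (chiralDensity_moments hκ _).2, ← chiralIntegral_eq hκ,
      chiralIntegral]
    have e : ∀ x : ℝ, x ^ (2 * (k + 1)) * (√((2 * √(κ * (1 - κ))) ^ 2 - (x ^ 2 - 1) ^ 2) / x) =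
        x ^ (2 * k + 1) * √((2 * √(κ * (1 - κ))) ^ 2 - (x ^ 2 - 1) ^ 2) := by
      intro x
      by_cases hx : x = 0
      · simp [hx]
      · field_simp
        ring
    simp only [e]
    rw [(even_two_mul (k + 1)).neg_one_pow]
    simp
    ring

end ChiralMoments

/-! ### Chiral matrices as Hermitian families -/

section Chiral

variable {S T : Type*}

/-- The admissible pairs: one row index and one column index. -/
def ChiralAdj (e : (S ⊕ T) × (S ⊕ T)) : Prop := e.1.isLeft ≠ e.2.isLeft

/-- The class of the entry of the chiral matrix at an admissible pair. -/
def chiralClass (r : Setoid (S × T)) : (S ⊕ T) × (S ⊕ T) → Option (Quotient r)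
  | (Sum.inl p, Sum.inr q) => some (Quotient.mk r (p, q))
  | (Sum.inr q, Sum.inl p) => some (Quotient.mk r (p, q))
  | _ => none

theorem chiralClass_swap (r : Setoid (S × T)) (e : (S ⊕ T) × (S ⊕ T)) :
    chiralClass r e.swap = chiralClass r e := by
  rcases e with ⟨_ | _, _ | _⟩ <;> rfl

theorem ChiralAdj.cases {e : (S ⊕ T) × (S ⊕ T)} (he : ChiralAdj e) :
    ∃ p q, e = (Sum.inl p, Sum.inr q) ∨ e = (Sum.inr q, Sum.inl p) := by
  rcases e with ⟨p | q, p' | q'⟩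
  · simp [ChiralAdj] at he
  · exact ⟨p, q', Or.inl rfl⟩
  · exact ⟨p', q, Or.inr rfl⟩
  · simp [ChiralAdj] at he

variable {Ω : Type*} [MeasurableSpace Ω]

/-- Entries of the zero blocks have zeroth absolute moment `0 ^ 0 = 1`, hence the maximum with `1`
in the moment bound. -/
theorem isHermitianFamily_chiral {P : Measure Ω} [IsProbabilityMeasure P] {r : Setoid (S × T)}
    {a : Ω → Matrix S T ℂ} (hmeas : ∀ p q, Measurable fun ω => a ω p q)
    (hindep : IndepOffClasses P r a) (hcenter : ∀ p q, ∫ ω, a ω p q ∂P = 0)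
    (hvar : ∀ p q, ∫ ω, a ω p q * conj (a ω p q) ∂P = 1) {K : ℕ → ℝ}
    (hmom : ∀ k p q, Integrable (fun ω => ‖a ω p q‖ ^ k) P ∧ ∫ ω, ‖a ω p q‖ ^ k ∂P ≤ K k) :
    IsHermitianFamily P ChiralAdj (chiralClass r)
      (fun e ω => chiralMatrix (a ω) e.1 e.2) (fun k => max (K k) 1) := by
  have hlr : ∀ p q ω, chiralMatrix (a ω) (Sum.inl p) (Sum.inr q) = a ω p q := fun _ _ _ => rfl
  have hrl : ∀ p q ω, chiralMatrix (a ω) (Sum.inr q) (Sum.inl p) = conj (a ω p q) :=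
    fun _ _ _ => rfl
  have hll : ∀ p p' ω, chiralMatrix (a ω) (Sum.inl p) (Sum.inl p') = 0 := fun _ _ _ => rfl
  have hrr : ∀ q q' ω, chiralMatrix (a ω) (Sum.inr q) (Sum.inr q') = 0 := fun _ _ _ => rfl
  have hconj : Measurable (conj : ℂ → ℂ) := Complex.continuous_conj.measurable
  have hswap : ∀ (i j : S ⊕ T) ω, chiralMatrix (a ω) j i = conj (chiralMatrix (a ω) i j) :=
    fun i j ω => ((chiralMatrix_isHermitian (a ω)).apply j i).symm
  have hnorm : ∀ (i j : S ⊕ T) ω, ‖chiralMatrix (a ω) j i‖ = ‖chiralMatrix (a ω) i j‖ := by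
    intro i j ω
    rw [hswap i j, RCLike.norm_conj]
  have hmom' : ∀ (e : (S ⊕ T) × (S ⊕ T)) (k : ℕ),
      Integrable (fun ω => ‖chiralMatrix (a ω) e.1 e.2‖ ^ k) P ∧
        ∫ ω, ‖chiralMatrix (a ω) e.1 e.2‖ ^ k ∂P ≤ max (K k) 1 := by
    rintro ⟨p | q, p' | q'⟩ k
    · simp only [hll]
      exact ⟨integrable_const _, by simpa using Or.inr (pow_le_one₀ le_rfl zero_le_one)⟩
    · exact ⟨(hmom k p q').1, (hmom k p q').2.trans (le_max_left _ _)⟩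
    · simp only [hnorm (Sum.inl p') (Sum.inr q)]
      exact ⟨(hmom k p' q).1, (hmom k p' q).2.trans (le_max_left _ _)⟩
    · simp only [hrr]
      exact ⟨integrable_const _, by simpa using Or.inr (pow_le_one₀ le_rfl zero_le_one)⟩
  have hvar' : ∀ p q, ∫ ω, ‖a ω p q‖ ^ 2 ∂P = 1 := by
    intro p q
    have h := hvar p q
    simp only [Complex.mul_conj'] at h
    norm_cast at h
  refine ⟨?_, chiralClass_swap r, ?_, ?_, ?_, ?_, ?_, ?_, fun e k => (hmom' e k).1,
    fun e k => (hmom' e k).2⟩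
  · intro e he
    exact he.symm
  · rintro ⟨p | q, p' | q'⟩
    · simp only [hll]; exact measurable_const
    · exact hmeas p q'
    · simp only [hrl]; exact hconj.comp (hmeas p' q)
    · simp only [hrr]; exact measurable_const
  · rintro ⟨p | q, p' | q'⟩ he ω
    · rfl
    · simp [ChiralAdj] at he
    · simp [ChiralAdj] at he
    · rfl
  · intro e ω
    exact hswap e.1 e.2 ω
  -- The entries outside the class of `e` are a measurable function `G` of the `a`-entries at
  -- positions inequivalent to `(p, q)`, with a conjugation in the lower block; independence passes
  -- through `G`.
  · have key : ∀ p q (e : (S ⊕ T) × (S ⊕ T)), chiralClass r e = some (Quotient.mk r (p, q)) →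
        ∃ G : ({f : S × T // ¬ r.r (p, q) f} → ℂ) →
          ({f : (S ⊕ T) × (S ⊕ T) // ChiralAdj f ∧ chiralClass r f ≠ chiralClass r e} → ℂ),
        Measurable G ∧ (fun ω f => chiralMatrix (a ω) f.1.1 f.1.2) =
          G ∘ fun ω (f : {f : S × T // ¬ r.r (p, q) f}) => a ω f.1.1 f.1.2 := by
      intro p q e he
      have hf : ∀ f : {f : (S ⊕ T) × (S ⊕ T) // ChiralAdj f ∧ chiralClass r f ≠ chiralClass r e},
          ∃ g : ({f : S × T // ¬ r.r (p, q) f} → ℂ) → ℂ, Measurable g ∧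
            ∀ ω, chiralMatrix (a ω) f.1.1 f.1.2 = g fun f => a ω f.1.1 f.1.2 := by
        rintro ⟨f, hf1, hf2⟩
        obtain ⟨p', q', rfl | rfl⟩ := hf1.cases
        · have hn : ¬ r.r (p, q) (p', q') := by
            intro h
            apply hf2
            rw [he]
            exact congrArg some (Quotient.sound (r.symm h))
          exact ⟨fun F => F ⟨(p', q'), hn⟩, measurable_pi_apply _, fun ω => rfl⟩
        · have hn : ¬ r.r (p, q) (p', q') := by
            intro h
            apply hf2
            rw [he]
            exact congrArg some (Quotient.sound (r.symm h))
          exact ⟨fun F => conj (F ⟨(p', q'), hn⟩), hconj.comp (measurable_pi_apply _),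
            fun ω => rfl⟩
      choose g hg1 hg2 using hf
      exact ⟨fun F f => g f F, measurable_pi_lambda _ hg1, by ext ω f; exact hg2 f ω⟩
    intro e he
    obtain ⟨p, q, rfl | rfl⟩ := he.cases
    · obtain ⟨G, hG, hGe⟩ := key p q (Sum.inl p, Sum.inr q) rfl
      rw [hGe]
      exact (hindep (p, q)).comp measurable_id hG
    · obtain ⟨G, hG, hGe⟩ := key p q (Sum.inr q, Sum.inl p) rfl
      rw [hGe]
      exact (hindep (p, q)).comp hconj hG
  · intro e he
    obtain ⟨p, q, rfl | rfl⟩ := he.cases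
    · exact hcenter p q
    · simp only [hrl]
      rw [integral_conj, hcenter, map_zero]
  · intro e he
    obtain ⟨p, q, rfl | rfl⟩ := he.cases
    · exact hvar' p q
    · simp only [hnorm (Sum.inl p) (Sum.inr q)]
      exact hvar' p q

-- If some neighbour `j₀` of `i` is reached in the class `c`, the others are positions in the same
-- row or column equivalent to that one, and (MP2) bounds their number.
open scoped Classical in
theorem card_chiral_column_le [Fintype S] [Fintype T] {r : Setoid (S × T)} {B : ℕ}
    (hB : ∀ (p : S) (q : T), (∀ p' : S, {q' : T | r.r (p, q) (p', q')}.ncard ≤ B) ∧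
      (∀ q' : T, {p' : S | r.r (p, q) (p', q')}.ncard ≤ B))
    (i : S ⊕ T) (c : Option (Quotient r)) :
    (Finset.univ.filter fun j => ChiralAdj (i, j) ∧ chiralClass r (i, j) = c).card ≤ B := by
  rcases Finset.eq_empty_or_nonempty
    (Finset.univ.filter fun j => ChiralAdj (i, j) ∧ chiralClass r (i, j) = c) with h | ⟨j₀, hj₀⟩
  · simp [h]
  · rw [← Set.ncard_coe_finset]
    simp only [Finset.mem_filter, Finset.mem_univ, true_and] at hj₀
    obtain ⟨hadj, rfl⟩ := hj₀
    rcases i with p | q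
    · rcases j₀ with p₀ | q₀
      · simp [ChiralAdj] at hadj
      refine le_trans (Set.ncard_le_ncard (t := Sum.inr '' {q' : T | r.r (p, q₀) (p, q')}) ?_
        (Set.toFinite _)) ((Set.ncard_image_le (Set.toFinite _)).trans ((hB p q₀).1 p))
      intro j hj
      simp only [Finset.coe_filter, Finset.mem_univ, true_and, Set.mem_ofPred_eq] at hj
      rcases j with p' | q'
      · simp [ChiralAdj] at hj
      · refine ⟨q', ?_, rfl⟩
        exact r.symm (Quotient.exact (Option.some.inj hj.2))
    · rcases j₀ with p₀ | q₀
      swap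
      · simp [ChiralAdj] at hadj
      refine le_trans (Set.ncard_le_ncard (t := Sum.inl '' {p' : S | r.r (p₀, q) (p', q)}) ?_
        (Set.toFinite _)) ((Set.ncard_image_le (Set.toFinite _)).trans ((hB p₀ q).2 q))
      intro j hj
      simp only [Finset.coe_filter, Finset.mem_univ, true_and, Set.mem_ofPred_eq] at hj
      rcases j with p' | q'
      · refine ⟨p', ?_, rfl⟩
        exact r.symm (Quotient.exact (Option.some.inj hj.2))
      · simp [ChiralAdj] at hj

/-- A turn at a row vertex is a pair of distinct equivalent positions in that row, a turn at a
column vertex one in that column. These are the two counts of (MP3). -/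
theorem card_turnPairs_chiral_le [Fintype S] [Fintype T] (r : Setoid (S × T)) :
    (turnPairs ChiralAdj (chiralClass r)).card ≤
      {x : S × T × T | r.r (x.1, x.2.1) (x.1, x.2.2) ∧ x.2.1 ≠ x.2.2}.ncard +
      {x : S × S × T | r.r (x.1, x.2.2) (x.2.1, x.2.2) ∧ x.1 ≠ x.2.1}.ncard := by
  rw [← Set.ncard_coe_finset]
  let f : S × T × T → (S ⊕ T) × (S ⊕ T) × (S ⊕ T) := fun x =>
    (Sum.inr x.2.1, Sum.inl x.1, Sum.inr x.2.2)
  let g : S × S × T → (S ⊕ T) × (S ⊕ T) × (S ⊕ T) := fun x =>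
    (Sum.inl x.1, Sum.inr x.2.2, Sum.inl x.2.1)
  refine le_trans (Set.ncard_le_ncard
    (t := f '' {x : S × T × T | r.r (x.1, x.2.1) (x.1, x.2.2) ∧ x.2.1 ≠ x.2.2} ∪
      g '' {x : S × S × T | r.r (x.1, x.2.2) (x.2.1, x.2.2) ∧ x.1 ≠ x.2.1}) ?_ (Set.toFinite _))
    ((Set.ncard_union_le _ _).trans (add_le_add (Set.ncard_image_le (Set.toFinite _))
      (Set.ncard_image_le (Set.toFinite _))))
  rintro ⟨i, j, k⟩ hx
  simp only [turnPairs, Finset.coe_filter, Finset.mem_univ, true_and, Set.mem_ofPred_eq] at hx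
  obtain ⟨hc, hne, h1, h2⟩ := hx
  rcases j with p | q
  · rcases i with _ | q₁
    · simp [ChiralAdj] at h1
    rcases k with _ | q₂
    · simp [ChiralAdj] at h2
    exact Or.inl ⟨(p, q₁, q₂), ⟨Quotient.exact (Option.some.inj hc), fun h => hne (congrArg _ h)⟩,
      rfl⟩
  · rcases i with p₁ | _
    swap
    · simp [ChiralAdj] at h1
    rcases k with p₂ | _
    swap
    · simp [ChiralAdj] at h2
    exact Or.inr ⟨(p₁, p₂, q), ⟨Quotient.exact (Option.some.inj hc), fun h => hne (congrArg _ h)⟩,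
      rfl⟩

-- Equivalent pairs of positions are counted row by row, which brings in the maximum of (MP1). The
-- factor `4` counts the directions of the two steps.
open scoped Classical in
theorem card_stepPairs_chiral_le [Fintype S] [Fintype T] (r : Setoid (S × T)) :
    (stepPairs ChiralAdj (chiralClass r)).card ≤ 4 * ((Finset.univ.sup fun p : S =>
      {x : T × S × T | r.r (p, x.1) (x.2.1, x.2.2)}.ncard) * Fintype.card S) := by
  set E : Finset (S × T × S × T) :=
    Finset.univ.filter fun x => r.r (x.1, x.2.1) (x.2.2.1, x.2.2.2) with hE
  have hcardE : E.card ≤ (Finset.univ.sup fun p : S =>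
      {x : T × S × T | r.r (p, x.1) (x.2.1, x.2.2)}.ncard) * Fintype.card S := by
    rw [← Finset.card_univ (α := S)]
    refine Finset.card_le_mul_card_image_of_maps_to (f := Prod.fst) (fun _ _ => Finset.mem_univ _)
      _ fun p hp => ?_
    refine le_trans ?_ (Finset.le_sup (f := fun p : S =>
      {x : T × S × T | r.r (p, x.1) (x.2.1, x.2.2)}.ncard) hp)
    rw [← Set.ncard_coe_finset]
    refine le_trans (Set.ncard_le_ncard
      (t := (fun x => (p, x)) '' {x : T × S × T | r.r (p, x.1) (x.2.1, x.2.2)}) ?_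
      (Set.toFinite _)) (Set.ncard_image_le (Set.toFinite _))
    rintro ⟨p', x⟩ hx
    simp only [hE, Finset.coe_filter, Finset.mem_filter, Finset.mem_univ, true_and,
      Set.mem_ofPred_eq] at hx
    obtain ⟨hx, rfl⟩ := hx
    exact ⟨x, hx, rfl⟩
  let o : Bool → S → T → (S ⊕ T) × (S ⊕ T) := fun b p q =>
    if b then (Sum.inl p, Sum.inr q) else (Sum.inr q, Sum.inl p)
  have ho : ∀ e : (S ⊕ T) × (S ⊕ T), ChiralAdj e → ∃ b p q, e = o b p q ∧
      chiralClass r e = some (Quotient.mk r (p, q)) := by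
    intro e he
    obtain ⟨p, q, rfl | rfl⟩ := he.cases
    · exact ⟨true, p, q, rfl, rfl⟩
    · exact ⟨false, p, q, rfl, rfl⟩
  have hsub : stepPairs ChiralAdj (chiralClass r) ⊆
      ((Finset.univ : Finset (Bool × Bool)) ×ˢ E).image fun x =>
        (o x.1.1 x.2.1 x.2.2.1, o x.1.2 x.2.2.2.1 x.2.2.2.2) := by
    rintro ⟨e, e'⟩ hx
    simp only [stepPairs, Finset.mem_filter, Finset.mem_univ, true_and] at hx
    obtain ⟨hc, h1, h2⟩ := hx
    obtain ⟨b, p, q, he, hce⟩ := ho e h1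
    obtain ⟨b', p', q', he', hce'⟩ := ho e' h2
    refine Finset.mem_image.2 ⟨((b, b'), (p, q, p', q')), ?_, by rw [he, he']⟩
    rw [hce, hce'] at hc
    simp only [Finset.mem_product, Finset.mem_univ, true_and, hE, Finset.mem_filter]
    exact Quotient.exact (Option.some.inj hc)
  refine (Finset.card_le_card hsub).trans (Finset.card_image_le.trans ?_)
  rw [Finset.card_product]
  exact Nat.mul_le_mul (by simp) hcardE

end Chiral

/-! ### The multiplicity conditions imply the assumptions on Hermitian sequences -/

section ChiralSequence

theorem isHermitianSequence_chiral {κ : ℝ} {δ : ℕ} (hδ : 0 < δ) {s t : ℕ → ℕ}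
    (hst : ∀ n, s n + t n = n) (hs : Tendsto (fun n => (s n : ℝ) / n) atTop (𝓝 κ))
    {Ω : ℕ → Type*} [∀ n, MeasurableSpace (Ω n)] {P : ∀ n, Measure (Ω n)}
    [∀ n, IsProbabilityMeasure (P n)]
    {r : ∀ n, Setoid (Fin (δ * s n) × Fin (δ * t n))}
    {a : ∀ n, Ω n → Matrix (Fin (δ * s n)) (Fin (δ * t n)) ℂ}
    (hmeas : ∀ n p q, Measurable fun ω => a n ω p q)
    (hindep : ∀ n, IndepOffClasses (P n) (r n) (a n))
    (hMP1 : MP1 (fun n => δ * s n) (fun n => δ * t n) r)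
    {B : ℕ} (hMP2 : ∀ (n : ℕ) (p : Fin (δ * s n)) (q : Fin (δ * t n)),
      (∀ p' : Fin (δ * s n), {q' : Fin (δ * t n) | (r n).r (p, q) (p', q')}.ncard ≤ B) ∧
      (∀ q' : Fin (δ * t n), {p' : Fin (δ * s n) | (r n).r (p, q) (p', q')}.ncard ≤ B))
    (hMP3 : MP3 (fun n => δ * s n) (fun n => δ * t n) r)
    (hcenter : ∀ n p q, ∫ ω, a n ω p q ∂(P n) = 0)
    (hvar : ∀ n p q, ∫ ω, a n ω p q * conj (a n ω p q) ∂(P n) = 1) {K : ℕ → ℝ}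
    (hmom : ∀ n k p q,
      Integrable (fun ω => ‖a n ω p q‖ ^ k) (P n) ∧ ∫ ω, ‖a n ω p q‖ ^ k ∂(P n) ≤ K k) :
    IsHermitianSequence P (fun _ => ChiralAdj) (fun n => chiralClass (r n))
      (fun n e ω => chiralMatrix (a n ω) e.1 e.2) (fun _ i => i.isLeft)
      (fun k => max (K k) 1) B κ := by
  have hcard : ∀ n, Fintype.card (Fin (δ * s n) ⊕ Fin (δ * t n)) = δ * n := by
    intro n
    rw [Fintype.card_sum, Fintype.card_fin, Fintype.card_fin, ← mul_add, hst]
  have hδ' : (0 : ℝ) < δ := Nat.cast_pos.2 hδ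
  have hδ1 : (1 : ℝ) ≤ δ := by exact_mod_cast hδ
  have ht : Tendsto (fun n => (t n : ℝ) / n) atTop (𝓝 (1 - κ)) := by
    refine (hs.const_sub 1).congr' ?_
    filter_upwards [eventually_gt_atTop 0] with n hn
    have hn' : (0 : ℝ) < n := Nat.cast_pos.2 hn
    have : (s n : ℝ) + t n = n := by exact_mod_cast hst n
    field_simp
    linarith
  -- The multiplicity conditions compare with powers of `n`, the walk counts with powers of `δ n`;
  -- the latter are larger.
  have hle2 : ∀ n : ℕ, (n : ℝ) ^ 2 ≤ ((δ * n : ℕ) : ℝ) ^ 2 := by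
    intro n
    have : (n : ℝ) ≤ ((δ * n : ℕ) : ℝ) := by exact_mod_cast Nat.le_mul_of_pos_left n hδ
    gcongr
  refine ⟨fun n => isHermitianFamily_chiral (hmeas n) (hindep n) (hcenter n) (hvar n) (hmom n),
    fun n u v => Iff.rfl, fun n i c => by
      convert card_chiral_column_le (hMP2 n) i c, ?_, ?_, ?_, ?_⟩
  · simp only [hcard]
    exact tendsto_natCast_atTop_atTop.comp
      (tendsto_id.const_mul_atTop' hδ)
  · intro b
    simp only [hcard]
    cases b
    · have e : ∀ n, ((Finset.univ.filter fun v : Fin (δ * s n) ⊕ Fin (δ * t n) =>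
          v.isLeft = false).card) = δ * t n := by
        intro n
        have : (Finset.univ.filter fun v : Fin (δ * s n) ⊕ Fin (δ * t n) => v.isLeft = false) =
            Finset.univ.map ⟨Sum.inr, Sum.inr_injective⟩ := by
          ext v
          rcases v with v | v <;> simp
        rw [this, Finset.card_map, Finset.card_univ, Fintype.card_fin]
      have : chiralCatalan κ 0 false = 1 - κ := by simp [chiralCatalan]
      rw [this]
      refine ht.congr fun n => ?_
      have := e n
      rw [show ((Finset.univ.filter fun v : Fin (δ * s n) ⊕ Fin (δ * t n) =>
          v.isLeft = false).card) = δ * t n by convert this]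
      push_cast
      rw [mul_div_mul_left _ _ hδ'.ne']
    · have e : ∀ n, ((Finset.univ.filter fun v : Fin (δ * s n) ⊕ Fin (δ * t n) =>
          v.isLeft = true).card) = δ * s n := by
        intro n
        have : (Finset.univ.filter fun v : Fin (δ * s n) ⊕ Fin (δ * t n) => v.isLeft = true) =
            Finset.univ.map ⟨Sum.inl, Sum.inl_injective⟩ := by
          ext v
          rcases v with v | v <;> simp
        rw [this, Finset.card_map, Finset.card_univ, Fintype.card_fin]
      have : chiralCatalan κ 0 true = κ := by simp [chiralCatalan]
      rw [this]
      refine hs.congr fun n => ?_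
      have := e n
      rw [show ((Finset.univ.filter fun v : Fin (δ * s n) ⊕ Fin (δ * t n) =>
          v.isLeft = true).card) = δ * s n by convert this]
      push_cast
      rw [mul_div_mul_left _ _ hδ'.ne']
  · have h := (hMP3.1.add hMP3.2).tendsto_div_nhds_zero
    refine squeeze_zero' (Eventually.of_forall fun n => by positivity) ?_ h
    filter_upwards [eventually_gt_atTop 0] with n hn
    have hn' : (0 : ℝ) < n := Nat.cast_pos.2 hn
    rw [hcard]
    refine div_le_div₀ (by positivity) ?_ (by positivity) (hle2 n)
    exact_mod_cast card_turnPairs_chiral_le (r n)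
  · have h := hMP1.tendsto_div_nhds_zero.const_mul 4
    rw [mul_zero] at h
    refine squeeze_zero' (Eventually.of_forall fun n => by positivity) ?_ h
    filter_upwards [eventually_gt_atTop 0] with n hn
    have hn' : (0 : ℝ) < n := Nat.cast_pos.2 hn
    have hpos : (0 : ℝ) < ((δ * n : ℕ) : ℝ) := by positivity
    rw [hcard, div_le_iff₀ (by positivity)]
    set m := Finset.univ.sup fun p : Fin (δ * s n) =>
      {x : Fin (δ * t n) × Fin (δ * s n) × Fin (δ * t n) |
        (r n).r (p, x.1) (x.2.1, x.2.2)}.ncard with hm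
    have h1 : ((stepPairs ChiralAdj (chiralClass (r n))).card : ℝ) ≤
        4 * ((m : ℝ) * ((δ * s n : ℕ) : ℝ)) := by
      have := card_stepPairs_chiral_le (r n)
      rw [Fintype.card_fin] at this
      exact_mod_cast this
    have h2 : ((δ * s n : ℕ) : ℝ) ≤ ((δ * n : ℕ) : ℝ) := by
      have := hst n
      exact_mod_cast Nat.mul_le_mul_left δ (by omega)
    calc ((stepPairs ChiralAdj (chiralClass (r n))).card : ℝ)
        ≤ 4 * ((m : ℝ) * ((δ * n : ℕ) : ℝ)) := h1.trans (by gcongr)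
      _ = 4 * ((m : ℝ) / (n : ℝ) ^ 2) * ((n : ℝ) ^ 2 * ((δ * n : ℕ) : ℝ)) := by
          field_simp
      _ ≤ 4 * ((m : ℝ) / (n : ℝ) ^ 2) * (((δ * n : ℕ) : ℝ) ^ 2 * ((δ * n : ℕ) : ℝ)) := by
          have := hle2 n
          gcongr
      _ = _ := by ring

end ChiralSequence

/-! ### Moments of the mean empirical measure and conclusion -/

theorem chiralMatrix_smul {ι κ : Type*} (c : ℝ) (X : Matrix ι κ ℂ) :
    chiralMatrix ((c : ℂ) • X) = (c : ℂ) • chiralMatrix X := by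
  simp [chiralMatrix, Matrix.fromBlocks_smul, Matrix.conjTranspose_smul]

theorem trace_chiralMatrix_smul_pow {ι κ : Type*} [Fintype ι] [Fintype κ] [DecidableEq ι]
    [DecidableEq κ] (c : ℝ) (X : Matrix ι κ ℂ) (m : ℕ) :
    (chiralMatrix ((c : ℂ) • X) ^ m).trace = (c : ℂ) ^ m *
      ∑ p ∈ closedLists (ι ⊕ κ) m,
        ((steps p).map fun e => chiralMatrix X e.1 e.2).prod := by
  rw [chiralMatrix_smul, smul_pow, Matrix.trace_smul, Matrix.trace_pow_eq_sum_lists, smul_eq_mul]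

theorem IsHermitianSequence.tendsto_moments {κ : ℝ} {δ : ℕ} (hδ : 0 < δ) {s t : ℕ → ℕ}
    (hst : ∀ n, s n + t n = n) (hκ : κ ∈ Set.Ioo (0 : ℝ) 1)
    {Ω : ℕ → Type*} [∀ n, MeasurableSpace (Ω n)] {P : ∀ n, Measure (Ω n)}
    [∀ n, IsProbabilityMeasure (P n)]
    {r : ∀ n, Setoid (Fin (δ * s n) × Fin (δ * t n))}
    {a X : ∀ n, Ω n → Matrix (Fin (δ * s n)) (Fin (δ * t n)) ℂ} {K : ℕ → ℝ} {B : ℕ}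
    (h : IsHermitianSequence P (fun _ => ChiralAdj) (fun n => chiralClass (r n))
      (fun n e ω => chiralMatrix (a n ω) e.1 e.2) (fun _ i => i.isLeft) K B κ)
    (hX : ∀ n ω, X n ω = (((√((δ * n : ℕ) : ℝ))⁻¹ : ℝ) : ℂ) • a n ω) :
    (∀ n, 0 < n → IsProbabilityMeasure (meanEmpiricalMeasure (P n) (X n)) ∧
      ∀ m : ℕ, Integrable (fun x => x ^ m) (meanEmpiricalMeasure (P n) (X n))) ∧
    ∀ m : ℕ, Tendsto (fun n => ∫ x, x ^ m ∂(meanEmpiricalMeasure (P n) (X n))) atTop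
      (𝓝 (∫ x, x ^ m ∂(chiralLimit κ))) := by
  have hcard : ∀ n, Fintype.card (Fin (δ * s n) ⊕ Fin (δ * t n)) = δ * n := by
    intro n
    rw [Fintype.card_sum, Fintype.card_fin, Fintype.card_fin, ← mul_add, hst]
  have htr : ∀ n m ω, (chiralMatrix (X n ω) ^ m).trace =
      (((√((δ * n : ℕ) : ℝ))⁻¹ : ℝ) : ℂ) ^ m *
        ∑ p ∈ closedLists (Fin (δ * s n) ⊕ Fin (δ * t n)) m,
          pairProd (fun e ω => chiralMatrix (a n ω) e.1 e.2) (steps p) ω := by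
    intro n m ω
    rw [hX, trace_chiralMatrix_smul_pow]
    rfl
  have hint : ∀ n m, Integrable (fun ω => (chiralMatrix (X n ω) ^ m).trace) (P n) := by
    intro n m
    simp only [htr]
    exact (integrable_finsetSum _ fun p _ => (h.family n).integrable_pairProd _).const_mul _
  have hmeas : ∀ n i j, Measurable fun ω => chiralMatrix (X n ω) i j := by
    intro n i j
    have : (fun ω => chiralMatrix (X n ω) i j) =
        fun ω => (((√((δ * n : ℕ) : ℝ))⁻¹ : ℝ) : ℂ) * chiralMatrix (a n ω) i j := by
      ext ω
      rw [hX, chiralMatrix_smul]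
      rfl
    rw [this]
    exact ((h.family n).measurable (i, j)).const_mul _
  -- For `n = 0` the matrix is empty and its empirical measure is zero, not a probability measure.
  have hbind : ∀ n, 0 < n → _ := fun n hn =>
    have : Nonempty (Fin (δ * s n) ⊕ Fin (δ * t n)) := by
      rw [← Fintype.card_pos_iff, hcard]
      positivity
    bind_empiricalMeasure (P n) (hmeas n) (fun ω => chiralMatrix_isHermitian (X n ω)) (hint n)
  refine ⟨fun n hn => ⟨(hbind n hn).1, fun m => ((hbind n hn).2 m).1⟩, fun m => ?_⟩
  have hval : ∀ n, 0 < n → ((∫ x, x ^ m ∂(meanEmpiricalMeasure (P n) (X n)) : ℝ) : ℂ) =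
      ((δ * n : ℕ) : ℂ)⁻¹ * ((((√((δ * n : ℕ) : ℝ))⁻¹ : ℝ) : ℂ) ^ m *
        ∑ p ∈ closedLists (Fin (δ * s n) ⊕ Fin (δ * t n)) m,
          ∫ ω, pairProd (fun e ω => chiralMatrix (a n ω) e.1 e.2) (steps p) ω ∂(P n)) := by
    intro n hn
    rw [meanEmpiricalMeasure, ((hbind n hn).2 m).2, hcard]
    simp only [htr]
    rw [integral_const_mul, integral_finsetSum _ fun p _ => (h.family n).integrable_pairProd _]
  have hC : Tendsto (fun n => ((∫ x, x ^ m ∂(meanEmpiricalMeasure (P n) (X n)) : ℝ) : ℂ)) atTop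
      (𝓝 ((∫ x, x ^ m ∂(chiralLimit κ) : ℝ) : ℂ)) := by
    rcases Nat.even_or_odd' m with ⟨k, rfl | rfl⟩
    · rw [integral_pow_even_chiralLimit hκ]
      refine (h.tendsto_even k).congr' ?_
      filter_upwards [eventually_gt_atTop 0] with n hn
      have hpos : (0 : ℝ) < ((δ * n : ℕ) : ℝ) := by positivity
      have hsq : ((√((δ * n : ℕ) : ℝ) : ℝ) : ℂ) ^ 2 = ((δ * n : ℕ) : ℂ) := by
        rw [← Complex.ofReal_pow, Real.sq_sqrt hpos.le, Complex.ofReal_natCast]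
      -- The entry scaling to the power `2k` and the average over eigenvalues combine to `(δ n) ^
      -- (-(k + 1))`.
      rw [hval n hn, hcard, Complex.ofReal_inv, inv_pow, pow_mul, hsq, pow_succ]
      have hne : ((δ * n : ℕ) : ℂ) ≠ 0 := by
        rw [← Complex.ofReal_natCast]
        exact_mod_cast hpos.ne'
      field_simp
    · rw [integral_pow_odd_chiralLimit hκ, Complex.ofReal_zero]
      refine (h.tendsto_odd k).congr' ?_
      filter_upwards [eventually_gt_atTop 0] with n hn
      have hpos : (0 : ℝ) < ((δ * n : ℕ) : ℝ) := by positivity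
      have hsq : ((√((δ * n : ℕ) : ℝ) : ℝ) : ℂ) ^ 2 = ((δ * n : ℕ) : ℂ) := by
        rw [← Complex.ofReal_pow, Real.sq_sqrt hpos.le, Complex.ofReal_natCast]
      rw [hval n hn, hcard, Complex.ofReal_inv, inv_pow, pow_succ _ (2 * k), pow_mul, hsq,
        Complex.ofReal_mul, Complex.ofReal_pow, Complex.ofReal_natCast, pow_succ]
      have hne : ((δ * n : ℕ) : ℂ) ≠ 0 := by
        rw [← Complex.ofReal_natCast]
        exact_mod_cast hpos.ne'
      have hne2 : ((√((δ * n : ℕ) : ℝ) : ℝ) : ℂ) ≠ 0 := by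
        exact_mod_cast (Real.sqrt_pos.2 hpos).ne'
      field_simp
  have := (Complex.continuous_re.tendsto _).comp hC
  simpa [Function.comp_def] using this

theorem mainTheorem2 (C : ChiralClass) (κ : ℝ) (hκ : κ ∈ Set.Ioo (0 : ℝ) 1)
    (s t : ℕ → ℕ) (hst : ∀ n, s n + t n = n)
    (hs : Tendsto (fun n => (s n : ℝ) / n) atTop (𝓝 κ))
    {Ω : ℕ → Type*} [∀ n, MeasurableSpace (Ω n)] (P : ∀ n, Measure (Ω n))
    [∀ n, IsProbabilityMeasure (P n)]
    (r : ∀ n, Setoid (Fin (C.delta * s n) × Fin (C.delta * t n)))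
    (a : ∀ n, Ω n → Matrix (Fin (C.delta * s n)) (Fin (C.delta * t n)) ℂ)
    (hmeas : ∀ n p q, Measurable fun ω => a n ω p q)
    (hindep : ∀ n, IndepOffClasses (P n) (r n) (a n))
    (hMP1 : MP1 (fun n => C.delta * s n) (fun n => C.delta * t n) r)
    (hMP2 : MP2 (fun n => C.delta * s n) (fun n => C.delta * t n) r)
    (hMP3 : MP3 (fun n => C.delta * s n) (fun n => C.delta * t n) r)
    (hcenter : ∀ n p q, ∫ ω, a n ω p q ∂(P n) = 0)
    (hvar : ∀ n p q, ∫ ω, a n ω p q * conj (a n ω p q) ∂(P n) = 1)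
    (hmom : ∀ k : ℕ, ∃ K : ℝ, ∀ n p q,
      Integrable (fun ω => ‖a n ω p q‖ ^ k) (P n) ∧ ∫ ω, ‖a n ω p q‖ ^ k ∂(P n) ≤ K)
    (X : ∀ n, Ω n → Matrix (Fin (C.delta * s n)) (Fin (C.delta * t n)) ℂ)
    (hX : ∀ n ω, X n ω = (((√((C.delta * n : ℕ) : ℝ))⁻¹ : ℝ) : ℂ) • a n ω)
    (hclass : ∀ n ω, X n ω ∈ C.blocks (s n) (t n)) :
    IsProbabilityMeasure (chiralLimit κ) ∧
    ∀ f : ℝ →ᵇ ℝ,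
      Tendsto (fun n => ∫ x, f x ∂(meanEmpiricalMeasure (P n) (X n))) atTop
        (𝓝 (∫ x, f x ∂(chiralLimit κ))) := by
  have hδ : 0 < C.delta := by cases C <;> simp [ChiralClass.delta]
  have := isProbabilityMeasure_chiralLimit hκ
  refine ⟨this, fun f => ?_⟩
  obtain ⟨B, hB⟩ := hMP2
  choose K hK using hmom
  have h := isHermitianSequence_chiral hδ hst hs hmeas hindep hMP1 hB hMP3 hcenter hvar
    (fun n k p q => hK k n p q)
  obtain ⟨h1, h2⟩ := h.tendsto_moments hδ hst hκ hX
  refine tendsto_integral_of_tendsto_moments (ae_abs_le_chiralLimit hκ) ?_ ?_ h2 f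
  · filter_upwards [eventually_gt_atTop 0] with n hn using (h1 n hn).1
  · filter_upwards [eventually_gt_atTop 0] with n hn using (h1 n hn).2
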